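/- **Setting.** For a symbol $a$ on $\mathbb{R}^3$ let $a(D)=\mathcal{F}^{-1}a\mathcal{F}$ be the Fourier multiplier (plane waves $e^{ix\cdot\xi}$) acting on tempered distributions; $e^{it\Delta}$ is the multiplier with symbol $e^{-it|\xi|^2}$ and $\|f\|_{H^s}=\|\langle\nabla\rangle^s f\|_{L^2}$, $\langle\xi\rangle=(1+|\xi|^2)^{1/2}$. *Wiener randomization.* Fix $\psi\in C^\infty(\mathbb{R}^3;\mathbb{R})$ with $\operatorname{supp}\psi\subset[-1,1]^3$ and $\sum_{k\in\mathbb{Z}^3}\psi(\xi-k)=1$ for all $\xi$, let $Q_k$ be the multiplier with symbol $\psi(\cdot-k)$, and let $\{g_k\}_{k\in\mathbb{Z}^3}$ be independent centred (real or complex) Gaussian random variables on a probability space $(\Omega,\mathbb{P})$ with $\mathbb{E}|g_k|^2\le\kappa$ for all $k$, for a fixed $\kappa$. For $f_0\in L^2(\mathbb{R}^3)$ put $f_0^\omega=\sum_{k\in\mathbb{Z}^3}g_k(\omega)\,Q_kf_0$. *I-operator.* For $1/2<\sigma<1$ and $N>0$, $I=I_N$ is a Fourier multiplier with a smooth radial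 symbol $m:\mathbb{R}^3\to[0,1]$ such that $m(\xi)=1$ if $|\xi|\le N$ and $m(\xi)=(N/|\xi|)^{1-\sigma}$ if $|\xi|\ge 2N$. **Proposition.** Let $s>1/4$ and $1/2<\sigma<1$ with $\sigma<2s$. Let $r\in(4,\infty]$ and $0<\delta<\min(s,\tfrac12)-\tfrac{\sigma}{2}$. Then there exist $N_0,C,c>0$, depending only on $r,\delta,s,\sigma$ (and on the fixed $\psi$ and $\kappa$ of the randomization), such that for all radially symmetric $f_0\in H^s(\mathbb{R}^3)$, all $\lambda>0$ and all $N\ge N_0$, $$\mathbb{P}\Big(\big\{\omega\in\Omega:\ \|\nabla I e^{it\Delta}f_0^\omega\|_{L^2_t(\mathbb{R};L^r_x(\mathbb{R}^3))}>\lambda\big\}\Big)\le C\exp\Big(-c\lambda^2\big(N^{-\delta}N^{\frac{1-\sigma}{2}}\|f_0\|_{H^s}\big)^{-2}\Big),$$ where the $L^r_x$ norm of a distribution that is not an $L^r$ function is $+\infty$ (for $f_0=0$ the left-hand side is $0$ and the bound is read as $\le C$). -/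

import Mathlib

open MeasureTheory ProbabilityTheory TemperedDistribution
open scoped ENNReal SchwartzMap FourierTransform LineDeriv

noncomputable section

/-- The space `ℝ³` with its Euclidean norm. -/
abbrev R3 := EuclideanSpace ℝ (Fin 3)

/-- The Fourier multiplier `a(D)`, `D = -i∇`, on tempered distributions. Symbols are functions of
the angular frequency (plane waves `e^{i x·ξ}`), whereas Mathlib's Fourier transform uses
`e^{2πi x·ξ}`; hence the dilation by `2π`. -/
def multD (a : R3 → ℂ) : 𝓢'(R3, ℂ) →L[ℂ] 𝓢'(R3, ℂ) :=
  fourierMultiplierCLM ℂ (fun ξ : R3 => a ((2 * Real.pi) • ξ))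

/-- The free Schrödinger propagator `e^{itΔ}`, with symbol `e^{-it|ξ|²}`. -/
def schrodinger (t : ℝ) : 𝓢'(R3, ℂ) →L[ℂ] 𝓢'(R3, ℂ) :=
  multD (fun ξ => Complex.exp (-(Complex.I * (t : ℂ) * ((‖ξ‖ ^ 2 : ℝ) : ℂ))))

/-- The `H^s(ℝ³)` norm `‖⟨∇⟩^s f‖_{L²}`, in `[0,∞]`, of an `L²` function, with
`⟨ξ⟩ = (1 + |ξ|²)^{1/2}`, computed on the Fourier side by Plancherel. -/
def hsNorm (s : ℝ) (f : Lp ℂ 2 (volume : Measure R3)) : ℝ≥0∞ :=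
  eLpNorm (fun ξ : R3 =>
    (((1 + ‖(2 * Real.pi) • ξ‖ ^ 2) ^ (s / 2) : ℝ) : ℂ) *
      (𝓕 f : Lp ℂ 2 (volume : Measure R3)) ξ) 2 volume

/-- `f` is radially symmetric (up to a null set). -/
def IsRadial (f : Lp ℂ 2 (volume : Measure R3)) : Prop :=
  ∃ F : ℝ → ℂ, ∀ᵐ x : R3, f x = F ‖x‖

/-- The lattice point `k ∈ ℤ³` as a vector of `ℝ³`. -/
def latticePoint (k : Fin 3 → ℤ) : R3 := WithLp.toLp 2 (fun i => (k i : ℝ))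

/-- The profile `ψ` of the Wiener decomposition: smooth, supported in the cube `[-1,1]³`, and its
integer translates form a partition of unity. -/
structure IsWienerProfile (ψ : R3 → ℝ) : Prop where
  smooth : ContDiff ℝ (⊤ : ℕ∞) ψ
  support : ∀ ξ, ψ ξ ≠ 0 → ∀ i, |ξ i| ≤ 1
  partition : ∀ ξ, HasSum (fun k : Fin 3 → ℤ => ψ (ξ - latticePoint k)) 1

/-- The unit-scale frequency projector `Q_k`, with symbol `ψ(ξ - k)`. -/
def wienerProj (ψ : R3 → ℝ) (k : Fin 3 → ℤ) : 𝓢'(R3, ℂ) →L[ℂ] 𝓢'(R3, ℂ) :=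
  multD (fun ξ => (ψ (ξ - latticePoint k) : ℂ))

/-- Independent centred complex Gaussian variables indexed by `ℤ³`, with `E|g_k|² ≤ κ`. Gaussian
laws on `ℂ = ℝ²` may be degenerate, so real-valued Gaussian variables are included. -/
structure IsGaussianFamily {Ω : Type*} [MeasurableSpace Ω] (P : Measure Ω) (κ : ℝ)
    (g : (Fin 3 → ℤ) → Ω → ℂ) : Prop where
  measurable : ∀ k, Measurable (g k)
  gaussian : ∀ k, IsGaussian (P.map (g k))
  mean_zero : ∀ k, ∫ ω, g k ω ∂P = 0
  variance_le : ∀ k, ∫ ω, ‖g k ω‖ ^ 2 ∂P ≤ κ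
  indep : iIndepFun g P

/-- The Wiener randomization `f₀^ω = ∑_k g_k(ω) Q_k f₀`, for the values `a k = g_k(ω)`. -/
def wienerRandomization (ψ : R3 → ℝ) (a : (Fin 3 → ℤ) → ℂ)
    (f₀ : Lp ℂ 2 (volume : Measure R3)) : 𝓢'(R3, ℂ) :=
  ∑' k : Fin 3 → ℤ, a k • wienerProj ψ k (f₀ : 𝓢'(R3, ℂ))

/-- `m` is a symbol of the I-operator at regularity `σ` and frequency `N`: smooth, radial, with
values in `[0,1]`, equal to `1` for `|ξ| ≤ N` and to `(N/|ξ|)^{1-σ}` for `|ξ| ≥ 2N`. -/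
structure IsISymbol (σ N : ℝ) (m : R3 → ℝ) : Prop where
  smooth : ContDiff ℝ (⊤ : ℕ∞) m
  radial : ∀ ξ η, ‖ξ‖ = ‖η‖ → m ξ = m η
  nonneg : ∀ ξ, 0 ≤ m ξ
  le_one : ∀ ξ, m ξ ≤ 1
  low : ∀ ξ, ‖ξ‖ ≤ N → m ξ = 1
  high : ∀ ξ, 2 * N ≤ ‖ξ‖ → m ξ = (N / ‖ξ‖) ^ (1 - σ)

/-- The I-operator with symbol `m`. -/
def iOperator (m : R3 → ℝ) : 𝓢'(R3, ℂ) →L[ℂ] 𝓢'(R3, ℂ) :=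
  multD (fun ξ => (m ξ : ℂ))

/-- The distributional gradient, as the triple of its components. -/
def gradient3 (u : 𝓢'(R3, ℂ)) (i : Fin 3) : 𝓢'(R3, ℂ) :=
  ∂_{(EuclideanSpace.single i (1 : ℝ) : R3)} u

/-- The `L^r(ℝ³; ℂ³)` norm, in `[0,∞]`, of a triple of tempered distributions: the norm of the
(almost everywhere unique) `L^r` function that represents it, and `∞` if there is none. -/
def distLpNorm (r : ℝ≥0∞) (T : Fin 3 → 𝓢'(R3, ℂ)) : ℝ≥0∞ :=
  ⨅ (h : R3 → EuclideanSpace ℂ (Fin 3))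
    (_ : MemLp h r volume ∧ ∀ (i : Fin 3) (φ : 𝓢(R3, ℂ)), T i φ = ∫ x, φ x * h x i),
    eLpNorm h r volume

/-- The mixed norm `L²_t(ℝ; L^r_x(ℝ³))`, in `[0,∞]`. -/
def mixedNorm (r : ℝ≥0∞) (T : ℝ → Fin 3 → 𝓢'(R3, ℂ)) : ℝ≥0∞ :=
  (∫⁻ t, distLpNorm r (T t) ^ 2) ^ (1 / 2 : ℝ)

end

/-! The bound is a Gaussian large deviation estimate resting on one deterministic inequality, for
the square function of the blocks Q_k. For n ≥ max(2, p), Minkowski's inequality bounds the n-th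
moment of the L²_t L^p_x norm of ∑ g_k F_k by a multiple of √n times the L²_t L^p_x norm of (∑
|F_k|²)^{1/2} (`IsGaussianFamily.lintegral_mixed_sum_le`). Moments growing like √n give the Gaussian
tail (`measureReal_lt_le_of_moments`).

For the square function, let u be a component of the gradient of a radial free solution. The symbols
of the Q_k are unit-scale translates with bounded overlap, so ∑ |Q_k u(x)|² ≤ C ∫ (1+|y|²)⁻²
|u(x+y)|² dy (`exists_sum_enorm_sq_wiener_le`). Radial symmetry bounds |u(t,x)|² by a function
b(t,|x|). The L^q norm, q = p/2, of the unit-scale average of b is at most a constant times ∫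
ρ²(1+ρ²)^{-(1-1/q)} b(t,ρ) dρ (`lintegral_rpow_weight_mul_radial_le`). Plancherel in time gives
local smoothing: ∫ b(t,ρ) dt is at most ρ⁻² times a squared homogeneous H^{1/2} norm
(`lintegral_enorm_sq_freeEvolution_coord_le`). The powers of ρ cancel, and what is left, ∫
(1+ρ²)^{-(1-1/q)} dρ, converges because q > 2, that is p > 4. The full gradient has thus cost only
half a derivative.

The remaining work is summation over dyadic shells |k| ~ 2^j. Bernstein's inequality replaces r by a
finite p > 4 at the price of 2^{εj}, a loss needed only for r = ∞. Put β = (1-σ)/2 - δ and 4ε = 2s -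
σ - 2δ. On the j-th shell |ξ| m² is at most a constant times N^{2β} 2^{-4εj} ⟨ξ⟩^{2s}, so the square
function there is bounded by N^β 2^{-2εj} ‖f₀‖_{H^s}. After the Bernstein loss the sum over j is
geometric with ratio 2^{-ε}. The two upper bounds on δ are what give β ≥ 0 and ε > 0. -/

/-! ### Minkowski's inequality; tails and moments -/

/-- **Minkowski's integral inequality** for functions with values in `[0,∞]`. -/
theorem lintegral_rpow_lintegral_le {α β : Type*} [MeasurableSpace α] [MeasurableSpace β]
    {μ : Measure α} {ν : Measure β} [SFinite μ] [SFinite ν] {f : α → β → ℝ≥0∞}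
    (hf : Measurable (Function.uncurry f)) {p : ℝ} (hp : 1 ≤ p) :
    (∫⁻ a, (∫⁻ b, f a b ∂ν) ^ p ∂μ) ^ (1 / p) ≤
      ∫⁻ b, (∫⁻ a, f a b ^ p ∂μ) ^ (1 / p) ∂ν := by
  rcases hp.eq_or_lt with rfl | hp
  · simp only [ENNReal.rpow_one, div_one]
    exact (lintegral_lintegral_swap hf.aemeasurable).le
  have hp0 : 0 < p := by linarith
  obtain ⟨q, hpq⟩ : ∃ q, p.HolderConjugate q := ⟨_, Real.HolderConjugate.conjExponent hp⟩
  have hq0 : 0 < q := hpq.symm.pos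
  have hq1 : 1 / q = 1 - 1 / p := by
    have := hpq.inv_add_inv_eq_one
    simp only [one_div]; linarith
  -- Hölder in b with the weight s (the L^p norms in a) bounds the p-th power of the inner integral
  -- by ∫ f^p s^{-p/q} times A^{p/q}. Integrating in a turns the first factor into ∫ s^{p-p/q} = ∫ s
  -- = A, for a total of A^p.
  set s : β → ℝ≥0∞ := fun b => (∫⁻ a, f a b ^ p ∂μ) ^ (1 / p) with hs
  have hfs : Measurable (Function.uncurry fun b a => f a b) := hf.comp measurable_swap
  have hfb : ∀ b, Measurable fun a => f a b ^ p := fun b =>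
    (hf.comp measurable_prodMk_right).pow_const p
  have hsm : Measurable s :=
    (Measurable.lintegral_prod_right' (f := fun z : β × α => f z.2 z.1 ^ p)
      (hfs.pow_const p)).pow_const _
  have hsp : ∀ b, s b ^ p = ∫⁻ a, f a b ^ p ∂μ := fun b => by
    rw [hs, ← ENNReal.rpow_mul, one_div_mul_cancel hp0.ne', ENNReal.rpow_one]
  set A := ∫⁻ b, s b ∂ν with hA
  by_cases hAtop : A = ∞
  · rw [hAtop]; exact le_top
  have hsfin : ∀ᵐ b ∂ν, s b < ∞ := ae_lt_top hsm hAtop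
  -- Dividing by s needs s b ≠ 0. Where s b = 0, f vanishes for almost every a, and exchanging the
  -- two null-set quantifiers makes this usable for a fixed a.
  have hzero : ∀ᵐ a ∂μ, ∀ᵐ b ∂ν, s b = 0 → f a b = 0 := by
    rw [Measure.ae_ae_comm]
    · filter_upwards with b
      by_cases hb : s b = 0
      · have h0 : ∫⁻ a, f a b ^ p ∂μ = 0 := by
          rw [← hsp, hb, ENNReal.zero_rpow_of_pos hp0]
        rw [lintegral_eq_zero_iff (hfb b)] at h0
        filter_upwards [h0] with a ha _
        simpa [hp0, hp0.le, not_lt.2 hp0.le] using ha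
      · exact Filter.Eventually.of_forall fun a h => absurd h hb
    · have e : {z : α × β | s z.2 = 0 → f z.1 z.2 = 0} =
          {z : α × β | s z.2 = 0}ᶜ ∪ {z | f z.1 z.2 = 0} := by
        ext z; simp [imp_iff_not_or]
      rw [e]
      exact ((hsm.comp measurable_snd) (measurableSet_singleton 0)).compl.union
        (hf (measurableSet_singleton 0))
  have hpt : ∀ᵐ a ∂μ, (∫⁻ b, f a b ∂ν) ^ p ≤
      (∫⁻ b, f a b ^ p * s b ^ (-(p / q)) ∂ν) * A ^ (p / q) := by
    filter_upwards [hzero] with a ha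
    have h1 : ∫⁻ b, f a b ∂ν = ∫⁻ b, (f a b * s b ^ (-(1 / q))) * s b ^ (1 / q) ∂ν := by
      refine lintegral_congr_ae ?_
      filter_upwards [ha, hsfin] with b hb hb'
      by_cases h0 : s b = 0
      · simp [hb h0]
      · rw [mul_assoc, ← ENNReal.rpow_add _ _ h0 hb'.ne, neg_add_cancel, ENNReal.rpow_zero,
          mul_one]
    have h2 := ENNReal.lintegral_mul_le_Lp_mul_Lq ν hpq
      (f := fun b => f a b * s b ^ (-(1 / q))) (g := fun b => s b ^ (1 / q))
      ((hf.comp measurable_prodMk_left).mul (hsm.pow_const _)).aemeasurable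
      (hsm.pow_const _).aemeasurable
    rw [h1]
    refine (ENNReal.rpow_le_rpow h2 hp0.le).trans ?_
    rw [ENNReal.mul_rpow_of_nonneg _ _ hp0.le, ← ENNReal.rpow_mul, one_div_mul_cancel hp0.ne',
      ENNReal.rpow_one, ← ENNReal.rpow_mul]
    refine mul_le_mul' (lintegral_mono fun b => ?_) ?_
    · rw [ENNReal.mul_rpow_of_nonneg _ _ hp0.le, ← ENNReal.rpow_mul]
      exact le_of_eq (by congr 2; ring)
    · have : 1 / q * p = p / q := by ring
      rw [this]
      refine ENNReal.rpow_le_rpow (lintegral_mono fun b => ?_) (by positivity)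
      rw [← ENNReal.rpow_mul, one_div_mul_cancel hq0.ne', ENNReal.rpow_one]
  have hpq' : p + -(p / q) = 1 := by
    have : p / q = p * (1 / q) := by ring
    rw [this, hq1]; field_simp; ring
  have hfinal : ∫⁻ a, (∫⁻ b, f a b ∂ν) ^ p ∂μ ≤ A ^ p := by
    calc ∫⁻ a, (∫⁻ b, f a b ∂ν) ^ p ∂μ
        ≤ ∫⁻ a, (∫⁻ b, f a b ^ p * s b ^ (-(p / q)) ∂ν) * A ^ (p / q) ∂μ :=
          lintegral_mono_ae hpt
      _ = (∫⁻ a, ∫⁻ b, f a b ^ p * s b ^ (-(p / q)) ∂ν ∂μ) * A ^ (p / q) := by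
          rw [lintegral_mul_const]
          exact Measurable.lintegral_prod_right' (f := fun z : α × β => f z.1 z.2 ^ p *
            s z.2 ^ (-(p / q))) ((hf.pow_const p).mul ((hsm.comp measurable_snd).pow_const _))
      _ = (∫⁻ b, ∫⁻ a, f a b ^ p * s b ^ (-(p / q)) ∂μ ∂ν) * A ^ (p / q) := by
          rw [lintegral_lintegral_swap]
          exact ((hf.pow_const p).mul ((hsm.comp measurable_snd).pow_const _)).aemeasurable
      _ = (∫⁻ b, s b ∂ν) * A ^ (p / q) := by
          congr 1
          refine lintegral_congr_ae ?_
          filter_upwards [hsfin] with b hb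
          rw [lintegral_mul_const _ (hfb b), ← hsp]
          by_cases h0 : s b = 0
          · rw [h0, ENNReal.zero_rpow_of_pos hp0, zero_mul]
          · rw [← ENNReal.rpow_add _ _ h0 hb.ne, hpq', ENNReal.rpow_one]
      _ = A ^ p := by
          by_cases h0 : A = 0
          · rw [← hA, h0, zero_mul, ENNReal.zero_rpow_of_pos hp0]
          · nth_rw 1 [← hA, ← ENNReal.rpow_one A]
            rw [← ENNReal.rpow_add _ _ h0 hAtop]
            congr 1; linarith
  calc _ ≤ (A ^ p) ^ (1 / p) := ENNReal.rpow_le_rpow hfinal (by positivity)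
    _ = A := by rw [← ENNReal.rpow_mul, mul_one_div_cancel hp0.ne', ENNReal.rpow_one]

/-- Gaussian tail from the growth `√n` of the `n`-th moments. -/
theorem measureReal_lt_le_of_moments {Ω : Type*} [MeasurableSpace Ω] {P : Measure Ω}
    [IsProbabilityMeasure P] {X : Ω → ℝ≥0∞} (hX : Measurable X) {n₀ : ℕ} (hn₀ : 1 ≤ n₀)
    {A : ℝ} (hA : 0 < A)
    (h : ∀ n : ℕ, n₀ ≤ n → (∫⁻ ω, X ω ^ (n : ℝ) ∂P) ^ (1 / (n : ℝ)) ≤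
      ENNReal.ofReal (A * √n)) {l : ℝ} (hl : 0 < l) :
    P.real {ω | ENNReal.ofReal l < X ω} ≤
      Real.exp (n₀ + 1) * Real.exp (-(l ^ 2 / (Real.exp 1 * A) ^ 2)) := by
  set q := l ^ 2 / (Real.exp 1 * A) ^ 2 with hq
  have he := Real.exp_pos 1
  have hq0 : 0 ≤ q := by positivity
  rw [← Real.exp_add]
  -- Markov's inequality is used with the exponent n = ⌊q⌋, for which A√n ≤ l/e, so the probability
  -- is at most e^{-n} ≤ e^{1-q}. If ⌊q⌋ < n₀, the factor exp(n₀ + 1) makes the claimed bound at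
  -- least 1.
  by_cases hn : n₀ ≤ ⌊q⌋₊
  swap
  · refine measureReal_le_one.trans (Real.one_le_exp ?_)
    have := (Nat.floor_lt hq0).1 (not_le.1 hn)
    linarith
  set n := ⌊q⌋₊ with hnq
  have hn1 : 1 ≤ n := hn₀.trans hn
  have hnq' : (n : ℝ) ≤ q := Nat.floor_le hq0
  have hn0 : (0 : ℝ) < n := by exact_mod_cast hn1
  have hmom : ∫⁻ ω, X ω ^ (n : ℝ) ∂P ≤ ENNReal.ofReal (A * √n) ^ (n : ℝ) := by
    have := ENNReal.rpow_le_rpow (h n hn) hn0.le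
    rwa [← ENNReal.rpow_mul, one_div_mul_cancel hn0.ne', ENNReal.rpow_one] at this
  have hsq : A * √n ≤ l * Real.exp (-1) := by
    have h1 : √(n : ℝ) ≤ l / (Real.exp 1 * A) := by
      rw [Real.sqrt_le_left (by positivity)]
      calc (n : ℝ) ≤ q := hnq'
        _ = _ := by rw [hq]; ring
    calc A * √n ≤ A * (l / (Real.exp 1 * A)) := by gcongr
      _ = l * Real.exp (-1) := by rw [Real.exp_neg]; field_simp
  have hmarkov : ENNReal.ofReal l ^ (n : ℝ) * P {ω | ENNReal.ofReal l < X ω} ≤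
      ENNReal.ofReal (A * √n) ^ (n : ℝ) := by
    refine le_trans ?_ ((mul_meas_ge_le_lintegral (hX.pow_const (n : ℝ))
      (ENNReal.ofReal l ^ (n : ℝ))).trans hmom)
    exact mul_le_mul' le_rfl
      (measure_mono fun ω hω => ENNReal.rpow_le_rpow (le_of_lt hω) hn0.le)
  have hP : P {ω | ENNReal.ofReal l < X ω} ≤ ENNReal.ofReal (Real.exp (-n)) := by
    have hl0 : ENNReal.ofReal l ^ (n : ℝ) ≠ 0 := by
      simp [hl]
    have hlt : ENNReal.ofReal l ^ (n : ℝ) ≠ ∞ := by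
      simp
    rw [← ENNReal.mul_le_mul_iff_right hl0 hlt]
    refine hmarkov.trans ?_
    refine (ENNReal.rpow_le_rpow (ENNReal.ofReal_le_ofReal hsq) hn0.le).trans ?_
    rw [ENNReal.ofReal_mul hl.le, ENNReal.mul_rpow_of_nonneg _ _ hn0.le]
    gcongr
    rw [ENNReal.ofReal_rpow_of_pos (Real.exp_pos _), ← Real.exp_mul]
    simp
  calc P.real {ω | ENNReal.ofReal l < X ω} ≤ Real.exp (-n) :=
        ENNReal.toReal_le_of_le_ofReal (Real.exp_pos _).le hP
    _ ≤ _ := by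
        apply Real.exp_le_exp.2
        have := Nat.lt_floor_add_one q
        have h3 : (1 : ℝ) ≤ n₀ := by exact_mod_cast hn₀
        rw [← hnq] at this
        linarith

/-- From |X|^n ≤ n! l^{-n} e^{l|X|} and the exponential moments at ±l. The choice l = √(n/v) makes
e^{v l²/2} = e^{n/2}, harmless against 4^n, while n! ≤ n^n turns n! l^{-n} into at most √(nv)^n. -/
theorem ProbabilityTheory.HasSubgaussianMGF.lintegral_enorm_rpow_le {Ω : Type*}
    [MeasurableSpace Ω] {P : Measure Ω} [IsProbabilityMeasure P] {X : Ω → ℝ} {v : NNReal}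
    (hX : HasSubgaussianMGF X v P) {n : ℕ} (hn : 1 ≤ n) :
    ∫⁻ ω, ‖X ω‖ₑ ^ (n : ℝ) ∂P ≤ ENNReal.ofReal ((4 * √(n * v)) ^ n) := by
  have hn0 : (0 : ℝ) < n := by exact_mod_cast hn
  rcases eq_or_ne v 0 with rfl | hv
  · have h0 := hX.ae_eq_zero_of_hasSubgaussianMGF_zero
    rw [lintegral_congr_ae (g := fun _ => 0)]
    · simp
    · filter_upwards [h0] with ω hω
      simp [hω, show n ≠ 0 by omega]
  have hv0 : (0 : ℝ) < v := by positivity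
  set l : ℝ := √(n / v) with hl
  have hl0 : 0 < l := by positivity
  have hl2 : l ^ 2 = n / v := Real.sq_sqrt (by positivity)
  have hexp : ∀ t : ℝ, ∫⁻ ω, ENNReal.ofReal (Real.exp (t * X ω)) ∂P ≤
      ENNReal.ofReal (Real.exp (v * t ^ 2 / 2)) := fun t => by
    rw [← ofReal_integral_eq_lintegral_ofReal (hX.integrable_exp_mul t)
      (Filter.Eventually.of_forall fun _ => (Real.exp_pos _).le)]
    exact ENNReal.ofReal_le_ofReal (hX.mgf_le t)
  have hpt : ∀ ω, ‖X ω‖ₑ ^ (n : ℝ) ≤ ENNReal.ofReal (n.factorial / l ^ n) *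
      (ENNReal.ofReal (Real.exp (l * X ω)) + ENNReal.ofReal (Real.exp (-l * X ω))) := fun ω => by
    rw [← ENNReal.ofReal_add (Real.exp_pos _).le (Real.exp_pos _).le,
      ← ENNReal.ofReal_mul (by positivity), ← ofReal_norm, ENNReal.rpow_natCast,
      ← ENNReal.ofReal_pow (norm_nonneg _)]
    apply ENNReal.ofReal_le_ofReal
    have h1 := Real.pow_div_factorial_le_exp (l * |X ω|) (by positivity) n
    have h2 : Real.exp (l * |X ω|) ≤ Real.exp (l * X ω) + Real.exp (-l * X ω) := by
      rcases abs_cases (X ω) with ⟨h, _⟩ | ⟨h, _⟩ <;> rw [h]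
      · linarith [Real.exp_pos (-l * X ω)]
      · rw [mul_neg, neg_mul]; linarith [Real.exp_pos (l * X ω)]
    calc ‖X ω‖ ^ n = n.factorial / l ^ n * ((l * |X ω|) ^ n / n.factorial) := by
          rw [mul_pow, Real.norm_eq_abs]
          have : (n.factorial : ℝ) ≠ 0 := by positivity
          field_simp
      _ ≤ _ := by gcongr; exact h1.trans h2
  have hfact : (n.factorial : ℝ) ≤ (n : ℝ) ^ n := by exact_mod_cast Nat.factorial_le_pow n
  calc ∫⁻ ω, ‖X ω‖ₑ ^ (n : ℝ) ∂P
      ≤ ∫⁻ ω, ENNReal.ofReal (n.factorial / l ^ n) *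
        (ENNReal.ofReal (Real.exp (l * X ω)) + ENNReal.ofReal (Real.exp (-l * X ω))) ∂P :=
        lintegral_mono hpt
    _ = ENNReal.ofReal (n.factorial / l ^ n) * (∫⁻ ω, ENNReal.ofReal (Real.exp (l * X ω)) ∂P +
        ∫⁻ ω, ENNReal.ofReal (Real.exp (-l * X ω)) ∂P) := by
        rw [lintegral_const_mul' _ _ ENNReal.ofReal_ne_top, lintegral_add_left']
        exact (hX.integrable_exp_mul l).1.aemeasurable.ennreal_ofReal
    _ ≤ ENNReal.ofReal (n.factorial / l ^ n) * (ENNReal.ofReal (Real.exp (n / 2)) +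
        ENNReal.ofReal (Real.exp (n / 2))) := by
        have e1 : v * l ^ 2 / 2 = n / 2 := by rw [hl2]; field_simp
        have e2 : v * (-l) ^ 2 / 2 = n / 2 := by rw [neg_sq, e1]
        gcongr
        · exact (hexp l).trans_eq (by rw [e1])
        · exact (hexp (-l)).trans_eq (by rw [e2])
    _ ≤ ENNReal.ofReal ((4 * √(n * v)) ^ n) := by
        rw [← ENNReal.ofReal_add (Real.exp_pos _).le (Real.exp_pos _).le,
          ← ENNReal.ofReal_mul (by positivity)]
        apply ENNReal.ofReal_le_ofReal
        have h4 : Real.exp (n / 2) + Real.exp (n / 2) ≤ 4 ^ n := by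
          have e : Real.exp (n / 2) = Real.exp (1 / 2) ^ n := by
            rw [← Real.exp_nat_mul]; ring_nf
          have h2 : Real.exp (1 / 2) ≤ 2 := by
            have := Real.exp_one_lt_d9
            have h3 : Real.exp (1 / 2) ^ 2 = Real.exp 1 := by
              rw [← Real.exp_nat_mul]; norm_num
            nlinarith [Real.exp_pos (1 / 2 : ℝ)]
          rw [e, ← two_mul]
          calc 2 * Real.exp (1 / 2) ^ n ≤ 2 ^ n * 2 ^ n := by
                gcongr
                exact le_self_pow₀ (by norm_num) (by omega)
            _ = 4 ^ n := by rw [← mul_pow]; norm_num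
        have h5 : (n : ℝ) ^ n / l ^ n = √(n * v) ^ n := by
          rw [← div_pow]
          congr 1
          rw [hl, Real.sqrt_div' _ hv0.le, Real.sqrt_mul hn0.le]
          have h6 := Real.mul_self_sqrt hn0.le
          have h7 : √(n : ℝ) ≠ 0 := by positivity
          field_simp
          nlinarith
        calc _ ≤ (n : ℝ) ^ n / l ^ n * 4 ^ n := by gcongr
          _ = _ := by rw [h5, ← mul_pow, mul_comm]

/-! ### Moments of Gaussian sums with complex coefficients -/

namespace IsGaussianFamily

variable {Ω : Type*} [MeasurableSpace Ω] {P : Measure Ω} {κ : ℝ} {g : (Fin 3 → ℤ) → Ω → ℂ}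

theorem nonneg (hg : IsGaussianFamily P κ g) : 0 ≤ κ :=
  (integral_nonneg fun _ => by positivity).trans (hg.variance_le 0)

variable [IsProbabilityMeasure P]

/-- The map z ↦ Re(zc) is real linear, so it sends a Gaussian law on ℂ = ℝ² to a real Gaussian law.
Real and imaginary parts of g_k may be correlated in any way: only |Re(zc)| ≤ |z||c| enters the
variance. -/
theorem hasSubgaussianMGF_re (hg : IsGaussianFamily P κ g) (k : Fin 3 → ℤ) (c : ℂ) :
    HasSubgaussianMGF (fun ω => (g k ω * c).re) (κ * ‖c‖ ^ 2).toNNReal P := by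
  have hκ := hg.nonneg
  have := hg.gaussian k
  let L : StrongDual ℝ ℂ := Complex.reCLM ∘L ((ContinuousLinearMap.mul ℝ ℂ).flip c)
  have hL : ∀ z, L z = (z * c).re := fun z => rfl
  have hm := hg.measurable k
  have hmap : P.map (fun ω => (g k ω * c).re) =
      gaussianReal ((P.map (g k))[L]) (Var[L; P.map (g k)]).toNNReal := by
    rw [← IsGaussian.map_eq_gaussianReal, Measure.map_map (by fun_prop) hm]
    rfl
  have hgint : MemLp (g k) 2 P := by
    have h := IsGaussian.memLp_id (P.map (g k)) 2 (by simp)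
    exact (memLp_map_measure_iff (by fun_prop) hm.aemeasurable).1 h
  have hmean : (P.map (g k))[L] = 0 := by
    rw [integral_map hm.aemeasurable (by fun_prop), L.integral_comp_comm
      (hgint.integrable (by norm_num)), hg.mean_zero, map_zero]
  have hvar : Var[L; P.map (g k)] ≤ κ * ‖c‖ ^ 2 := by
    rw [variance_of_integral_eq_zero (by fun_prop) hmean,
      integral_map hm.aemeasurable (by fun_prop)]
    calc ∫ ω, L (g k ω) ^ 2 ∂P ≤ ∫ ω, ‖g k ω‖ ^ 2 * ‖c‖ ^ 2 ∂P := by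
          refine integral_mono_of_nonneg (Filter.Eventually.of_forall fun _ => sq_nonneg _)
            (hgint.integrable_norm_pow (p := 2) (by norm_num) |>.mul_const _)
            (Filter.Eventually.of_forall fun ω => ?_)
          simp only [hL]
          rw [← mul_pow, ← norm_mul, ← sq_abs]
          gcongr
          exact Complex.abs_re_le_norm _
      _ ≤ κ * ‖c‖ ^ 2 := by
          rw [integral_mul_const]
          gcongr
          exact hg.variance_le k
  rw [hmean] at hmap
  refine (HasSubgaussianMGF.id_map_iff (by fun_prop)).1 ?_
  rw [hmap]
  refine ⟨fun t => integrable_exp_mul_gaussianReal t, fun t => ?_⟩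
  rw [mgf_id_gaussianReal]
  simp only [zero_mul, zero_add]
  gcongr

/-- Real and imaginary parts are each a sum of independent sub-Gaussian real variables. As Im z =
Re(-iz), the second reduces to the first with rotated coefficients; the two constants 4 add up to 8.
-/
theorem lintegral_enorm_sum_le (hg : IsGaussianFamily P κ g) (K : Finset (Fin 3 → ℤ))
    (c : (Fin 3 → ℤ) → ℂ) {n : ℕ} (hn : 1 ≤ n) :
    (∫⁻ ω, ‖∑ k ∈ K, g k ω * c k‖ₑ ^ (n : ℝ) ∂P) ^ (1 / (n : ℝ)) ≤
      ENNReal.ofReal (8 * √(n * κ)) * ENNReal.ofReal (√(∑ k ∈ K, ‖c k‖ ^ 2)) := by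
  have hκ := hg.nonneg
  have hn0 : (0 : ℝ) < n := by exact_mod_cast hn
  have hn1 : (1 : ℝ) ≤ n := by exact_mod_cast hn
  have key : ∀ d : (Fin 3 → ℤ) → ℂ, (∀ k, ‖d k‖ = ‖c k‖) →
      (∫⁻ ω, ‖(∑ k ∈ K, g k ω * d k).re‖ₑ ^ (n : ℝ) ∂P) ^ (1 / (n : ℝ)) ≤
        ENNReal.ofReal (4 * √(n * (κ * ∑ k ∈ K, ‖c k‖ ^ 2))) := fun d hd => by
    have hind : iIndepFun (fun k ω => (g k ω * d k).re) P :=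
      hg.indep.comp (fun k z => (z * d k).re) (fun k => by fun_prop)
    have hs := HasSubgaussianMGF.sum_of_iIndepFun hind (s := K)
      (c := fun k => (κ * ‖d k‖ ^ 2).toNNReal) (fun k _ => hg.hasSubgaussianMGF_re k (d k))
    have h := hs.lintegral_enorm_rpow_le hn
    have hv : ((∑ k ∈ K, (κ * ‖d k‖ ^ 2).toNNReal : NNReal) : ℝ) = κ * ∑ k ∈ K, ‖c k‖ ^ 2 := by
      rw [NNReal.coe_sum, Finset.mul_sum]
      refine Finset.sum_congr rfl fun k _ => ?_
      rw [Real.coe_toNNReal _ (by positivity), hd]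
    rw [hv] at h
    simp_rw [Complex.re_sum]
    refine (ENNReal.rpow_le_rpow h (by positivity)).trans_eq ?_
    rw [ENNReal.ofReal_pow (by positivity), ← ENNReal.rpow_natCast, ← ENNReal.rpow_mul,
      mul_one_div_cancel hn0.ne', ENNReal.rpow_one]
  have hre := key c fun _ => rfl
  have him := key (fun k => -Complex.I * c k) fun k => by simp
  have hmeas : Measurable fun ω => ∑ k ∈ K, g k ω * c k :=
    Finset.measurable_sum _ fun k _ => (hg.measurable k).mul_const _
  have himeq : ∀ ω, (∑ k ∈ K, g k ω * (-Complex.I * c k)).re = (∑ k ∈ K, g k ω * c k).im := by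
    intro ω
    rw [Complex.re_sum, Complex.im_sum]
    refine Finset.sum_congr rfl fun k _ => ?_
    simp
    ring
  simp_rw [himeq] at him
  calc (∫⁻ ω, ‖∑ k ∈ K, g k ω * c k‖ₑ ^ (n : ℝ) ∂P) ^ (1 / (n : ℝ))
      ≤ (∫⁻ ω, (‖(∑ k ∈ K, g k ω * c k).re‖ₑ + ‖(∑ k ∈ K, g k ω * c k).im‖ₑ) ^ (n : ℝ) ∂P) ^
          (1 / (n : ℝ)) := by
        gcongr with ω
        rw [← ofReal_norm, ← ofReal_norm, ← ofReal_norm,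
          ← ENNReal.ofReal_add (norm_nonneg _) (norm_nonneg _)]
        exact ENNReal.ofReal_le_ofReal (Complex.norm_le_abs_re_add_abs_im _)
    _ ≤ _ := ENNReal.lintegral_Lp_add_le
        (Complex.measurable_re.comp hmeas).enorm.aemeasurable
        (Complex.measurable_im.comp hmeas).enorm.aemeasurable hn1
    _ ≤ _ := add_le_add hre him
    _ = _ := by
        rw [← ENNReal.ofReal_add (by positivity) (by positivity),
          ← ENNReal.ofReal_mul (by positivity), ← mul_assoc, Real.sqrt_mul (by positivity)]
        congr 1
        ring

end IsGaussianFamily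

/-! ### Plancherel's theorem for Fourier integrals on L¹ ∩ L² -/

section Plancherel

variable {V : Type*} [NormedAddCommGroup V] [InnerProductSpace ℝ V] [FiniteDimensional ℝ V]
  [MeasurableSpace V] [BorelSpace V]

theorem integral_fourier_mul_eq_of_integrable {f g : V → ℂ} (hf : Integrable f)
    (hg : Integrable g) : ∫ x, 𝓕 f x * g x = ∫ x, f x * 𝓕 g x := by
  have h := VectorFourier.integral_fourierIntegral_smul_eq_flip (μ := volume) (ν := volume)
    (e := Real.fourierChar) (L := innerₗ V) Real.continuous_fourierChar continuous_inner hf hg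
  simpa [Real.fourier_eq, VectorFourier.fourierIntegral, real_inner_comm] using h

theorem integral_fourierInv_mul_eq_of_integrable {f g : V → ℂ} (hf : Integrable f)
    (hg : Integrable g) : ∫ x, 𝓕⁻ f x * g x = ∫ x, f x * 𝓕⁻ g x := by
  have h := integral_fourier_mul_eq_of_integrable hf.comp_neg hg
  rw [← Real.fourierInv_eq_fourier_comp_neg] at h
  rw [h, ← integral_neg_eq_self]
  refine integral_congr_ae (Filter.Eventually.of_forall fun x => ?_)
  simp [Real.fourierInv_eq_fourier_neg]

theorem continuous_fourier_of_integrable {f : V → ℂ} (hf : Integrable f) :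
    Continuous (𝓕 f) :=
  VectorFourier.fourierIntegral_continuous Real.continuous_fourierChar
    (by exact continuous_inner) hf

theorem integral_smul_fourier_Lp_eq (f : Lp ℂ 2 (volume : Measure V)) (Φ : 𝓢(V, ℂ)) :
    ∫ x, Φ x • (𝓕 f : Lp ℂ 2 (volume : Measure V)) x = ∫ x, 𝓕 (Φ : V → ℂ) x • f x := by
  have h := congrArg (fun T : 𝓢'(V, ℂ) => T Φ) (Lp.fourier_toTemperedDistribution_eq f)
  rw [← Lp.toTemperedDistribution_apply (𝓕 f : Lp ℂ 2 (volume : Measure V)) Φ, ← h,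
    TemperedDistribution.fourier_apply, Lp.toTemperedDistribution_apply, SchwartzMap.fourier_coe]

/-- On `L¹ ∩ L²` the `L²` Fourier transform is the Fourier integral. -/
theorem fourier_toLp_ae_eq {g : V → ℂ} (h1 : Integrable g) (h2 : MemLp g 2) :
    ((𝓕 (h2.toLp g) : Lp ℂ 2 (volume : Measure V)) : V → ℂ) =ᵐ[volume] (𝓕 g : V → ℂ) := by
  have h3 : ∀ Φ : 𝓢(V, ℂ), ∫ x, Φ x • (𝓕 (h2.toLp g) : Lp ℂ 2 (volume : Measure V)) x =
      ∫ x, Φ x * 𝓕 g x := fun Φ => by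
    rw [integral_smul_fourier_Lp_eq, ← integral_fourier_mul_eq_of_integrable Φ.integrable h1]
    refine integral_congr_ae ?_
    filter_upwards [h2.coeFn_toLp] with x hx
    rw [hx, smul_eq_mul]
  generalize (𝓕 (h2.toLp g) : Lp ℂ 2 (volume : Measure V)) = u at h3 ⊢
  have hl1 : LocallyIntegrable (u : V → ℂ) volume := (Lp.memLp u).locallyIntegrable (by norm_num)
  have hl2 : LocallyIntegrable (𝓕 g : V → ℂ) volume :=
    (continuous_fourier_of_integrable h1).locallyIntegrable
  refine ae_eq_of_integral_contDiff_smul_eq hl1 hl2 fun φ hφ hφc => ?_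
  have c1 : HasCompactSupport (fun x => (φ x : ℂ)) := hφc.comp_left Complex.ofReal_zero
  have c2 : ContDiff ℝ (⊤ : ℕ∞) (fun x => (φ x : ℂ)) :=
    Complex.ofRealCLM.contDiff.comp hφ
  exact h3 (c1.toSchwartzMap c2)

theorem eLpNorm_fourier_eq {g : V → ℂ} (h1 : Integrable g) (h2 : MemLp g 2) :
    eLpNorm (𝓕 g) 2 volume = eLpNorm g 2 volume := by
  rw [← eLpNorm_congr_ae (fourier_toLp_ae_eq h1 h2), ← eLpNorm_congr_ae h2.coeFn_toLp,
    ← ENNReal.toReal_eq_toReal_iff' (Lp.eLpNorm_ne_top _) (Lp.eLpNorm_ne_top _)]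
  exact Lp.norm_fourier_eq _

theorem eLpNorm_fourierInv_eq {g : V → ℂ} (h1 : Integrable g) (h2 : MemLp g 2) :
    eLpNorm (𝓕⁻ g) 2 volume = eLpNorm g 2 volume := by
  have hmp := Measure.measurePreserving_neg (volume : Measure V)
  rw [Real.fourierInv_eq_fourier_comp_neg]
  have := eLpNorm_fourier_eq h1.comp_neg (h2.comp_measurePreserving hmp)
  exact this.trans (eLpNorm_comp_measurePreserving h2.1 hmp)

end Plancherel

/-! ### Polar coordinates adapted to the norm and one coordinate -/

section Polar

/-- The substitution ρ = √(z² + q²), for which q dq = ρ dρ, replaces the distance to the axis by the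
distance to the origin. -/
theorem lintegral_Ioi_mul_comp_sqrt (z : ℝ) (G : ℝ → ℝ≥0∞) :
    ∫⁻ q in Set.Ioi (0 : ℝ), ENNReal.ofReal q * G (√(z ^ 2 + q ^ 2)) =
      ∫⁻ ρ in Set.Ioi |z|, ENNReal.ofReal ρ * G ρ := by
  have himg : (fun q : ℝ => √(z ^ 2 + q ^ 2)) '' Set.Ioi 0 = Set.Ioi |z| := by
    ext ρ
    constructor
    · rintro ⟨q, hq, rfl⟩
      have hq : 0 < q := hq
      simp only [Set.mem_Ioi]
      rw [← Real.sqrt_sq_eq_abs]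
      exact Real.sqrt_lt_sqrt (sq_nonneg _) (by nlinarith)
    · intro hρ
      have hρ : |z| < ρ := hρ
      have h0 : 0 ≤ ρ := (abs_nonneg z).trans hρ.le
      have h1 : 0 < ρ ^ 2 - z ^ 2 := by nlinarith [sq_abs z, abs_nonneg z]
      refine ⟨√(ρ ^ 2 - z ^ 2), Real.sqrt_pos.2 h1, ?_⟩
      simp only
      rw [Real.sq_sqrt h1.le, add_sub_cancel, Real.sqrt_sq h0]
  have hder : ∀ q ∈ Set.Ioi (0 : ℝ), HasDerivWithinAt (fun q : ℝ => √(z ^ 2 + q ^ 2))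
      (q / √(z ^ 2 + q ^ 2)) (Set.Ioi 0) q := fun q hq => by
    have hq : 0 < q := hq
    have h1 : HasDerivAt (fun q : ℝ => z ^ 2 + q ^ 2) (2 * q) q := by
      simpa using (hasDerivAt_pow 2 q).const_add (z ^ 2)
    have h2 := h1.sqrt (by positivity)
    rw [mul_div_mul_left _ _ two_ne_zero] at h2
    exact h2.hasDerivWithinAt
  have hinj : Set.InjOn (fun q : ℝ => √(z ^ 2 + q ^ 2)) (Set.Ioi 0) := by
    intro a ha b hb hab
    have ha : 0 < a := ha
    have hb : 0 < b := hb
    have h := (Real.sqrt_inj (by positivity) (by positivity)).1 hab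
    nlinarith
  rw [← himg, lintegral_image_eq_lintegral_abs_deriv_mul measurableSet_Ioi hder hinj]
  refine setLIntegral_congr_fun measurableSet_Ioi fun q hq => ?_
  have hq : 0 < q := hq
  have hs : 0 < √(z ^ 2 + q ^ 2) := by positivity
  rw [← mul_assoc, ← ENNReal.ofReal_mul (abs_nonneg _), abs_of_pos (by positivity),
    div_mul_cancel₀ _ hs.ne']

/-- Integration over `ℝ³` of a function of the norm and of one coordinate. -/
theorem lintegral_norm_coord {F : ℝ × ℝ → ℝ≥0∞} (hF : Measurable F) :
    ∫⁻ y : R3, F (‖y‖, y 0) =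
      ∫⁻ p : ℝ × ℝ in {p | |p.2| < p.1}, ENNReal.ofReal (2 * Real.pi * p.1) * F p := by
  have hpi : (0 : ℝ) < Real.pi := Real.pi_pos
  have e1 : ∫⁻ y : R3, F (‖y‖, y 0) =
      ∫⁻ y : Fin 3 → ℝ, F (√(y 0 ^ 2 + y 1 ^ 2 + y 2 ^ 2), y 0) := by
    rw [← (EuclideanSpace.volume_preserving_symm_measurableEquiv_toLp (Fin 3)).lintegral_comp_emb
      (MeasurableEquiv.measurableEmbedding _)]
    refine lintegral_congr fun y => ?_
    simp [EuclideanSpace.norm_eq, Fin.sum_univ_three]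
  have e2 : ∫⁻ y : Fin 3 → ℝ, F (√(y 0 ^ 2 + y 1 ^ 2 + y 2 ^ 2), y 0) =
      ∫⁻ z : ℝ, ∫⁻ w : ℝ × ℝ, F (√(z ^ 2 + (w.1 ^ 2 + w.2 ^ 2)), z) := by
    rw [← (volume_preserving_piFinSuccAbove (fun _ : Fin 3 => ℝ) 0).symm.lintegral_comp_emb
      (MeasurableEquiv.measurableEmbedding _), Measure.volume_eq_prod, lintegral_prod]
    · refine lintegral_congr fun z => ?_
      rw [← (volume_preserving_finTwoArrow ℝ).symm.lintegral_comp_emb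
        (MeasurableEquiv.measurableEmbedding _)]
      refine lintegral_congr fun w => ?_
      simp [MeasurableEquiv.piFinSuccAbove, MeasurableEquiv.finTwoArrow, Fin.insertNthEquiv,
        add_assoc]
    · refine Measurable.aemeasurable ?_
      refine Measurable.comp (g := fun y : Fin 3 → ℝ => F (√(y 0 ^ 2 + y 1 ^ 2 + y 2 ^ 2), y 0))
        ?_ (MeasurableEquiv.measurable _)
      fun_prop
  -- Polar coordinates in the plane orthogonal to the axis: the angle contributes 2π, and the planar
  -- radius is then traded for the norm in ℝ³.
  have e3 : ∀ z : ℝ, ∫⁻ w : ℝ × ℝ, F (√(z ^ 2 + (w.1 ^ 2 + w.2 ^ 2)), z) =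
      ∫⁻ ρ in Set.Ioi |z|, ENNReal.ofReal (2 * Real.pi * ρ) * F (ρ, z) := fun z => by
    rw [← lintegral_comp_polarCoord_symm, polarCoord_target, Measure.volume_eq_prod,
      ← Measure.prod_restrict, lintegral_prod]
    · have : ∀ q θ : ℝ, ENNReal.ofReal q • F (√(z ^ 2 + ((polarCoord.symm (q, θ)).1 ^ 2 +
          (polarCoord.symm (q, θ)).2 ^ 2)), z) = ENNReal.ofReal q * F (√(z ^ 2 + q ^ 2), z) := by
        intro q θ
        have : (q * Real.cos θ) ^ 2 + (q * Real.sin θ) ^ 2 = q ^ 2 := by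
          rw [mul_pow, mul_pow, ← mul_add, Real.cos_sq_add_sin_sq, mul_one]
        simp [polarCoord_symm_apply, this]
      simp only [this, lintegral_const, Measure.restrict_apply_univ, Real.volume_Ioo]
      rw [lintegral_mul_const', lintegral_Ioi_mul_comp_sqrt z fun ρ => F (ρ, z),
        ← lintegral_mul_const']
      · refine lintegral_congr fun ρ => ?_
        rw [mul_right_comm, mul_comm (ENNReal.ofReal ρ), ← ENNReal.ofReal_mul (by linarith)]
        ring_nf
      · simp
      · simp
    · refine Measurable.aemeasurable ?_
      have := continuous_polarCoord_symm.measurable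
      fun_prop
  have hms : MeasurableSet {p : ℝ × ℝ | |p.2| < p.1} := measurableSet_lt (by fun_prop) (by fun_prop)
  simp_rw [e1, e2, e3]
  rw [← lintegral_indicator hms, Measure.volume_eq_prod, lintegral_prod_symm]
  · refine lintegral_congr fun z => ?_
    rw [← lintegral_indicator measurableSet_Ioi]
    refine lintegral_congr fun ρ => ?_
    simp [Set.indicator]
  · exact ((by fun_prop : Measurable fun p : ℝ × ℝ =>
      ENNReal.ofReal (2 * Real.pi * p.1) * F p).indicator hms).aemeasurable

/-- The law of the norm and of one coordinate under Lebesgue measure on `ℝ³`. -/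
theorem map_norm_coord :
    (volume : Measure R3).map (fun y => (‖y‖, y 0)) =
      (volume.restrict {p : ℝ × ℝ | |p.2| < p.1}).withDensity
        (fun p => ENNReal.ofReal (2 * Real.pi * p.1)) := by
  have hm : Measurable fun y : R3 => (‖y‖, y 0) := by fun_prop
  refine Measure.ext_of_lintegral _ fun F hF => ?_
  rw [lintegral_map hF hm, lintegral_norm_coord hF,
    lintegral_withDensity_eq_lintegral_mul _ (by fun_prop) hF]
  rfl

/-- Integration over `ℝ³` in polar coordinates of a function of the norm and of one coordinate. -/
theorem lintegral_norm_coord_eq_iterated {F : ℝ × ℝ → ℝ≥0∞} (hF : Measurable F) :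
    ∫⁻ y : R3, F (‖y‖, y 0) = ∫⁻ ρ in Set.Ioi (0 : ℝ),
      ENNReal.ofReal (2 * Real.pi * ρ) * ∫⁻ z in Set.Ioo (-ρ) ρ, F (ρ, z) := by
  have hms : MeasurableSet {p : ℝ × ℝ | |p.2| < p.1} := measurableSet_lt (by fun_prop) (by fun_prop)
  rw [lintegral_norm_coord hF, ← lintegral_indicator hms, Measure.volume_eq_prod, lintegral_prod,
    ← lintegral_indicator measurableSet_Ioi]
  · refine lintegral_congr fun ρ => ?_
    by_cases hρ : 0 < ρ
    · rw [Set.indicator_of_mem (Set.mem_Ioi.2 hρ), ← lintegral_indicator measurableSet_Ioo,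
        ← lintegral_const_mul' _ _ ENNReal.ofReal_ne_top]
      refine lintegral_congr fun z => ?_
      simp [Set.indicator, abs_lt]
    · rw [Set.indicator_of_notMem (s := Set.Ioi (0 : ℝ)) (fun h => hρ h)]
      refine (lintegral_congr fun z => ?_).trans lintegral_zero
      have hz : (ρ, z) ∉ {p : ℝ × ℝ | |p.2| < p.1} :=
        fun h : |z| < ρ => hρ ((abs_nonneg z).trans_lt h)
      exact Set.indicator_of_notMem hz _
  · exact ((by fun_prop : Measurable fun p : ℝ × ℝ =>
      ENNReal.ofReal (2 * Real.pi * p.1) * F p).indicator hms).aemeasurable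

theorem lintegral_comp_norm {F : ℝ → ℝ≥0∞} (hF : Measurable F) :
    ∫⁻ y : R3, F ‖y‖ = ∫⁻ ρ in Set.Ioi (0 : ℝ), ENNReal.ofReal (4 * Real.pi * ρ ^ 2) * F ρ := by
  have hpi := Real.pi_pos
  rw [lintegral_norm_coord_eq_iterated (F := fun p => F p.1) (by fun_prop)]
  refine setLIntegral_congr_fun measurableSet_Ioi fun ρ hρ => ?_
  have hρ : 0 < ρ := hρ
  simp only [lintegral_const, Measure.restrict_apply_univ, Real.volume_Ioo]
  rw [mul_comm (F ρ), ← mul_assoc, ← ENNReal.ofReal_mul (by positivity)]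
  congr 2
  ring

end Polar

/-! ### Plancherel in the time variable -/

section Time

theorem image_two_pi_sq : (fun ρ : ℝ => 2 * Real.pi * ρ ^ 2) '' Set.Ioi 0 = Set.Ioi 0 := by
  have hpi := Real.pi_pos
  ext τ
  constructor
  · rintro ⟨ρ, hρ, rfl⟩
    have hρ : 0 < ρ := hρ
    simp only [Set.mem_Ioi]; positivity
  · intro hτ
    have hτ : 0 < τ := hτ
    refine ⟨√(τ / (2 * Real.pi)), Set.mem_Ioi.2 (by positivity), ?_⟩
    simp only
    rw [Real.sq_sqrt (by positivity)]
    field_simp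

theorem injOn_two_pi_sq : Set.InjOn (fun ρ : ℝ => 2 * Real.pi * ρ ^ 2) (Set.Ioi 0) := by
  have hpi := Real.pi_pos
  intro a ha b hb hab
  have ha : 0 < a := ha
  have hb : 0 < b := hb
  have h : a ^ 2 = b ^ 2 := mul_left_cancel₀ (by positivity) hab
  nlinarith

theorem hasDerivWithinAt_two_pi_sq (ρ : ℝ) (s : Set ℝ) :
    HasDerivWithinAt (fun ρ : ℝ => 2 * Real.pi * ρ ^ 2) (4 * Real.pi * ρ) s ρ := by
  have h := ((hasDerivAt_pow 2 ρ).const_mul (2 * Real.pi)).hasDerivWithinAt (s := s)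
  have e : 2 * Real.pi * ((2 : ℕ) * ρ ^ (2 - 1)) = 4 * Real.pi * ρ := by norm_num; ring
  rw [e] at h
  exact h

/-- Plancherel's theorem in time for a superposition of the oscillations `e^{-4π²itρ²}`. -/
theorem lintegral_enorm_sq_time_le {H : ℝ → ℂ} (hm : Measurable H)
    (hH : IntegrableOn H (Set.Ioi 0)) :
    ∫⁻ t : ℝ, ‖∫ ρ in Set.Ioi (0 : ℝ),
        Complex.exp (-(Complex.I * (t : ℂ) * (((2 * Real.pi * ρ) ^ 2 : ℝ) : ℂ))) * H ρ‖ₑ ^ 2 ≤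
      ∫⁻ ρ in Set.Ioi (0 : ℝ), ENNReal.ofReal (1 / (4 * Real.pi * ρ)) * ‖H ρ‖ₑ ^ 2 := by
  have hpi := Real.pi_pos
  set R := ∫⁻ ρ in Set.Ioi (0 : ℝ), ENNReal.ofReal (1 / (4 * Real.pi * ρ)) * ‖H ρ‖ₑ ^ 2 with hR
  by_cases hRtop : R = ∞
  · rw [hRtop]; exact le_top
  -- With τ = 2πρ² the oscillation e^{-it(2πρ)²} becomes e^{-2πitτ}, so the superposition is the
  -- Fourier transform of J. The factor 1/(4πρ) is dρ/dτ; one copy of it remains as a weight when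
  -- |J|² is integrated.
  let J₀ : ℝ → ℂ := fun τ => ((1 / (4 * Real.pi * √(τ / (2 * Real.pi))) : ℝ) : ℂ) *
    H √(τ / (2 * Real.pi))
  have hJ₀m : Measurable J₀ := by
    have : Measurable fun τ : ℝ => H √(τ / (2 * Real.pi)) := hm.comp (by fun_prop)
    fun_prop
  have hJ₀ : ∀ ρ ∈ Set.Ioi (0 : ℝ), J₀ (2 * Real.pi * ρ ^ 2) =
      ((1 / (4 * Real.pi * ρ) : ℝ) : ℂ) * H ρ := fun ρ hρ => by
    have hρ : 0 < ρ := hρ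
    have : √(2 * Real.pi * ρ ^ 2 / (2 * Real.pi)) = ρ := by
      rw [mul_div_cancel_left₀ _ (by positivity), Real.sqrt_sq hρ.le]
    simp only [J₀, this]
  let J : ℝ → ℂ := (Set.Ioi 0).indicator J₀
  have hJm : Measurable J := hJ₀m.indicator measurableSet_Ioi
  have hder : ∀ ρ ∈ Set.Ioi (0 : ℝ), HasDerivWithinAt (fun ρ : ℝ => 2 * Real.pi * ρ ^ 2)
    (4 * Real.pi * ρ) (Set.Ioi 0) ρ := fun ρ _ => hasDerivWithinAt_two_pi_sq ρ _
  have hJ1 : Integrable J := by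
    rw [integrable_indicator_iff measurableSet_Ioi, ← image_two_pi_sq,
      integrableOn_image_iff_integrableOn_abs_deriv_smul measurableSet_Ioi hder injOn_two_pi_sq]
    refine hH.congr_fun (fun ρ hρ => ?_) measurableSet_Ioi
    have hρ' : 0 < ρ := hρ
    rw [hJ₀ ρ hρ, abs_of_pos (by positivity), Complex.real_smul, ← mul_assoc,
      ← Complex.ofReal_mul, mul_one_div_cancel (by positivity), Complex.ofReal_one, one_mul]
  have hJsq : ∫⁻ τ, ‖J τ‖ₑ ^ 2 = R := by
    have : ∀ τ, ‖J τ‖ₑ ^ 2 = (Set.Ioi 0).indicator (fun τ => ‖J₀ τ‖ₑ ^ 2) τ := fun τ => by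
      by_cases h : τ ∈ Set.Ioi (0 : ℝ) <;> simp [J, Set.indicator, h]
    simp_rw [this]
    rw [lintegral_indicator measurableSet_Ioi, ← image_two_pi_sq,
      lintegral_image_eq_lintegral_abs_deriv_mul measurableSet_Ioi hder injOn_two_pi_sq]
    refine setLIntegral_congr_fun measurableSet_Ioi fun ρ hρ => ?_
    have hρ' : 0 < ρ := hρ
    rw [hJ₀ ρ hρ, abs_of_pos (by positivity), enorm_mul, mul_pow, ← mul_assoc,
      ← ofReal_norm (((1 / (4 * Real.pi * ρ) : ℝ)) : ℂ), Complex.norm_real,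
      Real.norm_of_nonneg (by positivity), ← ENNReal.ofReal_pow (by positivity),
      ← ENNReal.ofReal_mul (by positivity)]
    congr 2
    field_simp
  have hJ2 : MemLp J 2 := by
    refine ⟨hJm.aestronglyMeasurable, ?_⟩
    rw [eLpNorm_lt_top_iff_lintegral_rpow_enorm_lt_top (by norm_num) (by norm_num)]
    simpa [hJsq] using lt_top_iff_ne_top.2 hRtop
  have hF : ∀ t : ℝ, 𝓕 J t = ∫ ρ in Set.Ioi (0 : ℝ),
      Complex.exp (-(Complex.I * (t : ℂ) * (((2 * Real.pi * ρ) ^ 2 : ℝ) : ℂ))) * H ρ := fun t => by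
    rw [Real.fourier_real_eq_integral_exp_smul]
    have : ∀ τ : ℝ, Complex.exp (↑(-2 * Real.pi * τ * t) * Complex.I) • J τ =
        (Set.Ioi 0).indicator
          (fun τ => Complex.exp (↑(-2 * Real.pi * τ * t) * Complex.I) • J₀ τ) τ := fun τ => by
      by_cases h : τ ∈ Set.Ioi (0 : ℝ) <;> simp [J, Set.indicator, h]
    simp_rw [this]
    rw [integral_indicator measurableSet_Ioi]
    conv_lhs => rw [← image_two_pi_sq]
    rw [integral_image_eq_integral_abs_deriv_smul measurableSet_Ioi hder injOn_two_pi_sq]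
    refine setIntegral_congr_fun measurableSet_Ioi fun ρ hρ => ?_
    have hρ' : 0 < ρ := hρ
    rw [hJ₀ ρ hρ, abs_of_pos (by positivity), Complex.real_smul, smul_eq_mul, mul_left_comm,
      ← mul_assoc ((4 * Real.pi * ρ : ℝ) : ℂ),
      ← Complex.ofReal_mul, mul_one_div_cancel (by positivity), Complex.ofReal_one, one_mul]
    congr 2
    push_cast
    ring
  have h := eLpNorm_fourier_eq hJ1 hJ2
  rw [eLpNorm_eq_lintegral_rpow_enorm_toReal (by norm_num) (by norm_num),
    eLpNorm_eq_lintegral_rpow_enorm_toReal (by norm_num) (by norm_num)] at h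
  have h' := congrArg (fun x : ℝ≥0∞ => x ^ (2 : ℝ)) h
  simp only [← ENNReal.rpow_mul] at h'
  norm_num at h'
  simp_rw [← hF]
  rw [h', hJsq]

end Time

/-! ### Radial free solutions and local smoothing -/

noncomputable section

/-- The solution `∫ e^{2πix·ξ} e^{-it|2πξ|²} A(ξ) dξ` of the free Schrödinger equation. -/
def freeEvolution (A : R3 → ℂ) (t : ℝ) (x : R3) : ℂ :=
  𝓕⁻ (fun ξ : R3 => Complex.exp (-(Complex.I * (t : ℂ) * ((‖(2 * Real.pi) • ξ‖ ^ 2 : ℝ) : ℂ))) *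
    A ξ) x

theorem norm_schrodinger_symbol (t : ℝ) (a : ℝ) :
    ‖Complex.exp (-(Complex.I * (t : ℂ) * (a : ℂ)))‖ = 1 := by
  rw [show -(Complex.I * (t : ℂ) * (a : ℂ)) = ((-(t * a) : ℝ) : ℂ) * Complex.I by
    push_cast; ring]
  exact Complex.norm_exp_ofReal_mul_I _

theorem integrable_schrodinger_mul {A : R3 → ℂ} (hA : Integrable A) (t : ℝ) :
    Integrable fun ξ : R3 =>
      Complex.exp (-(Complex.I * (t : ℂ) * ((‖(2 * Real.pi) • ξ‖ ^ 2 : ℝ) : ℂ))) * A ξ :=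
  hA.bdd_mul (c := 1) (by fun_prop)
    (Filter.Eventually.of_forall fun ξ => (norm_schrodinger_symbol t _).le)

theorem continuous_freeEvolution {A : R3 → ℂ} (hA : Integrable A) :
    Continuous fun p : ℝ × R3 => freeEvolution A p.1 p.2 := by
  simp only [freeEvolution, Real.fourierInv_eq']
  refine continuous_of_dominated (bound := fun ξ => ‖A ξ‖) (fun p => ?_) (fun p => ?_) hA.norm ?_
  · simp only [smul_eq_mul]
    exact (by fun_prop : Continuous fun ξ : R3 =>
      Complex.exp (((2 * Real.pi * inner ℝ ξ p.2 : ℝ) : ℂ) * Complex.I)).aestronglyMeasurable.mul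
      (integrable_schrodinger_mul hA p.1).1
  · refine Filter.Eventually.of_forall fun ξ => ?_
    rw [norm_smul, norm_mul, norm_schrodinger_symbol, one_mul,
      Complex.norm_exp_ofReal_mul_I, one_mul]
  · refine Filter.Eventually.of_forall fun ξ => ?_
    fun_prop

/-- The vector with these components is, up to a factor, the gradient of a radial function, so at
|x|e₀ it points along e₀. Conjugating by the reflection that exchanges |x|e₀ and x expresses the
i-th component at x as a matrix entry, of size at most 1, times the 0-th component at |x|e₀. -/
theorem norm_fourierInv_coord_mul_le {Φ : ℝ → ℂ}
    (hΦ : ∀ l : Fin 3, Integrable fun ξ : R3 => (ξ l : ℂ) * Φ ‖ξ‖) (i : Fin 3) (x : R3) :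
    ‖𝓕⁻ (fun ξ : R3 => (ξ i : ℂ) * Φ ‖ξ‖) x‖ ≤
      ‖𝓕⁻ (fun ξ : R3 => (ξ 0 : ℂ) * Φ ‖ξ‖) (EuclideanSpace.single 0 ‖x‖)‖ := by
  set e : R3 := EuclideanSpace.single 0 ‖x‖ with he
  have hnorm : ‖e‖ = ‖x‖ := by simp [he]
  set A : R3 ≃ₗᵢ[ℝ] R3 := Submodule.reflection (ℝ ∙ (e - x))ᗮ with hA
  have hAe : A e = x := Submodule.reflection_sub hnorm
  -- Flipping the sign of the l-th coordinate fixes e and negates the integrand.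
  have hvanish : ∀ l : Fin 3, l ≠ 0 → 𝓕⁻ (fun ξ : R3 => (ξ l : ℂ) * Φ ‖ξ‖) e = 0 := fun l hl => by
    let B : R3 ≃ₗᵢ[ℝ] R3 := LinearIsometryEquiv.piLpCongrRight 2
      (fun j : Fin 3 => if j = l then LinearIsometryEquiv.neg ℝ else LinearIsometryEquiv.refl ℝ ℝ)
    have hBe : B e = e := by
      ext j
      by_cases hj : j = l
      · subst hj; simp [B, he, hl]
      · simp [B, hj]
    have h := Real.fourierInv_comp_linearIsometry B (fun ξ : R3 => (ξ l : ℂ) * Φ ‖ξ‖) e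
    have h2 : ((fun ξ : R3 => (ξ l : ℂ) * Φ ‖ξ‖) ∘ B) = fun ξ => -((ξ l : ℂ) * Φ ‖ξ‖) := by
      ext ξ
      simp only [Function.comp, LinearIsometryEquiv.norm_map]
      simp [B]
    rw [hBe, h2] at h
    have h3 : 𝓕⁻ (fun ξ : R3 => -((ξ l : ℂ) * Φ ‖ξ‖)) e =
        -𝓕⁻ (fun ξ : R3 => (ξ l : ℂ) * Φ ‖ξ‖) e := by
      simp only [Real.fourierInv_eq', smul_neg, integral_neg]
    rw [h3] at h
    exact self_eq_neg.1 h.symm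
  have hcoord : ∀ ξ : R3, ((A ξ) i : ℂ) = ∑ l, ((A (EuclideanSpace.single l 1)) i : ℂ) * ξ l :=
    fun ξ => by
      have h1 : ξ = ∑ l, ξ l • (EuclideanSpace.single l (1 : ℝ) : R3) := by
        ext j; simp [Finset.sum_apply, Pi.single_apply]
      conv_lhs => rw [h1]
      simp [mul_comm]
  have h := Real.fourierInv_comp_linearIsometry A (fun ξ : R3 => (ξ i : ℂ) * Φ ‖ξ‖) e
  rw [hAe] at h
  rw [← h]
  have h2 : ((fun ξ : R3 => (ξ i : ℂ) * Φ ‖ξ‖) ∘ A) =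
      fun ξ => ∑ l, ((A (EuclideanSpace.single l 1)) i : ℂ) * ((ξ l : ℂ) * Φ ‖ξ‖) := by
    ext ξ
    simp only [Function.comp, LinearIsometryEquiv.norm_map]
    rw [hcoord, Finset.sum_mul]
    simp only [mul_assoc]
  have h3 : 𝓕⁻ (fun ξ : R3 => ∑ l, ((A (EuclideanSpace.single l 1)) i : ℂ) *
      ((ξ l : ℂ) * Φ ‖ξ‖)) e = ∑ l, ((A (EuclideanSpace.single l 1)) i : ℂ) *
      𝓕⁻ (fun ξ : R3 => (ξ l : ℂ) * Φ ‖ξ‖) e := by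
    simp only [Real.fourierInv_eq', smul_eq_mul]
    simp only [Finset.mul_sum]
    rw [integral_finsetSum]
    · refine Finset.sum_congr rfl fun l _ => ?_
      rw [← integral_const_mul]
      refine integral_congr_ae (Filter.Eventually.of_forall fun ξ => ?_)
      simp only
      ring
    · intro l _
      refine ((hΦ l).const_mul _).bdd_mul (c := 1) (by fun_prop)
        (Filter.Eventually.of_forall fun ξ => ?_)
      rw [Complex.norm_exp_ofReal_mul_I]
  rw [h2, h3, Finset.sum_eq_single 0 (fun l _ hl => by rw [hvanish l hl, mul_zero]) (by simp),
    norm_mul]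
  have h4 : ‖((A (EuclideanSpace.single 0 1)) i : ℂ)‖ ≤ 1 := by
    rw [Complex.norm_real]
    refine (PiLp.norm_apply_le _ i).trans ?_
    simp
  calc _ ≤ 1 * ‖𝓕⁻ (fun ξ : R3 => (ξ 0 : ℂ) * Φ ‖ξ‖) e‖ := by gcongr
    _ = _ := one_mul _

/-- Integration by parts: the boundary terms and the remaining integral contribute ρ/(πr) each.
Trading one power of ρ for 1/r here is the source of the decay |x|⁻¹ in local smoothing. -/
theorem norm_integral_mul_cexp_le {r : ℝ} (hr : 0 < r) {ρ : ℝ} (hρ : 0 ≤ ρ) :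
    ‖∫ z in Set.Ioo (-ρ) ρ, (z : ℂ) * Complex.exp (((2 * Real.pi * (r * z) : ℝ) : ℂ) * Complex.I)‖ ≤
      2 * ρ / (Real.pi * r) := by
  have hpi := Real.pi_pos
  set c : ℂ := ((2 * Real.pi * r : ℝ) : ℂ) * Complex.I with hc
  have hcn : ‖c‖ = 2 * Real.pi * r := by
    rw [hc, norm_mul, Complex.norm_I, mul_one, Complex.norm_real,
      Real.norm_of_nonneg (by positivity)]
  have hc0 : c ≠ 0 := norm_pos_iff.1 (by rw [hcn]; positivity)
  have hexp : ∀ z : ℝ, Complex.exp (((2 * Real.pi * (r * z) : ℝ) : ℂ) * Complex.I) =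
      Complex.exp (c * z) := fun z => by
    congr 1; rw [hc]; push_cast; ring
  have hnexp : ∀ z : ℝ, ‖Complex.exp (c * z)‖ = 1 := fun z => by
    rw [← hexp, Complex.norm_exp_ofReal_mul_I]
  have hv : ∀ z : ℝ, HasDerivAt (fun z : ℝ => Complex.exp (c * z) / c) (Complex.exp (c * z)) z :=
    fun z => by
      have h1 : HasDerivAt (fun z : ℝ => c * (z : ℂ)) c z := by
        simpa using (Complex.ofRealCLM.hasDerivAt (x := z)).const_mul c
      have h2 := h1.cexp.div_const c
      rwa [mul_div_cancel_right₀ _ hc0] at h2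
  have hu : ∀ z : ℝ, HasDerivAt (fun z : ℝ => (z : ℂ)) 1 z := fun z =>
    Complex.ofRealCLM.hasDerivAt (x := z)
  have hparts := intervalIntegral.integral_mul_deriv_eq_deriv_mul (a := -ρ) (b := ρ)
    (fun z _ => hu z) (fun z _ => hv z)
    ((by fun_prop : Continuous fun _ : ℝ => (1 : ℂ)).intervalIntegrable _ _)
    ((by fun_prop : Continuous fun z : ℝ => Complex.exp (c * z)).intervalIntegrable _ _)
  simp_rw [hexp]
  rw [← integral_Ioc_eq_integral_Ioo, ← intervalIntegral.integral_of_le (by linarith), hparts]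
  have hdiv : ∀ z : ℝ, ‖Complex.exp (c * z) / c‖ = 1 / (2 * Real.pi * r) := fun z => by
    rw [norm_div, hnexp, hcn]
  have h1 : ‖∫ z in (-ρ)..ρ, 1 * (Complex.exp (c * z) / c)‖ ≤
      1 / (2 * Real.pi * r) * |ρ - -ρ| := by
    refine intervalIntegral.norm_integral_le_of_norm_le_const fun z _ => ?_
    rw [one_mul, hdiv]
  have h2 : ∀ z : ℝ, ‖(z : ℂ) * (Complex.exp (c * z) / c)‖ = |z| * (1 / (2 * Real.pi * r)) :=
    fun z => by rw [norm_mul, hdiv, Complex.norm_real, Real.norm_eq_abs]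
  refine (norm_sub_le _ _).trans ?_
  refine (add_le_add ((norm_sub_le _ _).trans (by rw [h2, h2])) h1).trans ?_
  rw [abs_neg, abs_of_nonneg hρ, sub_neg_eq_add, abs_of_nonneg (by linarith)]
  apply le_of_eq
  field_simp
  ring

/-- Integrating over spheres first leaves a one-dimensional integral in the radius, the form to
which Plancherel in time applies. Fubini supplies the integrability of the reduced integrand as well
as the formula. -/
theorem fourierInv_coord_mul_eq {Φ : ℝ → ℂ} (hm : Measurable Φ)
    (hΦ : Integrable fun ξ : R3 => (ξ 0 : ℂ) * Φ ‖ξ‖) (r : ℝ) :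
    IntegrableOn (fun ρ : ℝ => ((2 * Real.pi * ρ : ℝ) : ℂ) * Φ ρ *
        ∫ z in Set.Ioo (-ρ) ρ, (z : ℂ) *
          Complex.exp (((2 * Real.pi * (r * z) : ℝ) : ℂ) * Complex.I)) (Set.Ioi 0) ∧
    𝓕⁻ (fun ξ : R3 => (ξ 0 : ℂ) * Φ ‖ξ‖) (EuclideanSpace.single 0 r) =
      ∫ ρ in Set.Ioi (0 : ℝ), ((2 * Real.pi * ρ : ℝ) : ℂ) * Φ ρ *
        ∫ z in Set.Ioo (-ρ) ρ, (z : ℂ) *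
          Complex.exp (((2 * Real.pi * (r * z) : ℝ) : ℂ) * Complex.I) := by
  have hpi := Real.pi_pos
  let S : Set (ℝ × ℝ) := {p | |p.2| < p.1}
  have hS : MeasurableSet S := measurableSet_lt (by fun_prop) (by fun_prop)
  let E : ℝ → ℂ := fun z => Complex.exp (((2 * Real.pi * (r * z) : ℝ) : ℂ) * Complex.I)
  have hEm : Measurable E := by fun_prop
  have hE1 : ∀ z, ‖E z‖ = 1 := fun z => Complex.norm_exp_ofReal_mul_I _
  let F : ℝ × ℝ → ℂ := fun p => E p.2 * ((p.2 : ℂ) * Φ p.1)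
  have hFm : Measurable F := by fun_prop
  have hT : Measurable fun y : R3 => (‖y‖, y 0) := by fun_prop
  have e1 : 𝓕⁻ (fun ξ : R3 => (ξ 0 : ℂ) * Φ ‖ξ‖) (EuclideanSpace.single 0 r) =
      ∫ y : R3, F (‖y‖, y 0) := by
    rw [Real.fourierInv_eq']
    refine integral_congr_ae (Filter.Eventually.of_forall fun ξ => ?_)
    simp [F, E, EuclideanSpace.inner_single_right]
  have hint : Integrable (fun y : R3 => F (‖y‖, y 0)) :=
    hΦ.bdd_mul (c := 1) (hEm.comp (by fun_prop)).aestronglyMeasurable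
      (Filter.Eventually.of_forall fun ξ => (hE1 _).le)
  have hint2 : Integrable F ((volume : Measure R3).map (fun y => (‖y‖, y 0))) :=
    (integrable_map_measure hFm.aestronglyMeasurable hT.aemeasurable).2 hint
  have hdm : Measurable fun p : ℝ × ℝ => ENNReal.ofReal (2 * Real.pi * p.1) := by fun_prop
  have hint3 : Integrable (fun p : ℝ × ℝ => (ENNReal.ofReal (2 * Real.pi * p.1)).toReal • F p)
      (volume.restrict S) := by
    rw [map_norm_coord] at hint2
    exact (integrable_withDensity_iff_integrable_smul' hdm
      (Filter.Eventually.of_forall fun _ => ENNReal.ofReal_lt_top)).1 hint2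
  have hint4 := (integrable_indicator_iff hS).2 hint3
  rw [Measure.volume_eq_prod] at hint4
  have hinner : ∀ ρ : ℝ, (∫ z, S.indicator
      (fun p : ℝ × ℝ => (ENNReal.ofReal (2 * Real.pi * p.1)).toReal • F p) (ρ, z)) =
      (Set.Ioi 0).indicator (fun ρ : ℝ => ((2 * Real.pi * ρ : ℝ) : ℂ) * Φ ρ *
        ∫ z in Set.Ioo (-ρ) ρ, (z : ℂ) *
          Complex.exp (((2 * Real.pi * (r * z) : ℝ) : ℂ) * Complex.I)) ρ := fun ρ => by
    by_cases hρ : ρ ∈ Set.Ioi (0 : ℝ)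
    · have hρ' : 0 < ρ := hρ
      rw [Set.indicator_of_mem hρ, ← integral_const_mul, ← integral_indicator measurableSet_Ioo]
      refine integral_congr_ae (Filter.Eventually.of_forall fun z => ?_)
      simp only
      by_cases hz : z ∈ Set.Ioo (-ρ) ρ
      · rw [Set.indicator_of_mem hz, Set.indicator_of_mem (show (ρ, z) ∈ S from abs_lt.2 hz),
          ENNReal.toReal_ofReal (by positivity), Complex.real_smul]
        simp only [F, E]
        ring
      · rw [Set.indicator_of_notMem hz,
          Set.indicator_of_notMem (show (ρ, z) ∉ S from fun h => hz (abs_lt.1 h))]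
    · rw [Set.indicator_of_notMem hρ]
      refine integral_eq_zero_of_ae (Filter.Eventually.of_forall fun z => ?_)
      have hz : (ρ, z) ∉ S := fun h : |z| < ρ => hρ ((abs_nonneg z).trans_lt h)
      exact Set.indicator_of_notMem hz _
  refine ⟨?_, ?_⟩
  · rw [← integrable_indicator_iff measurableSet_Ioi]
    exact hint4.integral_prod_left.congr (Filter.Eventually.of_forall hinner)
  · rw [e1, ← integral_map hT.aemeasurable hFm.aestronglyMeasurable (f := F), map_norm_coord,
      integral_withDensity_eq_integral_toReal_smul hdm
        (Filter.Eventually.of_forall fun _ => ENNReal.ofReal_lt_top),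
      ← integral_indicator hS, Measure.volume_eq_prod, integral_prod _ hint4,
      ← integral_indicator measurableSet_Ioi]
    exact integral_congr_ae (Filter.Eventually.of_forall hinner)

/-- Local smoothing for the gradient of a radial free solution: `|x| |∇u(t,x)|` is bounded in
`L²_t` by the homogeneous `H^{1/2}` norm of the data. -/
theorem lintegral_enorm_sq_freeEvolution_coord_le {a : ℝ → ℂ} (hm : Measurable a)
    (ha : Integrable fun ξ : R3 => (ξ 0 : ℂ) * a ‖ξ‖) {r : ℝ} (hr : 0 < r) :
    ∫⁻ t, ‖freeEvolution (fun ξ => (ξ 0 : ℂ) * a ‖ξ‖) t (EuclideanSpace.single 0 r)‖ₑ ^ 2 ≤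
      ENNReal.ofReal (1 / r ^ 2) * ∫⁻ ξ : R3, ENNReal.ofReal ‖ξ‖ * ‖a ‖ξ‖‖ₑ ^ 2 := by
  have hpi := Real.pi_pos
  let kk : ℝ → ℂ := fun ρ => ∫ z in Set.Ioo (-ρ) ρ, (z : ℂ) *
          Complex.exp (((2 * Real.pi * (r * z) : ℝ) : ℂ) * Complex.I)
  let H : ℝ → ℂ := fun ρ => ((2 * Real.pi * ρ : ℝ) : ℂ) * a ρ * kk ρ
  have hkm : Measurable kk := by
    have : kk = fun ρ => ∫ z, {p : ℝ × ℝ | |p.2| < p.1}.indicator (fun p : ℝ × ℝ => (p.2 : ℂ) *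
          Complex.exp (((2 * Real.pi * (r * p.2) : ℝ) : ℂ) * Complex.I)) (ρ, z) := by
      ext ρ
      simp only [kk]
      rw [← integral_indicator measurableSet_Ioo]
      refine integral_congr_ae (Filter.Eventually.of_forall fun z => ?_)
      simp [Set.indicator, abs_lt]
    rw [this]
    refine (StronglyMeasurable.integral_prod_right' (f := _) ?_).measurable
    refine StronglyMeasurable.indicator ?_ (measurableSet_lt (by fun_prop) (by fun_prop))
    exact (by fun_prop : Continuous _).stronglyMeasurable
  have hHm : Measurable H := by fun_prop
  have hpolar : ∫⁻ ξ : R3, ENNReal.ofReal ‖ξ‖ * ‖a ‖ξ‖‖ₑ ^ 2 =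
      ∫⁻ ρ in Set.Ioi (0 : ℝ), ENNReal.ofReal (4 * Real.pi * ρ ^ 3) * ‖a ρ‖ₑ ^ 2 := by
    rw [lintegral_comp_norm (F := fun ρ => ENNReal.ofReal ρ * ‖a ρ‖ₑ ^ 2) (by fun_prop)]
    refine setLIntegral_congr_fun measurableSet_Ioi fun ρ hρ => ?_
    have hρ : 0 < ρ := hρ
    rw [← mul_assoc, ← ENNReal.ofReal_mul (by positivity)]
    congr 2
    ring
  have hHint : IntegrableOn H (Set.Ioi 0) := (fourierInv_coord_mul_eq hm ha r).1
  have key : ∀ t : ℝ, freeEvolution (fun ξ => (ξ 0 : ℂ) * a ‖ξ‖) t (EuclideanSpace.single 0 r) =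
      ∫ ρ in Set.Ioi (0 : ℝ),
        Complex.exp (-(Complex.I * (t : ℂ) * (((2 * Real.pi * ρ) ^ 2 : ℝ) : ℂ))) * H ρ := by
    intro t
    let Φ : ℝ → ℂ := fun ρ =>
      Complex.exp (-(Complex.I * (t : ℂ) * (((2 * Real.pi * ρ) ^ 2 : ℝ) : ℂ))) * a ρ
    have hΦm : Measurable Φ := by fun_prop
    have hfun : (fun ξ : R3 =>
        Complex.exp (-(Complex.I * (t : ℂ) * ((‖(2 * Real.pi) • ξ‖ ^ 2 : ℝ) : ℂ))) *
        ((ξ 0 : ℂ) * a ‖ξ‖)) = fun ξ => (ξ 0 : ℂ) * Φ ‖ξ‖ := by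
      ext ξ
      simp only [Φ]
      rw [norm_smul, Real.norm_of_nonneg (by positivity)]
      ring
    have hint := integrable_schrodinger_mul ha t
    rw [freeEvolution, hfun, (fourierInv_coord_mul_eq hΦm (hfun ▸ hint) r).2]
    refine setIntegral_congr_fun measurableSet_Ioi fun ρ hρ => ?_
    simp only [Φ, H, kk]
    ring
  simp_rw [key]
  refine (lintegral_enorm_sq_time_le hHm hHint).trans ?_
  rw [hpolar, ← lintegral_const_mul' _ _ ENNReal.ofReal_ne_top]
  refine setLIntegral_mono' measurableSet_Ioi fun ρ hρ => ?_
  have hρ' : 0 < ρ := hρ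
  -- Squared and multiplied by 1/(4πρ), this gives the density 4ρ³/(πr²), which lies below 4πρ³/r²,
  -- where 4πρ³ is the radial density of the right-hand side.
  have hH : ‖H ρ‖ₑ ≤ ENNReal.ofReal (4 * ρ ^ 2 / r) * ‖a ρ‖ₑ := by
    rw [← ofReal_norm, ← ofReal_norm, ← ENNReal.ofReal_mul (by positivity)]
    apply ENNReal.ofReal_le_ofReal
    simp only [H]
    rw [norm_mul, norm_mul, Complex.norm_real, Real.norm_of_nonneg (by positivity)]
    calc _ ≤ 2 * Real.pi * ρ * ‖a ρ‖ * (2 * ρ / (Real.pi * r)) := by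
          gcongr; exact norm_integral_mul_cexp_le hr hρ'.le
      _ = _ := by field_simp; ring
  calc _ ≤ ENNReal.ofReal (1 / (4 * Real.pi * ρ)) *
        (ENNReal.ofReal (4 * ρ ^ 2 / r) * ‖a ρ‖ₑ) ^ 2 := by
        gcongr
    _ = ENNReal.ofReal (4 / Real.pi * (ρ ^ 3 / r ^ 2)) * ‖a ρ‖ₑ ^ 2 := by
        rw [mul_pow, ← mul_assoc, ← ENNReal.ofReal_pow (by positivity),
          ← ENNReal.ofReal_mul (by positivity)]
        congr 2
        field_simp
    _ ≤ _ := by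
        rw [← mul_assoc, ← ENNReal.ofReal_mul (by positivity)]
        refine mul_le_mul' (ENNReal.ofReal_le_ofReal ?_) le_rfl
        have h3 : 4 / Real.pi ≤ 4 * Real.pi := by
          rw [div_le_iff₀ hpi]; nlinarith [Real.pi_gt_three]
        calc 4 / Real.pi * (ρ ^ 3 / r ^ 2) ≤ 4 * Real.pi * (ρ ^ 3 / r ^ 2) := by gcongr
          _ = _ := by ring

end

/-! ### Unit-scale averages of radial functions -/

section RadialConvolution

theorem integral_inv_sq_linear {R ρ : ℝ} (hρ : 0 ≤ ρ) :
    ∫ z in (-ρ)..ρ, ((1 + ρ ^ 2 + R ^ 2 - 2 * R * z) ^ 2)⁻¹ =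
      2 * ρ / ((1 + (R - ρ) ^ 2) * (1 + (R + ρ) ^ 2)) := by
  set D := 1 + ρ ^ 2 + R ^ 2 with hD
  have hD0 : 0 < D := by positivity
  have hpos : ∀ z ∈ Set.uIcc (-ρ) ρ, 0 < D - 2 * R * z := fun z hz => by
    rw [Set.uIcc_of_le (by linarith)] at hz
    have h1 : z ^ 2 ≤ ρ ^ 2 := sq_le_sq' (by linarith [hz.1]) hz.2
    nlinarith [sq_nonneg (R - z)]
  -- This antiderivative is normalized to vanish at z = 0, which keeps R out of the denominator: R =
  -- 0 needs no separate treatment.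
  have hder : ∀ z ∈ Set.uIcc (-ρ) ρ, HasDerivAt (fun z => z / (D * (D - 2 * R * z)))
      ((D - 2 * R * z) ^ 2)⁻¹ z := fun z hz => by
    have h0 := (hpos z hz).ne'
    have h1 : HasDerivAt (fun z => D * (D - 2 * R * z)) (D * (-(2 * R))) z := by
      have := (((hasDerivAt_id z).const_mul (2 * R)).const_sub D).const_mul D
      simpa using this
    have h2 := (hasDerivAt_id z).div h1 (mul_ne_zero hD0.ne' h0)
    refine h2.congr_deriv ?_
    simp only [id]
    field_simp
    ring
  rw [intervalIntegral.integral_eq_sub_of_hasDerivAt hder]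
  · have e1 : D - 2 * R * ρ = 1 + (R - ρ) ^ 2 := by rw [hD]; ring
    have e2 : D - 2 * R * -ρ = 1 + (R + ρ) ^ 2 := by rw [hD]; ring
    rw [e1, e2]
    have h1 : 0 < 1 + (R - ρ) ^ 2 := by positivity
    have h2 : 0 < 1 + (R + ρ) ^ 2 := by positivity
    field_simp
    rw [hD]; ring
  · refine ContinuousOn.intervalIntegrable ?_
    refine ContinuousOn.inv₀ (by fun_prop) fun z hz => ?_
    exact pow_ne_zero _ (hpos z hz).ne'

/-- After translating by x and moving x to the axis by a reflection, |u - x|² depends only on |u|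
and u₀, so the spherical integral is explicit. The two factors of the denominator belong to the
nearest and the farthest points of the sphere of radius ρ. -/
theorem lintegral_weight_mul_radial_eq {b : ℝ → ℝ≥0∞} (hb : Measurable b) (x : R3) :
    ∫⁻ y : R3, ENNReal.ofReal ((1 + ‖y‖ ^ 2) ^ 2)⁻¹ * b ‖x + y‖ =
      ∫⁻ ρ in Set.Ioi (0 : ℝ), ENNReal.ofReal (4 * Real.pi * ρ ^ 2 /
        ((1 + (‖x‖ - ρ) ^ 2) * (1 + (‖x‖ + ρ) ^ 2))) * b ρ := by
  have hpi := Real.pi_pos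
  set e : R3 := EuclideanSpace.single 0 ‖x‖ with he
  have hnorm : ‖e‖ = ‖x‖ := by simp [he]
  set A : R3 ≃ₗᵢ[ℝ] R3 := Submodule.reflection (ℝ ∙ (e - x))ᗮ with hA
  have hAe : A e = x := Submodule.reflection_sub hnorm
  let F : ℝ × ℝ → ℝ≥0∞ := fun p =>
    ENNReal.ofReal ((1 + p.1 ^ 2 + ‖x‖ ^ 2 - 2 * ‖x‖ * p.2) ^ 2)⁻¹ * b p.1
  have hF : Measurable F := by fun_prop
  calc ∫⁻ y : R3, ENNReal.ofReal ((1 + ‖y‖ ^ 2) ^ 2)⁻¹ * b ‖x + y‖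
      = ∫⁻ u : R3, ENNReal.ofReal ((1 + ‖u - x‖ ^ 2) ^ 2)⁻¹ * b ‖u‖ := by
        rw [← lintegral_add_left_eq_self
          (fun u : R3 => ENNReal.ofReal ((1 + ‖u - x‖ ^ 2) ^ 2)⁻¹ * b ‖u‖) x]
        simp
    _ = ∫⁻ u : R3, ENNReal.ofReal ((1 + ‖A u - x‖ ^ 2) ^ 2)⁻¹ * b ‖A u‖ := by
        rw [A.measurePreserving.lintegral_comp_emb A.toHomeomorph.measurableEmbedding
          (fun u : R3 => ENNReal.ofReal ((1 + ‖u - x‖ ^ 2) ^ 2)⁻¹ * b ‖u‖)]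
    _ = ∫⁻ u : R3, F (‖u‖, u 0) := by
        refine lintegral_congr fun u => ?_
        have h1 : ‖A u - x‖ ^ 2 = ‖u‖ ^ 2 - 2 * (‖x‖ * u 0) + ‖x‖ ^ 2 := by
          rw [← hAe, ← map_sub, LinearIsometryEquiv.norm_map, LinearIsometryEquiv.norm_map,
            norm_sub_sq_real, hnorm, he, EuclideanSpace.inner_single_right]
          simp
        simp only [F, LinearIsometryEquiv.norm_map, h1]
        congr 4
        ring
    _ = _ := by
        rw [lintegral_norm_coord_eq_iterated hF]
        refine setLIntegral_congr_fun measurableSet_Ioi fun ρ hρ => ?_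
        have hρ : 0 < ρ := hρ
        simp only [F]
        rw [lintegral_mul_const _ (by fun_prop), ← ofReal_integral_eq_lintegral_ofReal,
          ← integral_Ioc_eq_integral_Ioo, ← intervalIntegral.integral_of_le (by linarith),
          integral_inv_sq_linear hρ.le, ← mul_assoc, ← ENNReal.ofReal_mul (by positivity)]
        · congr 2
          ring
        · have hpos : ∀ z ∈ Set.Icc (-ρ) ρ, 0 < 1 + ρ ^ 2 + ‖x‖ ^ 2 - 2 * ‖x‖ * z := fun z hz => by
            have h1 : z ^ 2 ≤ ρ ^ 2 := sq_le_sq' (by linarith [hz.1]) hz.2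
            nlinarith [sq_nonneg (‖x‖ - z)]
          refine IntegrableOn.mono_set (ContinuousOn.integrableOn_Icc ?_) Set.Ioo_subset_Icc_self
          refine ContinuousOn.inv₀ (by fun_prop) fun z hz => ?_
          exact pow_ne_zero _ (hpos z hz).ne'
        · exact Filter.Eventually.of_forall fun z => by positivity

/-- The Jacobian R² is absorbed by 1 + (R+ρ)², and what is left is a translate of 1/(1+R²); hence
the uniformity in ρ. -/
theorem lintegral_radial_kernel_le (ρ : ℝ) (hρ : 0 < ρ) :
    ∫⁻ x : R3, ENNReal.ofReal (1 / ((1 + (‖x‖ - ρ) ^ 2) * (1 + (‖x‖ + ρ) ^ 2))) ≤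
      ENNReal.ofReal (4 * Real.pi ^ 2) := by
  have hpi := Real.pi_pos
  rw [lintegral_comp_norm
    (F := fun R => ENNReal.ofReal (1 / ((1 + (R - ρ) ^ 2) * (1 + (R + ρ) ^ 2)))) (by fun_prop)]
  calc _ ≤ ∫⁻ R in Set.Ioi (0 : ℝ), ENNReal.ofReal (4 * Real.pi * (1 + (R - ρ) ^ 2)⁻¹) := by
        refine setLIntegral_mono' measurableSet_Ioi fun R hR => ?_
        have hR : 0 < R := hR
        rw [← ENNReal.ofReal_mul (by positivity)]
        apply ENNReal.ofReal_le_ofReal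
        rw [mul_assoc]
        refine mul_le_mul_of_nonneg_left ?_ (by positivity)
        refine mul_le_mul_of_nonneg_left ?_ (by positivity) |>.trans_eq
          (b := R ^ 2 * (1 / ((1 + (R - ρ) ^ 2) * R ^ 2))) ?_
        · gcongr
          nlinarith
        · field_simp
    _ ≤ ∫⁻ R, ENNReal.ofReal (4 * Real.pi * (1 + (R - ρ) ^ 2)⁻¹) := setLIntegral_le_lintegral _ _
    _ = ∫⁻ R, ENNReal.ofReal (4 * Real.pi * (1 + R ^ 2)⁻¹) :=
        lintegral_sub_right_eq_self (fun R => ENNReal.ofReal (4 * Real.pi * (1 + R ^ 2)⁻¹)) ρ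
    _ = ENNReal.ofReal (4 * Real.pi ^ 2) := by
        rw [← ofReal_integral_eq_lintegral_ofReal (integrable_inv_one_add_sq.const_mul _)
          (Filter.Eventually.of_forall fun R => by positivity), integral_const_mul,
          integral_univ_inv_one_add_sq]
        congr 1; ring

/-- Smoothing a radial function at unit scale gains decay at infinity in `L^p`. -/
theorem lintegral_rpow_weight_mul_radial_le {p : ℝ} (hp : 1 ≤ p) {b : ℝ → ℝ≥0∞}
    (hb : Measurable b) :
    (∫⁻ x : R3, (∫⁻ y : R3, ENNReal.ofReal ((1 + ‖y‖ ^ 2) ^ 2)⁻¹ * b ‖x + y‖) ^ p) ^ (1 / p) ≤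
      ∫⁻ ρ in Set.Ioi (0 : ℝ),
        ENNReal.ofReal (16 * Real.pi ^ 3 * ρ ^ 2 * (1 + ρ ^ 2) ^ (-(1 - 1 / p))) * b ρ := by
  have hpi := Real.pi_pos
  have hp0 : 0 < p := by linarith
  simp_rw [lintegral_weight_mul_radial_eq hb]
  refine (lintegral_rpow_lintegral_le (by fun_prop) hp).trans ?_
  refine setLIntegral_mono' measurableSet_Ioi fun ρ hρ => ?_
  have hρ : 0 < ρ := hρ
  set kk : R3 → ℝ := fun x => 1 / ((1 + (‖x‖ - ρ) ^ 2) * (1 + (‖x‖ + ρ) ^ 2)) with hkk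
  have hk0 : ∀ x, 0 < kk x := fun x => by positivity
  -- The L^p norm of the kernel in x is interpolated between its supremum, at most (1+ρ²)⁻¹, and its
  -- integral, bounded uniformly in ρ. This produces the exponent -(1 - 1/p).
  have hkle : ∀ x, kk x ≤ (1 + ρ ^ 2)⁻¹ := fun x => by
    rw [hkk, inv_eq_one_div]
    have h1 : 1 + ρ ^ 2 ≤ (1 + (‖x‖ - ρ) ^ 2) * (1 + (‖x‖ + ρ) ^ 2) := by
      nlinarith [sq_nonneg (‖x‖ - ρ), norm_nonneg x, sq_nonneg ((‖x‖ - ρ) * (‖x‖ + ρ)),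
        mul_nonneg (norm_nonneg x) hρ.le]
    exact one_div_le_one_div_of_le (by positivity) h1
  have hkp : ∀ x, kk x ^ p ≤ (1 + ρ ^ 2) ^ (-(p - 1)) * kk x := fun x => by
    have : kk x ^ p = kk x ^ (p - 1) * kk x := by
      rw [← Real.rpow_add_one (hk0 x).ne']; congr 1; ring
    rw [this]
    refine mul_le_mul_of_nonneg_right ?_ (hk0 x).le
    rw [Real.rpow_neg (by positivity), ← Real.inv_rpow (by positivity)]
    exact Real.rpow_le_rpow (hk0 x).le (hkle x) (by linarith)
  have hLp : ∫⁻ x, ENNReal.ofReal (kk x) ^ p ≤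
      ENNReal.ofReal ((1 + ρ ^ 2) ^ (-(p - 1)) * (4 * Real.pi ^ 2)) := by
    calc ∫⁻ x, ENNReal.ofReal (kk x) ^ p
        ≤ ∫⁻ x, ENNReal.ofReal ((1 + ρ ^ 2) ^ (-(p - 1))) * ENNReal.ofReal (kk x) := by
          refine lintegral_mono fun x => ?_
          rw [ENNReal.ofReal_rpow_of_pos (hk0 x), ← ENNReal.ofReal_mul (by positivity)]
          exact ENNReal.ofReal_le_ofReal (hkp x)
      _ ≤ _ := by
          rw [lintegral_const_mul' _ _ ENNReal.ofReal_ne_top, ENNReal.ofReal_mul (by positivity)]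
          gcongr
          exact lintegral_radial_kernel_le ρ hρ
  have hfac : ∀ x : R3, (ENNReal.ofReal (4 * Real.pi * ρ ^ 2 /
      ((1 + (‖x‖ - ρ) ^ 2) * (1 + (‖x‖ + ρ) ^ 2))) * b ρ) ^ p =
      (ENNReal.ofReal (4 * Real.pi * ρ ^ 2) * b ρ) ^ p * ENNReal.ofReal (kk x) ^ p := fun x => by
    rw [← ENNReal.mul_rpow_of_nonneg _ _ hp0.le,
      mul_right_comm (ENNReal.ofReal (4 * Real.pi * ρ ^ 2)),
      ← ENNReal.ofReal_mul (by positivity), hkk, mul_one_div]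
  simp_rw [hfac]
  rw [lintegral_const_mul _ (by fun_prop), ENNReal.mul_rpow_of_nonneg _ _ (by positivity),
    ← ENNReal.rpow_mul, mul_one_div_cancel hp0.ne', ENNReal.rpow_one]
  have h2 : (∫⁻ x, ENNReal.ofReal (kk x) ^ p) ^ (1 / p) ≤
      ENNReal.ofReal ((1 + ρ ^ 2) ^ (-(1 - 1 / p)) * (4 * Real.pi ^ 2)) := by
    refine (ENNReal.rpow_le_rpow hLp (by positivity)).trans ?_
    rw [ENNReal.ofReal_rpow_of_nonneg (by positivity) (by positivity)]
    apply ENNReal.ofReal_le_ofReal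
    rw [Real.mul_rpow (by positivity) (by positivity), ← Real.rpow_mul (by positivity)]
    have e : -(p - 1) * (1 / p) = -(1 - 1 / p) := by field_simp
    rw [e]
    gcongr
    have h4 : 1 ≤ 4 * Real.pi ^ 2 := by nlinarith [Real.pi_gt_three]
    calc (4 * Real.pi ^ 2) ^ (1 / p) ≤ (4 * Real.pi ^ 2) ^ (1 : ℝ) :=
          Real.rpow_le_rpow_of_exponent_le h4 (by rw [div_le_one hp0]; exact hp)
      _ = _ := Real.rpow_one _
  calc _ ≤ ENNReal.ofReal (4 * Real.pi * ρ ^ 2) * b ρ *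
        ENNReal.ofReal ((1 + ρ ^ 2) ^ (-(1 - 1 / p)) * (4 * Real.pi ^ 2)) := by gcongr
    _ = _ := by
        rw [mul_right_comm, ← ENNReal.ofReal_mul (by positivity)]
        congr 2
        ring

end RadialConvolution

/-! ### Square function of the unit-scale frequency blocks, pointwise in space -/

section SquareFunction

theorem fourierInv_modulation (A : R3 → ℂ) (x y : R3) :
    𝓕⁻ (fun ξ : R3 => Complex.exp (((2 * Real.pi * inner ℝ ξ x : ℝ) : ℂ) * Complex.I) * A ξ) y =
      𝓕⁻ A (x + y) := by
  rw [Real.fourierInv_eq', Real.fourierInv_eq']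
  refine integral_congr_ae (Filter.Eventually.of_forall fun ξ => ?_)
  simp only [smul_eq_mul]
  rw [← mul_assoc, ← Complex.exp_add, inner_add_right]
  congr 2
  push_cast
  ring

theorem integrable_modulation {A : R3 → ℂ} (hA : Integrable A) (x : R3) :
    Integrable fun ξ : R3 =>
      Complex.exp (((2 * Real.pi * inner ℝ ξ x : ℝ) : ℂ) * Complex.I) * A ξ :=
  hA.bdd_mul (c := 1) (by fun_prop)
    (Filter.Eventually.of_forall fun ξ => (Complex.norm_exp_ofReal_mul_I _).le)

/-- A frequency cutoff acts as a convolution in space. -/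
theorem fourierInv_mul_eq_integral {A : R3 → ℂ} (hA : Integrable A) (S : 𝓢(R3, ℂ)) (x : R3) :
    𝓕⁻ (fun ξ => S ξ * A ξ) x = ∫ y, 𝓕 S y * 𝓕⁻ A (x + y) := by
  have h := integral_fourierInv_mul_eq_of_integrable (f := (𝓕 S : 𝓢(R3, ℂ)))
    (𝓕 S).integrable (integrable_modulation hA x)
  simp_rw [fourierInv_modulation] at h
  rw [← h, ← SchwartzMap.fourierInv_coe, FourierTransform.fourierInv_fourier_eq,
    Real.fourierInv_eq']
  refine integral_congr_ae (Filter.Eventually.of_forall fun ξ => ?_)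
  simp only [smul_eq_mul]
  ring

theorem fourier_comp_sub_const (S : 𝓢(R3, ℂ)) (a y : R3) :
    𝓕 (SchwartzMap.compSubConstCLM ℂ a S) y =
      Complex.exp (((-2 * Real.pi * inner ℝ a y : ℝ) : ℂ) * Complex.I) * 𝓕 S y := by
  rw [SchwartzMap.fourier_coe, SchwartzMap.fourier_coe, Real.fourier_eq', Real.fourier_eq',
    ← integral_const_mul, ← integral_add_right_eq_self _ a]
  refine integral_congr_ae (Filter.Eventually.of_forall fun ξ => ?_)
  simp only [smul_eq_mul, SchwartzMap.compSubConstCLM_apply, add_sub_cancel_right]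
  rw [← mul_assoc, ← Complex.exp_add, inner_add_left]
  congr 2
  push_cast
  ring

/-- The `L²` norm as a lower integral. -/
theorem eLpNorm_two_sq {α : Type*} [MeasurableSpace α] {μ : Measure α} (f : α → ℂ) :
    eLpNorm f 2 μ ^ 2 = ∫⁻ x, ‖f x‖ₑ ^ 2 ∂μ := by
  rw [eLpNorm_eq_lintegral_rpow_enorm_toReal (by norm_num) (by norm_num), ← ENNReal.rpow_natCast,
    ← ENNReal.rpow_mul]
  norm_num

theorem enorm_integral_mul_sq_le {α : Type*} [MeasurableSpace α] {μ : Measure α} {f g : α → ℂ}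
    (hf : AEStronglyMeasurable f μ) (hg : AEStronglyMeasurable g μ) {Q : Set α}
    (hQ : MeasurableSet Q) (hfQ : ∀ x, f x ≠ 0 → x ∈ Q) :
    ‖∫ x, f x * g x ∂μ‖ₑ ^ 2 ≤ (∫⁻ x, ‖f x‖ₑ ^ 2 ∂μ) * ∫⁻ x in Q, ‖g x‖ₑ ^ 2 ∂μ := by
  have h1 : ‖∫ x, f x * g x ∂μ‖ₑ ≤ ∫⁻ x, ‖f x‖ₑ * Q.indicator (fun x => ‖g x‖ₑ) x ∂μ := by
    refine (enorm_integral_le_lintegral_enorm _).trans (lintegral_mono fun x => ?_)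
    by_cases hx : x ∈ Q
    · simp [hx]
    · have : f x = 0 := by by_contra h; exact hx (hfQ x h)
      simp [this]
  have h2 := ENNReal.lintegral_mul_le_Lp_mul_Lq μ Real.HolderConjugate.two_two
    (f := fun x => ‖f x‖ₑ) (g := Q.indicator (fun x => ‖g x‖ₑ)) hf.enorm
    (hg.enorm.indicator hQ)
  have h3 : ∀ x, Q.indicator (fun x => ‖g x‖ₑ) x ^ (2 : ℝ) =
      Q.indicator (fun x => ‖g x‖ₑ ^ 2) x := fun x => by
    by_cases hx : x ∈ Q <;> simp [hx]
  simp_rw [h3] at h2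
  rw [lintegral_indicator hQ] at h2
  refine (pow_le_pow_left' (h1.trans h2) 2).trans_eq ?_
  rw [mul_pow, ← ENNReal.rpow_natCast, ← ENNReal.rpow_natCast, ← ENNReal.rpow_mul,
    ← ENNReal.rpow_mul]
  norm_num

/-- The cube of half-width one around a lattice point, in the frequency variable of the Fourier
transform. -/
def freqCube (k : Fin 3 → ℤ) : Set R3 := {ξ | ∀ i, |2 * Real.pi * ξ i - k i| ≤ 1}

theorem measurableSet_freqCube (k : Fin 3 → ℤ) : MeasurableSet (freqCube k) := by
  have : freqCube k = ⋂ i, {ξ : R3 | |2 * Real.pi * ξ i - k i| ≤ 1} := by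
    ext; simp [freqCube]
  rw [this]
  exact MeasurableSet.iInter fun i => measurableSet_le (by fun_prop) (by fun_prop)

theorem isClosed_freqCube (k : Fin 3 → ℤ) : IsClosed (freqCube k) := by
  have : freqCube k = ⋂ i, {ξ : R3 | |2 * Real.pi * ξ i - k i| ≤ 1} := by
    ext; simp [freqCube]
  rw [this]
  exact isClosed_iInter fun i => isClosed_le (by fun_prop) (by fun_prop)

-- Each coordinate of 2πξ is within distance one of at most three integers, and 27 = 3³.
open Classical in
theorem card_freqCube_le (K : Finset (Fin 3 → ℤ)) (ξ : R3) :
    (K.filter fun k => ξ ∈ freqCube k).card ≤ 27 := by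
  have hsub : (K.filter fun k => ξ ∈ freqCube k) ⊆ Fintype.piFinset fun i =>
      Finset.Icc ⌈2 * Real.pi * ξ i - 1⌉ ⌊2 * Real.pi * ξ i + 1⌋ := by
    intro k hk
    rw [Fintype.mem_piFinset]
    intro i
    have h := abs_le.1 ((Finset.mem_filter.1 hk).2 i)
    rw [Finset.mem_Icc, Int.ceil_le, Int.le_floor]
    constructor <;> linarith
  refine (Finset.card_le_card hsub).trans ?_
  rw [Fintype.card_piFinset]
  have h3 : ∀ i : Fin 3,
      (Finset.Icc ⌈2 * Real.pi * ξ i - 1⌉ ⌊2 * Real.pi * ξ i + 1⌋).card ≤ 3 := fun i => by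
    rw [Int.card_Icc]
    have h1 := Int.floor_le_ceil (2 * Real.pi * ξ i)
    rw [Int.ceil_sub_one, Int.floor_add_one]
    omega
  calc _ ≤ ∏ _i : Fin 3, 3 := Finset.prod_le_prod' fun i _ => h3 i
    _ = 27 := by simp

theorem sum_setLIntegral_freqCube_le (K : Finset (Fin 3 → ℤ)) {G : R3 → ℝ≥0∞}
    (hG : AEMeasurable G) : ∑ k ∈ K, ∫⁻ ξ in freqCube k, G ξ ≤ 27 * ∫⁻ ξ, G ξ := by
  classical
  simp_rw [← lintegral_indicator (measurableSet_freqCube _)]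
  rw [← lintegral_finsetSum' _ fun k _ => hG.indicator (measurableSet_freqCube k),
    ← lintegral_const_mul' _ _ (by norm_num)]
  refine lintegral_mono fun ξ => ?_
  have : ∑ k ∈ K, (freqCube k).indicator G ξ =
      ((K.filter fun k => ξ ∈ freqCube k).card : ℝ≥0∞) * G ξ := by
    rw [← nsmul_eq_mul, ← Finset.sum_const, Finset.sum_filter]
    refine Finset.sum_congr rfl fun k _ => ?_
    simp [Set.indicator]
  rw [this]
  gcongr
  exact_mod_cast card_freqCube_le K ξ

theorem IsWienerProfile.contDiff_dilation {ψ : R3 → ℝ} (hψ : IsWienerProfile ψ) :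
    ContDiff ℝ (⊤ : ℕ∞) fun ξ : R3 => (ψ ((2 * Real.pi) • ξ) : ℂ) :=
  Complex.ofRealCLM.contDiff.comp (hψ.smooth.comp (contDiff_const_smul _))

theorem IsWienerProfile.mem_freqCube {ψ : R3 → ℝ} (hψ : IsWienerProfile ψ) {k : Fin 3 → ℤ}
    {ξ : R3} (h : ψ ((2 * Real.pi) • ξ - latticePoint k) ≠ 0) : ξ ∈ freqCube k := fun i => by
  simpa [latticePoint] using hψ.support _ h i

theorem IsWienerProfile.tsupport_subset {ψ : R3 → ℝ} (hψ : IsWienerProfile ψ) :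
    tsupport (fun ξ : R3 => (ψ ((2 * Real.pi) • ξ) : ℂ)) ⊆ freqCube 0 := by
  refine closure_minimal (fun ξ hξ => hψ.mem_freqCube (k := 0) ?_) (isClosed_freqCube 0)
  have h0 : latticePoint 0 = 0 := by ext; simp [latticePoint]
  rw [h0, sub_zero]
  simpa using hξ

theorem freqCube_subset_closedBall : freqCube 0 ⊆ Metric.closedBall 0 2 := by
  intro ξ hξ
  have hpi := Real.pi_gt_three
  have h : ∀ i, ξ i ^ 2 ≤ 1 := fun i => by
    have h1 := hξ i
    simp only [Pi.zero_apply, Int.cast_zero, sub_zero, abs_mul] at h1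
    rw [abs_of_pos (by positivity : (0 : ℝ) < 2), abs_of_pos (by linarith)] at h1
    have h2 : |ξ i| ≤ 1 := by nlinarith [abs_nonneg (ξ i)]
    nlinarith [sq_abs (ξ i), abs_nonneg (ξ i)]
  rw [mem_closedBall_zero_iff, EuclideanSpace.norm_eq, Real.sqrt_le_left (by norm_num),
    Fin.sum_univ_three]
  simp only [Real.norm_eq_abs, sq_abs]
  linarith [h 0, h 1, h 2]

theorem IsWienerProfile.hasCompactSupport_dilation {ψ : R3 → ℝ} (hψ : IsWienerProfile ψ) :
    HasCompactSupport fun ξ : R3 => (ψ ((2 * Real.pi) • ξ) : ℂ) :=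
  (isCompact_closedBall (0 : R3) 2).of_isClosed_subset (isClosed_tsupport _)
    (hψ.tsupport_subset.trans freqCube_subset_closedBall)

/-- The profile `ψ(2π ·)` as a Schwartz function. -/
noncomputable def IsWienerProfile.schwartz {ψ : R3 → ℝ} (hψ : IsWienerProfile ψ) : 𝓢(R3, ℂ) :=
  hψ.hasCompactSupport_dilation.toSchwartzMap hψ.contDiff_dilation

theorem IsWienerProfile.schwartz_sub {ψ : R3 → ℝ} (hψ : IsWienerProfile ψ) (k : Fin 3 → ℤ)
    (ξ : R3) : SchwartzMap.compSubConstCLM ℂ ((2 * Real.pi)⁻¹ • latticePoint k) hψ.schwartz ξ =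
      (ψ ((2 * Real.pi) • ξ - latticePoint k) : ℂ) := by
  have hpi : (2 * Real.pi) ≠ 0 := by positivity
  rw [SchwartzMap.compSubConstCLM_apply]
  change ((ψ ((2 * Real.pi) • (ξ - (2 * Real.pi)⁻¹ • latticePoint k)) : ℝ) : ℂ) = _
  rw [smul_sub, smul_inv_smul₀ hpi]

open Laplacian in
/-- `φ = (1 - (2π)⁻²Δ) ψ(2π ·)` is supported where `ψ(2π ·)` is, and its Fourier transform is that
of `ψ(2π ·)` times `1 + |y|²`. -/
theorem IsWienerProfile.exists_schwartz_weight {ψ : R3 → ℝ} (hψ : IsWienerProfile ψ) :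
    ∃ φ : 𝓢(R3, ℂ), (∀ ξ, φ ξ ≠ 0 → ξ ∈ freqCube 0) ∧
      ∀ y, 𝓕 φ y = ((1 + ‖y‖ ^ 2 : ℝ) : ℂ) * 𝓕 hψ.schwartz y := by
  have hpi : (2 * Real.pi) ≠ 0 := by positivity
  have hs : tsupport (hψ.schwartz : R3 → ℂ) ⊆ freqCube 0 := hψ.tsupport_subset
  set M : 𝓢(R3, ℂ) := SchwartzMap.fourierMultiplierCLM ℂ (fun y : R3 => ‖y‖ ^ 2) hψ.schwartz
  have hM : Δ hψ.schwartz = (-(2 * Real.pi) ^ 2) • M :=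
    SchwartzMap.laplacian_eq_fourierMultiplierCLM _
  refine ⟨hψ.schwartz + M, fun ξ hξ => ?_, fun y => ?_⟩
  · by_contra hmem
    have hnot : ξ ∉ tsupport (hψ.schwartz : R3 → ℂ) := fun h => hmem (hs h)
    apply hξ
    have h1 : hψ.schwartz ξ = 0 := image_eq_zero_of_notMem_tsupport hnot
    have h2 : Δ hψ.schwartz ξ = 0 := by
      rw [SchwartzMap.laplacian_eq_sum (stdOrthonormalBasis ℝ R3), sum_apply]
      refine Finset.sum_eq_zero fun i _ => image_eq_zero_of_notMem_tsupport fun h => hnot ?_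
      exact SchwartzMap.tsupport_lineDerivOp_subset _ _
        (SchwartzMap.tsupport_lineDerivOp_subset _ _ h)
    rw [hM, smul_apply, smul_eq_zero] at h2
    have h3 : M ξ = 0 := h2.resolve_left (neg_ne_zero.2 (pow_ne_zero _ hpi))
    rw [add_apply, h1, h3, add_zero]
  · rw [FourierTransform.fourier_add, add_apply]
    have h4 : 𝓕 M = SchwartzMap.smulLeftCLM ℂ (fun y : R3 => ‖y‖ ^ 2) (𝓕 hψ.schwartz) := by
      simp only [M]
      rw [SchwartzMap.fourierMultiplierCLM_apply, FourierTransform.fourier_fourierInv_eq]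
    rw [h4, SchwartzMap.smulLeftCLM_apply_apply (by fun_prop), Complex.real_smul]
    push_cast
    ring

/-- For fixed x the numbers Q_k u(x) are local averages, over the cubes around k, of the Fourier
transform of the weighted translate b(y) = (1+|y|²)⁻¹ u(x+y). Cauchy–Schwarz on each cube, bounded
overlap of the cubes and Plancherel for b bound the sum of squares by ‖b‖₂². The decaying weight
localizes the estimate near x. -/
theorem exists_sum_enorm_sq_wiener_le {ψ : R3 → ℝ} (hψ : IsWienerProfile ψ) :
    ∃ C : ℝ≥0∞, C ≠ ∞ ∧ ∀ (A : R3 → ℂ), Integrable A → MemLp A 2 →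
      ∀ (K : Finset (Fin 3 → ℤ)) (x : R3),
        ∑ k ∈ K, ‖𝓕⁻ (fun ξ => (ψ ((2 * Real.pi) • ξ - latticePoint k) : ℂ) * A ξ) x‖ₑ ^ 2 ≤
          C * ∫⁻ y, ENNReal.ofReal ((1 + ‖y‖ ^ 2) ^ 2)⁻¹ * ‖𝓕⁻ A (x + y)‖ₑ ^ 2 := by
  obtain ⟨φ, hφs, hφ⟩ := hψ.exists_schwartz_weight
  have hφ2 : ∫⁻ ξ, ‖φ ξ‖ₑ ^ 2 ≠ ∞ := by
    have h : eLpNorm (φ : R3 → ℂ) 2 volume ≠ ∞ := (φ.memLp 2 volume).2.ne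
    rw [← eLpNorm_two_sq]
    exact ENNReal.pow_ne_top h
  refine ⟨(∫⁻ ξ, ‖φ ξ‖ₑ ^ 2) * 27, ENNReal.mul_ne_top hφ2 (by norm_num), fun A h1 h2 K x => ?_⟩
  set a : (Fin 3 → ℤ) → R3 := fun k => (2 * Real.pi)⁻¹ • latticePoint k
  have hw0 : ∀ y : R3, 0 < 1 + ‖y‖ ^ 2 := fun y => by positivity
  set u : R3 → ℂ := 𝓕⁻ A
  have hu : MemLp u 2 := by
    refine ⟨?_, by rw [eLpNorm_fourierInv_eq h1 h2]; exact h2.2⟩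
    simp only [u, Real.fourierInv_eq_fourier_comp_neg]
    exact (continuous_fourier_of_integrable h1.comp_neg).aestronglyMeasurable
  have hux : MemLp (fun y => u (x + y)) 2 :=
    hu.comp_measurePreserving (measurePreserving_add_left volume x)
  set w : R3 → ℂ := fun y => ((1 + ‖y‖ ^ 2)⁻¹ : ℝ)
  have hwc : Continuous w := by
    refine Complex.continuous_ofReal.comp (Continuous.inv₀ (by fun_prop) fun y => (hw0 y).ne')
  have hw2 : MemLp w 2 := by
    refine ⟨hwc.aestronglyMeasurable, ?_⟩
    rw [eLpNorm_lt_top_iff_lintegral_rpow_enorm_lt_top (by norm_num) (by norm_num)]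
    have hi := integrable_rpow_neg_one_add_norm_sq (E := R3) (r := 4) (μ := volume)
      (by simp; norm_num)
    refine lt_of_le_of_lt (lintegral_mono fun y => ?_) hi.2
    simp only [w]
    rw [← ofReal_norm, ← ofReal_norm, Complex.norm_real,
      Real.norm_of_nonneg (inv_nonneg.2 (hw0 y).le), Real.norm_of_nonneg (by positivity),
      ENNReal.ofReal_rpow_of_nonneg (by positivity) (by norm_num)]
    apply ENNReal.ofReal_le_ofReal
    rw [← Real.rpow_neg_one, ← Real.rpow_mul (hw0 y).le]
    norm_num
  -- Being a product of two L² functions, b is integrable, so its Fourier transform is an honest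
  -- integral to which the duality formula applies.
  set b : R3 → ℂ := fun y => w y * u (x + y)
  have hb1 : Integrable b := hw2.integrable_mul hux
  have hb2 : MemLp b 2 := by
    refine hux.of_le (hb1.1) (Filter.Eventually.of_forall fun y => ?_)
    simp only [b, norm_mul]
    refine mul_le_of_le_one_left (norm_nonneg _) ?_
    simp only [w]
    rw [Complex.norm_real, Real.norm_of_nonneg (inv_nonneg.2 (hw0 y).le)]
    exact inv_le_one_of_one_le₀ (by nlinarith [norm_nonneg y])
  have hbsq : ∫⁻ ξ, ‖𝓕 b ξ‖ₑ ^ 2 =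
      ∫⁻ y, ENNReal.ofReal ((1 + ‖y‖ ^ 2) ^ 2)⁻¹ * ‖u (x + y)‖ₑ ^ 2 := by
    rw [← eLpNorm_two_sq, eLpNorm_fourier_eq hb1 hb2, eLpNorm_two_sq]
    refine lintegral_congr fun y => ?_
    simp only [b, w]
    rw [enorm_mul, mul_pow, ← ofReal_norm (((1 + ‖y‖ ^ 2)⁻¹ : ℝ) : ℂ), Complex.norm_real,
      Real.norm_of_nonneg (inv_nonneg.2 (hw0 y).le),
      ← ENNReal.ofReal_pow (inv_nonneg.2 (hw0 y).le), inv_pow]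
  -- The factor 1 + |y|² in the Fourier transform of φ cancels the weight in b, and translating to
  -- the k-th cube multiplies both transforms by the same phase.
  have hkey : ∀ k, 𝓕⁻ (fun ξ => (ψ ((2 * Real.pi) • ξ - latticePoint k) : ℂ) * A ξ) x =
      ∫ ξ, SchwartzMap.compSubConstCLM ℂ (a k) φ ξ * 𝓕 b ξ := fun k => by
    simp_rw [← hψ.schwartz_sub k]
    rw [fourierInv_mul_eq_integral h1, ← integral_fourier_mul_eq_of_integrable
      (SchwartzMap.integrable _) hb1]
    refine integral_congr_ae (Filter.Eventually.of_forall fun y => ?_)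
    simp only [b, w]
    rw [← SchwartzMap.fourier_coe, fourier_comp_sub_const, fourier_comp_sub_const, hφ]
    have : (((1 + ‖y‖ ^ 2 : ℝ)) : ℂ) * (((1 + ‖y‖ ^ 2)⁻¹ : ℝ) : ℂ) = 1 := by
      rw [← Complex.ofReal_mul, mul_inv_cancel₀ (hw0 y).ne', Complex.ofReal_one]
    linear_combination (-(Complex.exp (((-2 * Real.pi * inner ℝ (a k) y : ℝ) : ℂ) * Complex.I)) *
      𝓕 hψ.schwartz y * u (x + y)) * this
  calc ∑ k ∈ K, ‖𝓕⁻ (fun ξ => (ψ ((2 * Real.pi) • ξ - latticePoint k) : ℂ) * A ξ) x‖ₑ ^ 2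
      ≤ ∑ k ∈ K, (∫⁻ ξ, ‖φ ξ‖ₑ ^ 2) * ∫⁻ ξ in freqCube k, ‖𝓕 b ξ‖ₑ ^ 2 := by
        refine Finset.sum_le_sum fun k _ => ?_
        rw [hkey]
        refine (enorm_integral_mul_sq_le (Q := freqCube k)
          (SchwartzMap.continuous _).aestronglyMeasurable
          (continuous_fourier_of_integrable hb1).aestronglyMeasurable
          (measurableSet_freqCube k) fun ξ hξ i => ?_).trans_eq ?_
        · rw [SchwartzMap.compSubConstCLM_apply] at hξ
          have h := hφs _ hξ i
          have hpi := Real.pi_pos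
          simp only [a, latticePoint, PiLp.sub_apply, PiLp.smul_apply, smul_eq_mul, Pi.zero_apply,
            Int.cast_zero, sub_zero] at h
          rwa [mul_sub, mul_inv_cancel_left₀ (by positivity)] at h
        · simp only [SchwartzMap.compSubConstCLM_apply]
          rw [lintegral_sub_right_eq_self fun ξ => ‖φ ξ‖ₑ ^ 2]
    _ = (∫⁻ ξ, ‖φ ξ‖ₑ ^ 2) * ∑ k ∈ K, ∫⁻ ξ in freqCube k, ‖𝓕 b ξ‖ₑ ^ 2 := by
        rw [Finset.mul_sum]
    _ ≤ (∫⁻ ξ, ‖φ ξ‖ₑ ^ 2) * (27 * ∫⁻ ξ, ‖𝓕 b ξ‖ₑ ^ 2) := by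
        gcongr
        exact sum_setLIntegral_freqCube_le K
          ((continuous_fourier_of_integrable hb1).measurable.enorm.pow_const 2).aemeasurable
    _ = _ := by rw [hbsq, mul_assoc]

end SquareFunction

/-! ### Temperate growth of the symbols -/

section TemperateGrowth

theorem hasTemperateGrowth_cexp_mul {c : ℂ} (hc : c.re = 0) :
    Function.HasTemperateGrowth fun s : ℝ => Complex.exp (c * s) := by
  have hder : ∀ s : ℝ, HasDerivAt (fun s : ℝ => Complex.exp (c * s)) (c * Complex.exp (c * s)) s :=
    fun s => by
      have h1 : HasDerivAt (fun z : ℝ => c * (z : ℂ)) c s := by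
        simpa using (Complex.ofRealCLM.hasDerivAt (x := s)).const_mul c
      simpa [mul_comm] using h1.cexp
  have hit : ∀ n : ℕ, iteratedDeriv n (fun s : ℝ => Complex.exp (c * s)) =
      fun s : ℝ => c ^ n * Complex.exp (c * s) := by
    intro n
    induction n with
    | zero => simp
    | succ n ih =>
      rw [iteratedDeriv_succ, ih]
      ext s
      rw [((hder s).const_mul (c ^ n)).deriv, pow_succ, mul_assoc]
  refine ⟨?_, fun n => ⟨0, ‖c‖ ^ n, fun s => ?_⟩⟩
  · exact Complex.contDiff_exp.comp (contDiff_const.mul Complex.ofRealCLM.contDiff)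
  · rw [norm_iteratedFDeriv_eq_norm_iteratedDeriv, hit, norm_mul, norm_pow, Complex.norm_exp]
    simp [hc]

theorem hasTemperateGrowth_schrodinger (t : ℝ) : Function.HasTemperateGrowth fun ξ : R3 =>
    Complex.exp (-(Complex.I * (t : ℂ) * ((‖(2 * Real.pi) • ξ‖ ^ 2 : ℝ) : ℂ))) := by
  have h1 := hasTemperateGrowth_cexp_mul (c := -(Complex.I * t)) (by simp)
  have h2 : Function.HasTemperateGrowth fun ξ : R3 => ‖(2 * Real.pi) • ξ‖ ^ 2 :=
    (Function.hasTemperateGrowth_norm_sq (H := R3)).comp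
      ((2 * Real.pi) • ContinuousLinearMap.id ℝ R3).hasTemperateGrowth
  have h3 := h1.comp h2
  simpa only [Function.comp_def, neg_mul] using h3

/-- Every derivative is bounded: by compactness on a ball, and outside it by scaling back to its
boundary sphere, since m is homogeneous of degree -(1-σ) there. The bounds depend on m and serve
only to compose multipliers on distributions; no quantitative estimate uses them. -/
theorem IsISymbol.hasTemperateGrowth {σ N : ℝ} (hN : 0 < N) (hσ : σ < 1) {m : R3 → ℝ}
    (hm : IsISymbol σ N m) : m.HasTemperateGrowth := by
  refine ⟨hm.smooth, fun n => ?_⟩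
  -- Strictly beyond 2N, so homogeneity holds in a neighbourhood of the sphere of radius R and may
  -- be differentiated there.
  set R := 2 * N + 1 with hR
  have hcont : Continuous fun x => ‖iteratedFDeriv ℝ n m x‖ :=
    (hm.smooth.of_le (mod_cast le_top)).continuous_iteratedFDeriv'.norm
  obtain ⟨C, hC⟩ := (isCompact_closedBall (0 : R3) R).exists_bound_of_continuousOn
    hcont.continuousOn
  refine ⟨0, C, fun x => ?_⟩
  rw [pow_zero, mul_one]
  by_cases hx : ‖x‖ ≤ R
  · simpa using hC x (by simpa using hx)
  push Not at hx
  have hR0 : 0 < R := by positivity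
  set l := ‖x‖ / R with hl
  have hl1 : 1 ≤ l := by rw [hl, one_le_div hR0]; exact hx.le
  have hl0 : 0 < l := by linarith
  set e : R3 := l⁻¹ • x with he
  have hle : l • e = x := by rw [he, smul_inv_smul₀ hl0.ne']
  have hne : ‖e‖ = R := by
    rw [he, norm_smul, norm_inv, Real.norm_of_nonneg hl0.le, hl]
    have : 0 < ‖x‖ := by linarith
    field_simp
  have hev : (fun y => m (l • y)) =ᶠ[nhds e] fun y => (l ^ (-(1 - σ))) • m y := by
    have hopen : ∀ᶠ y in nhds e, 2 * N < ‖y‖ := by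
      refine (continuous_norm.tendsto e).eventually (lt_mem_nhds ?_)
      rw [hne]; linarith
    filter_upwards [hopen] with y hy
    have hy0 : 0 < ‖y‖ := by linarith
    have h1 : ‖l • y‖ = l * ‖y‖ := by rw [norm_smul, Real.norm_of_nonneg hl0.le]
    rw [hm.high _ hy.le, hm.high (l • y) (by rw [h1]; nlinarith), h1, smul_eq_mul,
      Real.rpow_neg hl0.le, ← Real.inv_rpow hl0.le, ← Real.mul_rpow (by positivity) (by positivity)]
    congr 1
    field_simp
  have h1 := hev.iteratedFDeriv ℝ n
  have h2 := h1.eq_of_nhds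
  have h3 := congrFun (iteratedFDeriv_comp_const_smul (i := n) l
    (hm.smooth.of_le (mod_cast le_top))) e
  have h4 : iteratedFDeriv ℝ n (fun y => (l ^ (-(1 - σ))) • m y) e =
      (l ^ (-(1 - σ))) • iteratedFDeriv ℝ n m e :=
    iteratedFDeriv_const_smul_apply' (hm.smooth.of_le (mod_cast le_top)).contDiffAt
  rw [h4] at h2
  rw [h3, hle] at h2
  have h5 := congrArg norm h2
  rw [norm_smul, norm_smul, Real.norm_of_nonneg (by positivity),
    Real.norm_of_nonneg (by positivity)] at h5
  have h6 : ‖iteratedFDeriv ℝ n m e‖ ≤ C := by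
    simpa using hC e (by simp [hne])
  have h7 : l ^ (-(1 - σ)) ≤ 1 := Real.rpow_le_one_of_one_le_of_nonpos hl1 (by linarith)
  have h8 : 1 ≤ l ^ n := one_le_pow₀ hl1
  calc ‖iteratedFDeriv ℝ n m x‖ ≤ l ^ n * ‖iteratedFDeriv ℝ n m x‖ :=
        le_mul_of_one_le_left (norm_nonneg _) h8
    _ = l ^ (-(1 - σ)) * ‖iteratedFDeriv ℝ n m e‖ := h5
    _ ≤ ‖iteratedFDeriv ℝ n m e‖ := mul_le_of_le_one_left (norm_nonneg _) h7
    _ ≤ C := h6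

theorem IsISymbol.hasTemperateGrowth_dilation {σ N : ℝ} (hN : 0 < N) (hσ : σ < 1) {m : R3 → ℝ}
    (hm : IsISymbol σ N m) :
    Function.HasTemperateGrowth fun ξ : R3 => (m ((2 * Real.pi) • ξ) : ℂ) :=
  Function.Complex.hasTemperateGrowth_ofReal.comp ((hm.hasTemperateGrowth hN hσ).comp
    ((2 * Real.pi) • ContinuousLinearMap.id ℝ R3).hasTemperateGrowth)

theorem IsWienerProfile.hasTemperateGrowth {ψ : R3 → ℝ} (hψ : IsWienerProfile ψ)
    (k : Fin 3 → ℤ) : Function.HasTemperateGrowth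
      fun ξ : R3 => (ψ ((2 * Real.pi) • ξ - latticePoint k) : ℂ) := by
  simp_rw [← hψ.schwartz_sub k]
  exact SchwartzMap.hasTemperateGrowth _

end TemperateGrowth

/-! ### Frequency blocks of the distribution as functions -/

section Representation

theorem fourierMultiplierCLM_Lp_apply {a : R3 → ℂ} (ha : a.HasTemperateGrowth)
    (f : Lp ℂ 2 (volume : Measure R3))
    (hint : Integrable fun ξ => a ξ * (𝓕 f : Lp ℂ 2 (volume : Measure R3)) ξ) (φ : 𝓢(R3, ℂ)) :
    fourierMultiplierCLM ℂ a (f : 𝓢'(R3, ℂ)) φ =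
      ∫ x, φ x * 𝓕⁻ (fun ξ => a ξ * (𝓕 f : Lp ℂ 2 (volume : Measure R3)) ξ) x := by
  rw [fourierMultiplierCLM_apply_apply, ← TemperedDistribution.fourier_apply,
    Lp.fourier_toTemperedDistribution_eq, Lp.toTemperedDistribution_apply,
    ← integral_fourierInv_mul_eq_of_integrable φ.integrable hint]
  refine integral_congr_ae (Filter.Eventually.of_forall fun ξ => ?_)
  simp only [smul_eq_mul]
  rw [SchwartzMap.smulLeftCLM_apply_apply ha, smul_eq_mul, SchwartzMap.fourierInv_coe]
  ring

/-- The Fourier transform of `∂ᵢ I f`. -/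
noncomputable def gradIData (m : R3 → ℝ) (f : Lp ℂ 2 (volume : Measure R3)) (i : Fin 3)
    (ξ : R3) : ℂ :=
  (ξ i : ℂ) * (2 * Real.pi * Complex.I * m ((2 * Real.pi) • ξ) *
    (𝓕 f : Lp ℂ 2 (volume : Measure R3)) ξ)

/-- The four operators are multipliers and combine into one symbol. The cutoff ψ is what makes
integrable data possible, so that the distribution is given by an inverse Fourier integral. -/
theorem gradient3_wienerProj_apply {ψ : R3 → ℝ} (hψ : IsWienerProfile ψ) {σ N : ℝ} (hN : 0 < N)
    (hσ : σ < 1) {m : R3 → ℝ} (hm : IsISymbol σ N m) (f : Lp ℂ 2 (volume : Measure R3))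
    (k : Fin 3 → ℤ) (t : ℝ) (i : Fin 3)
    (hint : Integrable fun ξ => (ψ ((2 * Real.pi) • ξ - latticePoint k) : ℂ) * gradIData m f i ξ)
    (φ : 𝓢(R3, ℂ)) :
    gradient3 (iOperator m (schrodinger t (wienerProj ψ k (f : 𝓢'(R3, ℂ))))) i φ =
      ∫ x, φ x * freeEvolution
        (fun ξ => (ψ ((2 * Real.pi) • ξ - latticePoint k) : ℂ) * gradIData m f i ξ) t x := by
  have g1 := hψ.hasTemperateGrowth k
  have g2 := hasTemperateGrowth_schrodinger t
  have g3 := hm.hasTemperateGrowth_dilation hN hσ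
  have g4 : Function.HasTemperateGrowth fun ξ : R3 =>
      ((inner ℝ ξ (EuclideanSpace.single i (1 : ℝ) : R3) : ℝ) : ℂ) := by fun_prop
  have hpi : (2 * Real.pi * Complex.I : ℂ) ≠ 0 := by simp [Real.pi_ne_zero]
  rw [gradient3, iOperator, schrodinger, wienerProj, multD, multD, multD,
    TemperedDistribution.lineDeriv_eq_fourierMultiplierCLM,
    fourierMultiplierCLM_fourierMultiplierCLM_apply g1 g2,
    fourierMultiplierCLM_fourierMultiplierCLM_apply (g1.mul g2) g3,
    fourierMultiplierCLM_fourierMultiplierCLM_apply ((g1.mul g2).mul g3) g4]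
  set G := (((fun ξ : R3 => (ψ ((2 * Real.pi) • ξ - latticePoint k) : ℂ)) * fun ξ : R3 =>
    Complex.exp (-(Complex.I * (t : ℂ) * ((‖(2 * Real.pi) • ξ‖ ^ 2 : ℝ) : ℂ)))) *
    fun ξ : R3 => (m ((2 * Real.pi) • ξ) : ℂ)) * fun ξ : R3 =>
      ((inner ℝ ξ (EuclideanSpace.single i (1 : ℝ) : R3) : ℝ) : ℂ) with hG
  have hGg : G.HasTemperateGrowth := ((g1.mul g2).mul g3).mul g4
  have hfun : (fun ξ : R3 =>
      Complex.exp (-(Complex.I * (t : ℂ) * ((‖(2 * Real.pi) • ξ‖ ^ 2 : ℝ) : ℂ))) *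
      ((ψ ((2 * Real.pi) • ξ - latticePoint k) : ℂ) * gradIData m f i ξ)) =
      fun ξ => (2 * Real.pi * Complex.I) • (G ξ * (𝓕 f : Lp ℂ 2 (volume : Measure R3)) ξ) := by
    ext ξ
    simp only [gradIData, hG, Pi.mul_apply, EuclideanSpace.inner_single_right, smul_eq_mul]
    simp
    ring
  have hint2 : Integrable fun ξ => G ξ * (𝓕 f : Lp ℂ 2 (volume : Measure R3)) ξ := by
    have h := integrable_schrodinger_mul hint t
    rw [hfun] at h
    exact (integrable_smul_iff hpi _).1 h
  have hsm : ∀ T : 𝓢'(R3, ℂ), ((2 * Real.pi * Complex.I : ℂ) • T) φ =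
      (2 * Real.pi * Complex.I : ℂ) * T φ := fun T => rfl
  rw [hsm, fourierMultiplierCLM_Lp_apply hGg f hint2, ← integral_const_mul]
  refine integral_congr_ae (Filter.Eventually.of_forall fun x => ?_)
  simp only [freeEvolution]
  rw [hfun, Real.fourierInv_eq', Real.fourierInv_eq']
  simp only [smul_eq_mul]
  rw [mul_left_comm, ← integral_const_mul]
  congr 2
  ext ξ
  ring

end Representation

/-! ### Square function estimate in L²_t L^p_x -/

section SquareFunction

/-- The propagator has a radial symbol, so the data keep the form ξ_l times a radial function at all
times and `norm_fourierInv_coord_mul_le` applies for each t. -/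
theorem enorm_freeEvolution_coord_le {a : ℝ → ℂ}
    (ha : ∀ l : Fin 3, Integrable fun ξ : R3 => (ξ l : ℂ) * a ‖ξ‖) (i : Fin 3) (t : ℝ) (x : R3) :
    ‖freeEvolution (fun ξ : R3 => (ξ i : ℂ) * a ‖ξ‖) t x‖ₑ ≤
      ‖freeEvolution (fun ξ : R3 => (ξ 0 : ℂ) * a ‖ξ‖) t (EuclideanSpace.single 0 ‖x‖)‖ₑ := by
  set Φ : ℝ → ℂ := fun ρ =>
    Complex.exp (-(Complex.I * (t : ℂ) * (((2 * Real.pi * ρ) ^ 2 : ℝ) : ℂ))) * a ρ with hΦ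
  have h : ∀ l : Fin 3, (fun ξ : R3 =>
      Complex.exp (-(Complex.I * (t : ℂ) * ((‖(2 * Real.pi) • ξ‖ ^ 2 : ℝ) : ℂ))) *
        ((ξ l : ℂ) * a ‖ξ‖)) = fun ξ : R3 => (ξ l : ℂ) * Φ ‖ξ‖ := fun l => by
    ext ξ
    rw [norm_smul, Real.norm_of_nonneg (by positivity)]
    simp only [hΦ]
    ring
  simp only [freeEvolution, h]
  rw [enorm_le_iff_norm_le]
  refine norm_fourierInv_coord_mul_le (fun l => ?_) i x
  rw [← h l]
  exact integrable_schrodinger_mul (ha l) t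

theorem continuous_freeEvolution_single {A : R3 → ℂ} (hA : Integrable A) :
    Continuous fun z : ℝ × ℝ => freeEvolution A z.1 (EuclideanSpace.single 0 z.2) := by
  have hsing : Continuous fun z : ℝ × ℝ => (z.1, (EuclideanSpace.single 0 z.2 : R3)) := by
    refine continuous_fst.prodMk ?_
    have h : (fun z : ℝ × ℝ => (EuclideanSpace.single 0 z.2 : R3)) =
        fun z : ℝ × ℝ => z.2 • (EuclideanSpace.single 0 1 : R3) := by
      ext z j
      simp
    rw [h]
    exact continuous_snd.smul continuous_const
  have h := (continuous_freeEvolution hA).comp hsing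
  exact h

theorem memLp_schrodinger_mul {A : R3 → ℂ} (hA : MemLp A 2) (t : ℝ) :
    MemLp (fun ξ : R3 =>
      Complex.exp (-(Complex.I * (t : ℂ) * ((‖(2 * Real.pi) • ξ‖ ^ 2 : ℝ) : ℂ))) * A ξ) 2 := by
  refine hA.of_le ((by fun_prop : Continuous fun ξ : R3 => Complex.exp
    (-(Complex.I * (t : ℂ) * ((‖(2 * Real.pi) • ξ‖ ^ 2 : ℝ) : ℂ)))).aestronglyMeasurable.mul hA.1)
    (Filter.Eventually.of_forall fun ξ => ?_)
  rw [norm_mul, norm_schrodinger_symbol, one_mul]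

/-- Convergence at infinity asks for 2(1 - 1/q) > 1. With q = p/2 this is the condition p > 4, the
origin of the restriction on r. -/
theorem lintegral_one_add_sq_rpow_lt_top {q : ℝ} (hq : 2 < q) :
    ∫⁻ ρ in Set.Ioi (0 : ℝ), ENNReal.ofReal ((1 + ρ ^ 2) ^ (-(1 - 1 / q))) ≠ ∞ := by
  have hq0 : 0 < q := by linarith
  have h1 : (Module.finrank ℝ ℝ : ℝ) < 2 * (1 - 1 / q) := by
    simp only [Module.finrank_self, Nat.cast_one]
    have : 1 / q < 1 / 2 := one_div_lt_one_div_of_lt (by norm_num) hq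
    linarith
  have h := (integrable_rpow_neg_one_add_norm_sq (μ := (volume : Measure ℝ)) h1).lintegral_lt_top
  refine ((setLIntegral_le_lintegral _ _).trans_lt ?_).ne
  refine lt_of_eq_of_lt (lintegral_congr fun ρ => ?_) h
  rw [Real.norm_eq_abs, sq_abs]
  congr 2
  ring

/-- The square function of the Wiener blocks of a radial free evolution in `L²_t L^p_x`. -/
theorem exists_lintegral_square_function_le {ψ : R3 → ℝ} (hψ : IsWienerProfile ψ) {p : ℝ}
    (hp : 4 < p) :
    ∃ C : ℝ≥0∞, C ≠ ∞ ∧ ∀ a : ℝ → ℂ, Measurable a →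
      (∀ l : Fin 3, Integrable fun ξ : R3 => (ξ l : ℂ) * a ‖ξ‖) →
      (∀ l : Fin 3, MemLp (fun ξ : R3 => (ξ l : ℂ) * a ‖ξ‖) 2) →
      ∀ (K : Finset (Fin 3 → ℤ)) (i : Fin 3),
        ∫⁻ t, (∫⁻ x, (∑ k ∈ K, ‖freeEvolution (fun ξ : R3 =>
          (ψ ((2 * Real.pi) • ξ - latticePoint k) : ℂ) * ((ξ i : ℂ) * a ‖ξ‖)) t x‖ₑ ^ 2) ^
            (p / 2)) ^ (2 / p) ≤
          C * ∫⁻ ξ : R3, ENNReal.ofReal ‖ξ‖ * ‖a ‖ξ‖‖ₑ ^ 2 := by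
  obtain ⟨C, hC, hCA⟩ := exists_sum_enorm_sq_wiener_le hψ
  have hq : 2 < p / 2 := by linarith
  set q := p / 2 with hqdef
  have hq0 : 0 < q := by linarith
  have hpq : 2 / p = 1 / q := by rw [hqdef]; field_simp
  rw [hpq]
  refine ⟨C * (ENNReal.ofReal (16 * Real.pi ^ 3) *
    ∫⁻ ρ in Set.Ioi (0 : ℝ), ENNReal.ofReal ((1 + ρ ^ 2) ^ (-(1 - 1 / q)))),
    ENNReal.mul_ne_top hC (ENNReal.mul_ne_top ENNReal.ofReal_ne_top
      (lintegral_one_add_sq_rpow_lt_top hq)), fun a ham ha1 ha2 K i => ?_⟩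
  set b : ℝ → ℝ → ℝ≥0∞ := fun t ρ =>
    ‖freeEvolution (fun ξ : R3 => (ξ 0 : ℂ) * a ‖ξ‖) t (EuclideanSpace.single 0 ρ)‖ₑ ^ 2 with hb
  have hbm : Measurable (Function.uncurry b) := by
    have h1 := continuous_freeEvolution_single (ha1 0)
    exact h1.measurable.enorm.pow_const 2
  set D := ∫⁻ ξ : R3, ENNReal.ofReal ‖ξ‖ * ‖a ‖ξ‖‖ₑ ^ 2 with hD
  set w : ℝ → ℝ≥0∞ := fun ρ =>
    ENNReal.ofReal (16 * Real.pi ^ 3 * ρ ^ 2 * (1 + ρ ^ 2) ^ (-(1 - 1 / q))) with hw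
  have hwm : Measurable w := by
    simp only [hw]
    fun_prop
  -- The propagator commutes with the frequency cutoffs, so the pointwise bound applies to the
  -- evolved data; radial symmetry then replaces the evolution at x + y by its value on the axis at
  -- distance ‖x + y‖.
  have hpt : ∀ t x, ∑ k ∈ K, ‖freeEvolution (fun ξ : R3 =>
      (ψ ((2 * Real.pi) • ξ - latticePoint k) : ℂ) * ((ξ i : ℂ) * a ‖ξ‖)) t x‖ₑ ^ 2 ≤
      C * ∫⁻ y : R3, ENNReal.ofReal ((1 + ‖y‖ ^ 2) ^ 2)⁻¹ * b t ‖x + y‖ := by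
    intro t x
    have h := hCA _ (integrable_schrodinger_mul (ha1 i) t) (memLp_schrodinger_mul (ha2 i) t) K x
    simp only [freeEvolution]
    simp_rw [mul_left_comm (Complex.exp _)]
    simp_rw [mul_left_comm (Complex.exp _)] at h
    refine h.trans (mul_le_mul_right (lintegral_mono fun y => mul_le_mul_right ?_ _) _)
    have h2 := enorm_freeEvolution_coord_le ha1 i t (x + y)
    refine le_trans (le_of_eq ?_) (pow_le_pow_left' h2 2)
    simp only [freeEvolution]
    simp_rw [mul_left_comm (Complex.exp _)]
  have ht : ∀ t, (∫⁻ x, (∑ k ∈ K, ‖freeEvolution (fun ξ : R3 =>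
      (ψ ((2 * Real.pi) • ξ - latticePoint k) : ℂ) * ((ξ i : ℂ) * a ‖ξ‖)) t x‖ₑ ^ 2) ^
        q) ^ (1 / q) ≤ C * ∫⁻ ρ in Set.Ioi (0 : ℝ), w ρ * b t ρ := by
    intro t
    refine (ENNReal.rpow_le_rpow (lintegral_mono fun x =>
      ENNReal.rpow_le_rpow (hpt t x) hq0.le) (by positivity)).trans ?_
    simp_rw [ENNReal.mul_rpow_of_nonneg _ _ hq0.le]
    rw [lintegral_const_mul' _ _ (ENNReal.rpow_ne_top_of_nonneg hq0.le hC),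
      ENNReal.mul_rpow_of_nonneg _ _ (by positivity), ← ENNReal.rpow_mul,
      mul_one_div_cancel hq0.ne', ENNReal.rpow_one]
    refine mul_le_mul_right ?_ _
    exact lintegral_rpow_weight_mul_radial_le (by linarith) (hbm.of_uncurry_left)
  refine (lintegral_mono ht).trans ?_
  rw [lintegral_const_mul' _ _ hC, mul_assoc C]
  refine mul_le_mul_right ?_ _
  -- With time integrated first, local smoothing at fixed ρ gives a factor ρ⁻² that cancels the ρ²
  -- of the weight.
  rw [lintegral_lintegral_swap
    ((hwm.comp measurable_snd).mul hbm).aemeasurable, ← lintegral_const_mul' _ _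
      ENNReal.ofReal_ne_top, ← lintegral_mul_const _ (by fun_prop)]
  refine setLIntegral_mono' measurableSet_Ioi fun ρ hρ => ?_
  have hρ' : (0 : ℝ) < ρ := hρ
  rw [lintegral_const_mul _ (hbm.of_uncurry_right)]
  refine (mul_le_mul_right (lintegral_enorm_sq_freeEvolution_coord_le ham (ha1 0) hρ') _).trans ?_
  rw [← mul_assoc]
  refine mul_le_mul_left (le_of_eq ?_) _
  simp only [hw]
  rw [← ENNReal.ofReal_mul (by positivity), ← ENNReal.ofReal_mul (by positivity)]
  congr 1
  field_simp

end SquareFunction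

/-! ### Bernstein's inequality -/

section Bernstein

theorem exists_schwartz_eq_one_on_closedBall :
    ∃ S : 𝓢(R3, ℂ), ∀ ξ : R3, ‖ξ‖ ≤ 1 → S ξ = 1 := by
  set χ : ContDiffBump (0 : R3) := ⟨1, 2, one_pos, one_lt_two⟩
  have hcs : HasCompactSupport fun ξ : R3 => ((χ ξ : ℝ) : ℂ) :=
    χ.hasCompactSupport.comp_left (g := fun z : ℝ => (z : ℂ)) Complex.ofReal_zero
  have hcd : ContDiff ℝ (⊤ : ℕ∞) fun ξ : R3 => ((χ ξ : ℝ) : ℂ) :=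
    Complex.ofRealCLM.contDiff.comp χ.contDiff
  refine ⟨hcs.toSchwartzMap hcd, fun ξ hξ => ?_⟩
  have : χ ξ = 1 := χ.one_of_mem_closedBall (by simpa [χ] using hξ)
  change ((χ ξ : ℝ) : ℂ) = 1
  rw [this, Complex.ofReal_one]

/-- Multiplying by a Schwartz function equal to 1 on the unit ball does not change A, so its
transform reproduces itself by convolution with a fixed Schwartz kernel; Hölder's inequality
finishes. -/
theorem exists_enorm_fourierInv_le_of_support_unit {p : ℝ} (hp : 1 < p) :
    ∃ C : ℝ≥0∞, C ≠ ∞ ∧ ∀ A : R3 → ℂ, Integrable A → (∀ ξ, A ξ ≠ 0 → ‖ξ‖ ≤ 1) → ∀ x,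
      ‖𝓕⁻ A x‖ₑ ≤ C * (∫⁻ y, ‖𝓕⁻ A y‖ₑ ^ p) ^ (1 / p) := by
  obtain ⟨S, hS⟩ := exists_schwartz_eq_one_on_closedBall
  have hpq : (p.conjExponent).HolderConjugate p := (Real.HolderConjugate.conjExponent hp).symm
  set q := p.conjExponent
  have hq0 : 0 < q := hpq.pos
  have hq1 : ENNReal.ofReal q ≠ 0 := by simpa using hq0
  have hSq : ∫⁻ y, ‖(𝓕 S : 𝓢(R3, ℂ)) y‖ₑ ^ q ≠ ∞ := by
    have h : MemLp (𝓕 S : 𝓢(R3, ℂ)) (ENNReal.ofReal q) volume := (𝓕 S).memLp _ _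
    have h2 := (lintegral_rpow_enorm_lt_top_of_eLpNorm_lt_top hq1 ENNReal.ofReal_ne_top h.2).ne
    rwa [ENNReal.toReal_ofReal hq0.le] at h2
  refine ⟨(∫⁻ y, ‖(𝓕 S : 𝓢(R3, ℂ)) y‖ₑ ^ q) ^ (1 / q),
    ENNReal.rpow_ne_top_of_nonneg (by positivity) hSq, fun A hA hs x => ?_⟩
  have hAS : A = fun ξ => S ξ * A ξ := by
    ext ξ
    by_cases h : A ξ = 0
    · simp [h]
    · rw [hS ξ (hs ξ h), one_mul]
  have hcont : Continuous (𝓕⁻ A) := by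
    rw [show 𝓕⁻ A = fun x => 𝓕 A (-x) from funext fun x => Real.fourierInv_eq_fourier_neg A x]
    exact (continuous_fourier_of_integrable hA).comp continuous_neg
  have hx : 𝓕⁻ A x = ∫ y, (𝓕 S : 𝓢(R3, ℂ)) y * 𝓕⁻ A (x + y) := by
    conv_lhs => rw [hAS]
    exact fourierInv_mul_eq_integral hA S x
  rw [hx]
  refine (enorm_integral_le_lintegral_enorm _).trans ?_
  simp_rw [enorm_mul]
  refine (ENNReal.lintegral_mul_le_Lp_mul_Lq volume hpq
    (𝓕 S).continuous.enorm.aemeasurable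
    (hcont.comp (continuous_const.add continuous_id)).enorm.aemeasurable).trans (le_of_eq ?_)
  congr 2
  exact lintegral_add_left_eq_self (fun y => ‖𝓕⁻ A y‖ₑ ^ p) x

theorem lintegral_comp_smul_R3 {R : ℝ} (hR : 0 < R) {F : R3 → ℝ≥0∞} (hF : Measurable F) :
    ∫⁻ x, F (R • x) = ENNReal.ofReal ((R ^ 3)⁻¹) * ∫⁻ x, F x := by
  have h := Measure.map_addHaar_smul (volume : Measure R3) hR.ne'
  rw [finrank_euclideanSpace_fin, abs_of_pos (by positivity)] at h
  rw [← lintegral_map hF (measurable_const_smul R)]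
  have : Measure.map (fun x : R3 => R • x) volume = Measure.map (R • ·) volume := rfl
  rw [h, lintegral_smul_measure, smul_eq_mul]

theorem fourierInv_comp_smul_R3 {R : ℝ} (hR : 0 < R) (A : R3 → ℂ) (x : R3) :
    𝓕⁻ (fun ξ => A (R • ξ)) x = ((R ^ 3)⁻¹ : ℝ) • 𝓕⁻ A (R⁻¹ • x) := by
  rw [Real.fourierInv_eq', Real.fourierInv_eq']
  have h := Measure.integral_comp_smul (volume : Measure R3) (fun ξ : R3 =>
    Complex.exp (((2 * Real.pi * inner ℝ ξ (R⁻¹ • x) : ℝ) : ℂ) * Complex.I) • A ξ) R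
  rw [finrank_euclideanSpace_fin, abs_of_pos (by positivity)] at h
  rw [← h]
  congr 1
  ext ξ
  rw [inner_smul_left, inner_smul_right]
  simp only [conj_trivial]
  rw [← mul_assoc R, mul_inv_cancel₀ hR.ne', one_mul]

/-- Bernstein's inequality for functions with frequencies in a ball. -/
theorem exists_enorm_fourierInv_le_of_support {p : ℝ} (hp : 1 < p) :
    ∃ C : ℝ≥0∞, C ≠ ∞ ∧ ∀ (R : ℝ), 0 < R → ∀ A : R3 → ℂ, Integrable A →
      (∀ ξ, A ξ ≠ 0 → ‖ξ‖ ≤ R) → ∀ x,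
      ‖𝓕⁻ A x‖ₑ ≤ C * ENNReal.ofReal (R ^ (3 / p)) * (∫⁻ y, ‖𝓕⁻ A y‖ₑ ^ p) ^ (1 / p) := by
  obtain ⟨C, hC, h⟩ := exists_enorm_fourierInv_le_of_support_unit hp
  have hp0 : 0 < p := by linarith
  refine ⟨C, hC, fun R hR A hA hs x => ?_⟩
  have hcont : Continuous (𝓕⁻ A) := by
    rw [show 𝓕⁻ A = fun x => 𝓕 A (-x) from funext fun x => Real.fourierInv_eq_fourier_neg A x]
    exact (continuous_fourier_of_integrable hA).comp continuous_neg
  -- Rescaling to the unit ball and evaluating at R • x. The Jacobian R³ in the L^p integral becomes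
  -- R^{3/p}; the factors R⁻³ on the two sides cancel.
  have h1 := h (fun ξ => A (R • ξ)) (hA.comp_smul hR.ne') (fun ξ hξ => by
    have := hs _ hξ
    rw [norm_smul, Real.norm_of_nonneg hR.le] at this
    exact le_of_mul_le_mul_left (by linarith) hR) (R • x)
  simp_rw [fourierInv_comp_smul_R3 hR, enorm_smul, inv_smul_smul₀ hR.ne'] at h1
  set c : ℝ≥0∞ := ‖((R ^ 3)⁻¹ : ℝ)‖ₑ with hc
  have hc0 : c ≠ 0 := by
    rw [hc, Ne, enorm_eq_zero]; positivity
  have hct : c ≠ ∞ := enorm_ne_top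
  simp_rw [ENNReal.mul_rpow_of_nonneg _ _ hp0.le] at h1
  rw [lintegral_const_mul' _ _ (ENNReal.rpow_ne_top_of_nonneg hp0.le hct),
    ENNReal.mul_rpow_of_nonneg _ _ (by positivity), ← ENNReal.rpow_mul,
    mul_one_div_cancel hp0.ne', ENNReal.rpow_one,
    lintegral_comp_smul_R3 (inv_pos.2 hR) (F := fun y => ‖𝓕⁻ A y‖ₑ ^ p)
      (hcont.measurable.enorm.pow_const p), mul_left_comm,
    ENNReal.mul_le_mul_iff_right hc0 hct, ENNReal.mul_rpow_of_nonneg _ _ (by positivity),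
    ENNReal.ofReal_rpow_of_pos (by positivity), ← mul_assoc] at h1
  convert h1 using 4
  rw [inv_pow, inv_inv, ← Real.rpow_natCast, ← Real.rpow_mul hR.le]
  congr 1
  push_cast
  ring

end Bernstein

/-! ### The L² Fourier transform of a radial function -/

section RadialFourier

theorem fourier_radial {f : R3 → ℂ} (hf : ∃ F : ℝ → ℂ, ∀ᵐ x : R3, f x = F ‖x‖) (ξ : R3) :
    𝓕 f ξ = 𝓕 f (EuclideanSpace.single 0 ‖ξ‖) := by
  obtain ⟨F, hF⟩ := hf
  set e : R3 := EuclideanSpace.single 0 ‖ξ‖ with he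
  have hnorm : ‖ξ‖ = ‖e‖ := by simp [he]
  set A : R3 ≃ₗᵢ[ℝ] R3 := Submodule.reflection (ℝ ∙ (ξ - e))ᗮ with hA
  have hAe : A ξ = e := Submodule.reflection_sub hnorm
  rw [← hAe, ← Real.fourier_comp_linearIsometry]
  have hfA : f =ᵐ[volume] f ∘ A := by
    have h := A.measurePreserving.quasiMeasurePreserving.ae hF
    filter_upwards [hF, h] with x h1 h2
    rw [Function.comp_apply, h1, h2, A.norm_map]
  rw [Real.fourier_eq, Real.fourier_eq]
  refine integral_congr_ae ?_
  filter_upwards [hfA] with x hx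
  rw [hx]

theorem tendsto_eLpNorm_indicator_ball_sub {f : R3 → ℂ} (hf : MemLp f 2) :
    Filter.Tendsto (fun n : ℕ =>
      eLpNorm ((Metric.ball (0 : R3) n).indicator f - f) 2 volume) Filter.atTop (nhds 0) := by
  have h2 : ∫⁻ x, ‖f x‖ₑ ^ 2 ≠ ∞ := by
    rw [← eLpNorm_two_sq]
    exact ENNReal.pow_ne_top hf.2.ne
  have h : Filter.Tendsto (fun n : ℕ =>
      ∫⁻ x, ‖((Metric.ball (0 : R3) n).indicator f - f) x‖ₑ ^ 2) Filter.atTop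
        (nhds (∫⁻ _ : R3, 0)) := by
    refine tendsto_lintegral_of_dominated_convergence' (fun x => ‖f x‖ₑ ^ 2) (fun n => ?_)
      (fun n => ?_) h2 ?_
    · exact (((hf.1.indicator measurableSet_ball).sub hf.1).enorm.pow_const 2)
    · refine Filter.Eventually.of_forall fun x => pow_le_pow_left' ?_ 2
      by_cases hx : x ∈ Metric.ball (0 : R3) n
      · simp [Set.indicator_of_mem hx]
      · simp [Set.indicator_of_notMem hx]
    · refine Filter.Eventually.of_forall fun x => ?_
      refine tendsto_const_nhds.congr' ?_
      filter_upwards [Filter.eventually_gt_atTop ⌈‖x‖⌉₊] with n hn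
      have hx : x ∈ Metric.ball (0 : R3) n := by
        rw [mem_ball_zero_iff]
        exact (Nat.le_ceil _).trans_lt (by exact_mod_cast hn)
      simp [Set.indicator_of_mem hx]
  rw [lintegral_zero] at h
  have h3 := (ENNReal.continuous_rpow_const (y := (1 / 2 : ℝ))).continuousAt.tendsto.comp h
  rw [ENNReal.zero_rpow_of_pos (by norm_num)] at h3
  refine h3.congr fun n => ?_
  rw [Function.comp_apply, ← eLpNorm_two_sq, ← ENNReal.rpow_natCast, ← ENNReal.rpow_mul]
  norm_num

/-- The Fourier transform of a radial function is radial. -/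
theorem IsRadial.exists_fourier_ae_eq {f : Lp ℂ 2 (volume : Measure R3)} (hf : IsRadial f) :
    ∃ G : ℝ → ℂ, Measurable G ∧
      ∀ᵐ ξ : R3, (𝓕 f : Lp ℂ 2 (volume : Measure R3)) ξ = G ‖ξ‖ := by
  obtain ⟨F, hF⟩ := hf
  -- Truncations to balls are radial and lie in L¹ ∩ L², where the transform is an integral with
  -- exact rotation invariance. They converge to f in L², so along a subsequence their transforms
  -- converge almost everywhere.
  set u : ℕ → R3 → ℂ := fun n => (Metric.ball (0 : R3) n).indicator f with hu
  have hu2 : ∀ n, MemLp (u n) 2 := fun n => (Lp.memLp f).indicator measurableSet_ball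
  have hu1 : ∀ n, Integrable (u n) := fun n => by
    refine (integrable_indicator_iff measurableSet_ball).2 ?_
    have : IsFiniteMeasure ((volume : Measure R3).restrict (Metric.ball (0 : R3) n)) :=
      ⟨by rw [Measure.restrict_apply_univ]; exact measure_ball_lt_top⟩
    exact ((Lp.memLp f).restrict _).integrable one_le_two
  have hconv : Filter.Tendsto (fun n => (hu2 n).toLp (u n)) Filter.atTop (nhds f) := by
    rw [Lp.tendsto_Lp_iff_tendsto_eLpNorm']
    refine (tendsto_eLpNorm_indicator_ball_sub (Lp.memLp f)).congr fun n => ?_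
    refine eLpNorm_congr_ae ?_
    filter_upwards [(hu2 n).coeFn_toLp] with x hx
    rw [Pi.sub_apply, Pi.sub_apply, hx]
  have hconv2 : Filter.Tendsto (fun n => (𝓕 ((hu2 n).toLp (u n)) : Lp ℂ 2 (volume : Measure R3)))
      Filter.atTop (nhds (𝓕 f)) :=
    ((Lp.fourierTransformₗᵢ R3 ℂ).continuous.tendsto f).comp hconv
  obtain ⟨ns, -, hns⟩ := (tendstoInMeasure_of_tendsto_Lp hconv2).exists_seq_tendsto_ae
  have hae : ∀ᵐ ξ : R3, ∀ n, (𝓕 ((hu2 n).toLp (u n)) : Lp ℂ 2 (volume : Measure R3)) ξ =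
      𝓕 (u n) ξ := ae_all_iff.2 fun n => fourier_toLp_ae_eq (hu1 n) (hu2 n)
  have hrad : ∀ n ξ, 𝓕 (u n) ξ = 𝓕 (u n) (EuclideanSpace.single 0 ‖ξ‖) := fun n ξ => by
    refine fourier_radial ⟨fun ρ => if ρ < n then F ρ else 0, ?_⟩ ξ
    filter_upwards [hF] with x hx
    by_cases h : ‖x‖ < n
    · rw [if_pos h, ← hx]
      exact Set.indicator_of_mem (by simpa using h) _
    · rw [if_neg h]
      exact Set.indicator_of_notMem (by simpa using h) _
  have hsing : Continuous fun ρ : ℝ => (EuclideanSpace.single 0 ρ : R3) := by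
    have h : (fun ρ : ℝ => (EuclideanSpace.single 0 ρ : R3)) =
        fun ρ : ℝ => ρ • (EuclideanSpace.single 0 1 : R3) := by
      ext ρ j
      simp
    rw [h]
    exact continuous_id.smul continuous_const
  -- The profile F is not assumed measurable. Measurability of G comes from the continuity of the
  -- truncated transforms along a ray; where the limit fails to exist, G takes a default value,
  -- which matters only on a null set.
  refine ⟨fun ρ => Filter.limUnder Filter.atTop fun n => 𝓕 (u (ns n)) (EuclideanSpace.single 0 ρ),
    (StronglyMeasurable.limUnder fun n => ((continuous_fourier_of_integrable
      (hu1 (ns n))).comp hsing).stronglyMeasurable).measurable, ?_⟩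
  filter_upwards [hns, hae] with ξ h1 h2
  simp_rw [h2, fun n => hrad (ns n) ξ] at h1
  exact h1.limUnder_eq.symm

end RadialFourier

/-! ### Dyadic grouping of the lattice points -/

section DyadicBlocks

/-- The dyadic size of a lattice point. -/
noncomputable def dyadicLevel (k : Fin 3 → ℤ) : ℕ := Nat.log 2 (⌊‖latticePoint k‖⌋₊ + 1)

theorem two_pow_dyadicLevel_le (k : Fin 3 → ℤ) :
    (2 : ℝ) ^ dyadicLevel k ≤ ‖latticePoint k‖ + 1 := by
  have h : 2 ^ dyadicLevel k ≤ ⌊‖latticePoint k‖⌋₊ + 1 := Nat.pow_log_le_self 2 (Nat.succ_ne_zero _)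
  have h2 : (2 : ℝ) ^ dyadicLevel k ≤ (⌊‖latticePoint k‖⌋₊ : ℝ) + 1 := by exact_mod_cast h
  linarith [Nat.floor_le (norm_nonneg (latticePoint k))]

theorem norm_latticePoint_lt (k : Fin 3 → ℤ) : ‖latticePoint k‖ < 2 * 2 ^ dyadicLevel k := by
  have h : ⌊‖latticePoint k‖⌋₊ + 1 < 2 ^ (dyadicLevel k + 1) :=
    Nat.lt_pow_succ_log_self one_lt_two _
  have h2 : (⌊‖latticePoint k‖⌋₊ : ℝ) + 1 < 2 ^ (dyadicLevel k + 1) := by exact_mod_cast h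
  rw [pow_succ] at h2
  linarith [Nat.lt_floor_add_one ‖latticePoint k‖]

theorem finite_dyadicLevel_eq (j : ℕ) : {k | dyadicLevel k = j}.Finite := by
  refine (Set.Finite.pi' fun _ : Fin 3 =>
    Set.finite_Icc (-(2 * 2 ^ j : ℤ)) (2 * 2 ^ j)).subset fun k hk i => ?_
  have h := norm_latticePoint_lt k
  rw [show dyadicLevel k = j from hk] at h
  have h2 : |(k i : ℝ)| ≤ ‖latticePoint k‖ := by
    simpa [latticePoint] using PiLp.norm_apply_le (latticePoint k) i
  have h3 : |(k i : ℝ)| ≤ 2 * 2 ^ j := h2.trans h.le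
  rw [abs_le] at h3
  exact ⟨by exact_mod_cast h3.1, by exact_mod_cast h3.2⟩

/-- The lattice points of dyadic size `2 ^ j`. -/
noncomputable def dyadicBlock (j : ℕ) : Finset (Fin 3 → ℤ) := (finite_dyadicLevel_eq j).toFinset

theorem mem_dyadicBlock {j : ℕ} {k : Fin 3 → ℤ} : k ∈ dyadicBlock j ↔ dyadicLevel k = j := by
  simp [dyadicBlock]

/-- Radii `ρ` of the frequencies (in Mathlib's normalization) met by the `j`-th dyadic block. -/
def dyadicShell (j : ℕ) : Set ℝ :=
  {ρ | 2 * Real.pi * ρ ≤ 4 * 2 ^ j ∧ (2 ^ j) ^ 2 ≤ 16 * (1 + (2 * Real.pi * ρ) ^ 2)}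

theorem measurableSet_dyadicShell (j : ℕ) : MeasurableSet (dyadicShell j) := by
  refine MeasurableSet.inter (s₁ := {ρ : ℝ | 2 * Real.pi * ρ ≤ 4 * 2 ^ j})
    (s₂ := {ρ : ℝ | (2 ^ j) ^ 2 ≤ 16 * (1 + (2 * Real.pi * ρ) ^ 2)}) ?_ ?_
  · exact measurableSet_le (by fun_prop) (by fun_prop)
  · exact measurableSet_le (by fun_prop) (by fun_prop)

theorem norm_sub_latticePoint_le {k : Fin 3 → ℤ} {ξ : R3} (h : ξ ∈ freqCube k) :
    ‖(2 * Real.pi) • ξ - latticePoint k‖ ≤ 2 := by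
  have h1 : ∀ i, ((2 * Real.pi) * ξ i - k i) ^ 2 ≤ 1 := fun i => by
    have := h i
    rw [← sq_abs]
    exact pow_le_one₀ (abs_nonneg _) this
  rw [EuclideanSpace.norm_eq, Real.sqrt_le_left (by norm_num)]
  simp only [Fin.sum_univ_three, Real.norm_eq_abs, sq_abs, latticePoint, PiLp.sub_apply,
    PiLp.smul_apply, smul_eq_mul]
  linarith [h1 0, h1 1, h1 2]

/-- On the cube |2πξ - k| ≤ √3 ≤ 2, so |2πξ| < 2·2^j + 2 ≤ 4·2^j and 2^j ≤ |2πξ| + 3. The form 1 +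
|2πξ|² of the lower bound lets small j include low frequencies. -/
theorem norm_mem_dyadicShell {k : Fin 3 → ℤ} {ξ : R3} (h : ξ ∈ freqCube k) :
    ‖ξ‖ ∈ dyadicShell (dyadicLevel k) := by
  have h1 := norm_sub_latticePoint_le h
  have h2 := two_pow_dyadicLevel_le k
  have h3 := norm_latticePoint_lt k
  have hn : ‖(2 * Real.pi) • ξ‖ = 2 * Real.pi * ‖ξ‖ := by
    rw [norm_smul, Real.norm_of_nonneg (by positivity)]
  have h4 := norm_le_norm_add_norm_sub' ((2 * Real.pi) • ξ) (latticePoint k)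
  have h5 := norm_le_norm_add_norm_sub ((2 * Real.pi) • ξ) (latticePoint k)
  rw [hn] at h4 h5
  have hJ : (1 : ℝ) ≤ 2 ^ dyadicLevel k := one_le_pow₀ one_le_two
  set J : ℝ := 2 ^ dyadicLevel k with hJdef
  set z := 2 * Real.pi * ‖ξ‖ with hz
  have hz0 : 0 ≤ z := by positivity
  have h6 : ‖latticePoint k‖ ≤ z + 2 := by linarith
  refine ⟨by linarith, ?_⟩
  by_cases hJ4 : J ≤ 4
  · nlinarith
  · nlinarith

/-- The radial profile of `∇ I f` in the `j`-th dyadic shell, for `f` with radial Fourier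
transform `G`. -/
noncomputable def shellProfile (m : R3 → ℝ) (G : ℝ → ℂ) (j : ℕ) : ℝ → ℂ :=
  (dyadicShell j).indicator fun ρ =>
    2 * Real.pi * Complex.I * m ((2 * Real.pi) • EuclideanSpace.single 0 ρ) * G ρ

theorem norm_shellProfile_le {σ N : ℝ} {m : R3 → ℝ} (hm : IsISymbol σ N m) (G : ℝ → ℂ) (j : ℕ)
    (ρ : ℝ) : ‖shellProfile m G j ρ‖ ≤ 2 * Real.pi * ‖G ρ‖ := by
  have hpi := Real.pi_pos
  by_cases hρ : ρ ∈ dyadicShell j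
  · rw [shellProfile, Set.indicator_of_mem hρ]
    simp only [norm_mul, Complex.norm_real, Complex.norm_I, Complex.norm_ofNat, mul_one,
      Real.norm_of_nonneg hpi.le, Real.norm_of_nonneg (hm.nonneg _)]
    have := hm.le_one ((2 * Real.pi) • EuclideanSpace.single 0 ρ)
    refine mul_le_mul_of_nonneg_right ?_ (norm_nonneg _)
    exact mul_le_of_le_one_right (by positivity) this
  · rw [shellProfile, Set.indicator_of_notMem hρ, norm_zero]
    positivity

theorem measurable_shellProfile {σ N : ℝ} {m : R3 → ℝ} (hm : IsISymbol σ N m) {G : ℝ → ℂ}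
    (hG : Measurable G) (j : ℕ) : Measurable (shellProfile m G j) := by
  have hsing : Continuous fun ρ : ℝ => ((2 * Real.pi) • (EuclideanSpace.single 0 ρ : R3)) := by
    have h : (fun ρ : ℝ => (2 * Real.pi) • (EuclideanSpace.single 0 ρ : R3)) =
        fun ρ : ℝ => (2 * Real.pi) • ρ • (EuclideanSpace.single 0 1 : R3) := by
      ext ρ l
      simp
    rw [h]
    have h1 : Continuous fun ρ : ℝ => ρ • (EuclideanSpace.single 0 1 : R3) :=
      continuous_id.smul continuous_const
    exact h1.const_smul (2 * Real.pi)
  have h := (hm.smooth.continuous.comp hsing).measurable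
  exact ((measurable_const.mul (Complex.measurable_ofReal.comp h)).mul hG).indicator
    (measurableSet_dyadicShell j)

/-- The shell requires ρ ≤ (4/2π) 2^j, and 4 < 2π. -/
theorem shellProfile_eq_zero {m : R3 → ℝ} {G : ℝ → ℂ} {j : ℕ} {ρ : ℝ} (hρ : 2 ^ j < ρ) :
    shellProfile m G j ρ = 0 := by
  have hpi := Real.pi_gt_three
  refine Set.indicator_of_notMem (fun h : ρ ∈ dyadicShell j => ?_) _
  have h0 : (0 : ℝ) < 2 ^ j := by positivity
  have h1 := h.1
  nlinarith

theorem memLp_coord_mul_shellProfile {σ N : ℝ} {m : R3 → ℝ} (hm : IsISymbol σ N m) {G : ℝ → ℂ}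
    (hG : Measurable G) (hG2 : MemLp (fun ξ : R3 => G ‖ξ‖) 2) (j : ℕ) (l : Fin 3) :
    MemLp (fun ξ : R3 => (ξ l : ℂ) * shellProfile m G j ‖ξ‖) 2 := by
  have hmeas := measurable_shellProfile hm hG j
  refine (hG2.const_mul ((2 ^ j * (2 * Real.pi) : ℝ) : ℂ)).of_le ?_
    (Filter.Eventually.of_forall fun ξ => ?_)
  · exact ((Complex.measurable_ofReal.comp (by fun_prop)).mul
      (hmeas.comp measurable_norm)).aestronglyMeasurable
  · by_cases h : ‖ξ‖ ≤ 2 ^ j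
    · rw [norm_mul, norm_mul, Complex.norm_real, Complex.norm_real,
        Real.norm_of_nonneg (show (0 : ℝ) ≤ 2 ^ j * (2 * Real.pi) by positivity), mul_assoc]
      exact mul_le_mul ((PiLp.norm_apply_le ξ l).trans h) (norm_shellProfile_le hm G j _)
        (norm_nonneg _) (by positivity)
    · rw [shellProfile_eq_zero (not_le.1 h), mul_zero, norm_zero]
      positivity

theorem integrable_coord_mul_shellProfile {σ N : ℝ} {m : R3 → ℝ} (hm : IsISymbol σ N m)
    {G : ℝ → ℂ} (hG : Measurable G) (hG2 : MemLp (fun ξ : R3 => G ‖ξ‖) 2) (j : ℕ) (l : Fin 3) :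
    Integrable fun ξ : R3 => (ξ l : ℂ) * shellProfile m G j ‖ξ‖ := by
  have h2 := memLp_coord_mul_shellProfile hm hG hG2 j l
  have hfin : IsFiniteMeasure ((volume : Measure R3).restrict
      (Metric.closedBall (0 : R3) (2 ^ j))) :=
    ⟨by rw [Measure.restrict_apply_univ]; exact measure_closedBall_lt_top⟩
  have h3 := (h2.restrict (Metric.closedBall (0 : R3) (2 ^ j))).integrable one_le_two
  refine (integrableOn_iff_integrable_of_support_subset fun ξ hξ => ?_).1 h3
  rw [mem_closedBall_zero_iff]
  by_contra h
  exact hξ (by simp only [shellProfile_eq_zero (not_le.1 h), mul_zero])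

/-- Restricting to the shell is invisible after multiplication by ψ(· - k), yet it is a radial
cutoff. Data truncated this way stay radial up to the factor ξ_i, so the square function estimate
can be applied shell by shell. -/
theorem wiener_mul_gradIData_ae_eq {ψ : R3 → ℝ} (hψ : IsWienerProfile ψ) {σ N : ℝ} {m : R3 → ℝ}
    (hm : IsISymbol σ N m) {f : Lp ℂ 2 (volume : Measure R3)} {G : ℝ → ℂ}
    (hG : ∀ᵐ ξ : R3, (𝓕 f : Lp ℂ 2 (volume : Measure R3)) ξ = G ‖ξ‖) {j : ℕ} {k : Fin 3 → ℤ}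
    (hk : dyadicLevel k = j) (i : Fin 3) :
    (fun ξ => (ψ ((2 * Real.pi) • ξ - latticePoint k) : ℂ) * gradIData m f i ξ) =ᵐ[volume]
      fun ξ => (ψ ((2 * Real.pi) • ξ - latticePoint k) : ℂ) *
        ((ξ i : ℂ) * shellProfile m G j ‖ξ‖) := by
  filter_upwards [hG] with ξ hξ
  by_cases h : ψ ((2 * Real.pi) • ξ - latticePoint k) = 0
  · simp [h]
  · have hmem : ‖ξ‖ ∈ dyadicShell j := hk ▸ norm_mem_dyadicShell (hψ.mem_freqCube h)
    have hmr : m ((2 * Real.pi) • ξ) = m ((2 * Real.pi) • EuclideanSpace.single 0 ‖ξ‖) :=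
      hm.radial _ _ (by simp [norm_smul])
    rw [gradIData, shellProfile, Set.indicator_of_mem hmem, hξ, hmr]

end DyadicBlocks

/-! ### Trading derivatives for powers of N -/

section SymbolBound

/-- For |η| ≤ 2N the bracket is at most 3N and m ≤ 1. Beyond, β ≤ 1 - σ gives m² ≤ (N/|η|)^{2β},
which cancels the growth of the bracket. The numerical factors stay below 3 because 2β ≤ 1. -/
theorem IsISymbol.bracket_rpow_mul_sq_le {σ N β : ℝ} (hβ : 0 ≤ β) (hβσ : β ≤ 1 - σ)
    (hβ1 : 2 * β ≤ 1) (hN : 1 ≤ N) {m : R3 → ℝ} (hm : IsISymbol σ N m) (η : R3) :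
    √(1 + ‖η‖ ^ 2) ^ (2 * β) * m η ^ 2 ≤ 3 * N ^ (2 * β) := by
  have hN0 : 0 < N := by linarith
  have hz := norm_nonneg η
  have hJ0 : 0 ≤ √(1 + ‖η‖ ^ 2) := Real.sqrt_nonneg _
  have key : ∀ {c : ℝ}, 1 ≤ c → c ≤ 3 → c ^ (2 * β) ≤ 3 := fun {c} h1 h3 => by
    calc c ^ (2 * β) ≤ c ^ (1 : ℝ) := Real.rpow_le_rpow_of_exponent_le h1 hβ1
      _ ≤ 3 := by rwa [Real.rpow_one]
  by_cases h : ‖η‖ ≤ 2 * N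
  · have hJ : √(1 + ‖η‖ ^ 2) ≤ 3 * N := Real.sqrt_le_iff.2 ⟨by positivity, by nlinarith⟩
    calc √(1 + ‖η‖ ^ 2) ^ (2 * β) * m η ^ 2 ≤ (3 * N) ^ (2 * β) * 1 :=
          mul_le_mul (Real.rpow_le_rpow hJ0 hJ (by positivity))
            (pow_le_one₀ (hm.nonneg η) (hm.le_one η)) (by positivity) (by positivity)
      _ = 3 ^ (2 * β) * N ^ (2 * β) := by rw [mul_one, Real.mul_rpow (by norm_num) hN0.le]
      _ ≤ _ := mul_le_mul_of_nonneg_right (key (by norm_num) le_rfl) (by positivity)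
  · have hz2 : 2 * N ≤ ‖η‖ := (not_le.1 h).le
    have hzp : 0 < ‖η‖ := by linarith
    have hJ : √(1 + ‖η‖ ^ 2) ≤ 2 * ‖η‖ := Real.sqrt_le_iff.2 ⟨by positivity, by nlinarith⟩
    have hq0 : 0 < N / ‖η‖ := by positivity
    have hq1 : N / ‖η‖ ≤ 1 := (div_le_one hzp).2 (by linarith)
    have hm2 : m η ^ 2 ≤ (N / ‖η‖) ^ (2 * β) := by
      rw [hm.high η hz2, ← Real.rpow_natCast, ← Real.rpow_mul hq0.le]
      exact Real.rpow_le_rpow_of_exponent_ge hq0 hq1 (by push_cast; linarith)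
    calc √(1 + ‖η‖ ^ 2) ^ (2 * β) * m η ^ 2 ≤ (2 * ‖η‖) ^ (2 * β) * (N / ‖η‖) ^ (2 * β) :=
          mul_le_mul (Real.rpow_le_rpow hJ0 hJ (by positivity)) hm2 (by positivity) (by positivity)
      _ = 2 ^ (2 * β) * N ^ (2 * β) := by
          rw [← Real.mul_rpow (by positivity) (by positivity),
            ← Real.mul_rpow (by norm_num) hN0.le]
          congr 1
          field_simp
      _ ≤ _ := mul_le_mul_of_nonneg_right (key (by norm_num) (by norm_num)) (by positivity)

/-- With J = ⟨η⟩ and η = 2πξ, the relation 1 - 2s + 4ε = 2β splits one derivative as J = J^{2s}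
J^{2β} J^{-4ε}. The first factor goes to the Sobolev norm, the second is paid by m² with N^{2β}, and
J ≥ 2^j/4 on the shell makes the third at most 4^{4ε} 2^{-4εj}. -/
theorem norm_mul_shellProfile_sq_le {σ N β ε s : ℝ} (hβ : 0 ≤ β) (hβσ : β ≤ 1 - σ)
    (hβ1 : 2 * β ≤ 1) (hε : 0 ≤ ε) (hs : 1 - 2 * s + 4 * ε = 2 * β) (hN : 1 ≤ N) {m : R3 → ℝ}
    (hm : IsISymbol σ N m) (G : ℝ → ℂ) (j : ℕ) (ξ : R3) :
    ‖ξ‖ * ‖shellProfile m G j ‖ξ‖‖ ^ 2 ≤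
      6 * Real.pi * 4 ^ (4 * ε) * (N ^ β * (2 : ℝ) ^ (-(2 * ε * j))) ^ 2 *
        (((1 + ‖(2 * Real.pi) • ξ‖ ^ 2) ^ (s / 2)) ^ 2 * ‖G ‖ξ‖‖ ^ 2) := by
  have hpi := Real.pi_pos
  by_cases h : ‖ξ‖ ∈ dyadicShell j
  swap
  · rw [shellProfile, Set.indicator_of_notMem h, norm_zero]
    norm_num
    positivity
  set η := (2 * Real.pi) • ξ with hη
  have hmr : m ((2 * Real.pi) • EuclideanSpace.single 0 ‖ξ‖) = m η :=
    hm.radial _ _ (by simp [hη, norm_smul])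
  have hn : ‖η‖ = 2 * Real.pi * ‖ξ‖ := by
    rw [hη, norm_smul, Real.norm_of_nonneg (by positivity)]
  have hsh : ‖shellProfile m G j ‖ξ‖‖ = 2 * Real.pi * m η * ‖G ‖ξ‖‖ := by
    rw [shellProfile, Set.indicator_of_mem h, hmr]
    simp only [norm_mul, Complex.norm_real, Complex.norm_I, Complex.norm_ofNat, mul_one,
      Real.norm_of_nonneg hpi.le, Real.norm_of_nonneg (hm.nonneg _)]
  set J := √(1 + ‖η‖ ^ 2) with hJ
  have hJsq : J ^ 2 = 1 + ‖η‖ ^ 2 := Real.sq_sqrt (by positivity)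
  have hJ1 : 1 ≤ J := Real.one_le_sqrt.2 (by nlinarith [sq_nonneg ‖η‖])
  have hJ0 : 0 < J := by linarith
  have hzJ : ‖η‖ ≤ J := Real.le_sqrt_of_sq_le (by linarith)
  have h2j : (2 : ℝ) ^ (j : ℝ) ≤ 4 * J := by
    have := h.2
    rw [← hn, ← hJsq] at this
    rw [Real.rpow_natCast]
    exact le_of_sq_le_sq (by linarith [mul_pow 4 J 2]) (by positivity)
  have hJs : ((1 + ‖η‖ ^ 2) ^ (s / 2)) ^ 2 = J ^ (2 * s) := by
    rw [← hJsq, ← Real.rpow_natCast, ← Real.rpow_natCast, ← Real.rpow_mul hJ0.le,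
      ← Real.rpow_mul hJ0.le]
    congr 1
    push_cast
    ring
  have hsym := hm.bracket_rpow_mul_sq_le hβ hβσ hβ1 hN η
  have hNb : (N ^ β) ^ 2 = N ^ (2 * β) := by
    rw [← Real.rpow_natCast, ← Real.rpow_mul (by linarith)]
    congr 1
    push_cast
    ring
  have htwo : ((2 : ℝ) ^ (-(2 * ε * j))) ^ 2 * ((2 : ℝ) ^ (j : ℝ)) ^ (4 * ε) = 1 := by
    rw [← Real.rpow_natCast, ← Real.rpow_mul (by norm_num), ← Real.rpow_mul (by norm_num),
      ← Real.rpow_add (by norm_num)]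
    convert Real.rpow_zero 2 using 2
    push_cast
    ring
  set T := ((2 : ℝ) ^ (-(2 * ε * j))) ^ 2 with hT
  have hTJ : 1 ≤ T * (4 ^ (4 * ε) * J ^ (4 * ε)) := by
    rw [← htwo, ← Real.mul_rpow (by norm_num) hJ0.le]
    exact mul_le_mul_of_nonneg_left (Real.rpow_le_rpow (by positivity) h2j (by positivity))
      (by positivity)
  have hJJ : J * J ^ (4 * ε) = J ^ (2 * β) * J ^ (2 * s) := by
    nth_rewrite 1 [← Real.rpow_one J]
    rw [← Real.rpow_add hJ0, ← Real.rpow_add hJ0]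
    congr 1
    linarith
  rw [hsh, hJs, mul_pow (N ^ β), hNb, ← hT]
  have hg : 0 ≤ ‖G ‖ξ‖‖ ^ 2 := by positivity
  calc ‖ξ‖ * (2 * Real.pi * m η * ‖G ‖ξ‖‖) ^ 2
      = 2 * Real.pi * (‖η‖ * m η ^ 2 * ‖G ‖ξ‖‖ ^ 2) := by rw [hn]; ring
    _ ≤ 2 * Real.pi * ((J * m η ^ 2 * ‖G ‖ξ‖‖ ^ 2) * (T * (4 ^ (4 * ε) * J ^ (4 * ε)))) := by
        refine mul_le_mul_of_nonneg_left ?_ (by positivity)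
        refine le_trans ?_ (le_mul_of_one_le_right (by positivity) hTJ)
        gcongr
    _ = 2 * Real.pi * 4 ^ (4 * ε) * T * (J ^ (2 * β) * m η ^ 2) * (J ^ (2 * s) * ‖G ‖ξ‖‖ ^ 2) := by
        linear_combination (2 * Real.pi * m η ^ 2 * ‖G ‖ξ‖‖ ^ 2 * T * 4 ^ (4 * ε)) * hJJ
    _ ≤ 2 * Real.pi * 4 ^ (4 * ε) * T * (3 * N ^ (2 * β)) * (J ^ (2 * s) * ‖G ‖ξ‖‖ ^ 2) := by
        gcongr
    _ = _ := by ring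

theorem lintegral_shellProfile_le {σ β ε s : ℝ} (hβ : 0 ≤ β) (hβσ : β ≤ 1 - σ)
    (hβ1 : 2 * β ≤ 1) (hε : 0 ≤ ε) (hs : 1 - 2 * s + 4 * ε = 2 * β) {N : ℝ} (hN : 1 ≤ N)
    {m : R3 → ℝ} (hm : IsISymbol σ N m) {f : Lp ℂ 2 (volume : Measure R3)} {G : ℝ → ℂ}
    (hG : ∀ᵐ ξ : R3, (𝓕 f : Lp ℂ 2 (volume : Measure R3)) ξ = G ‖ξ‖) (j : ℕ) :
    ∫⁻ ξ : R3, ENNReal.ofReal ‖ξ‖ * ‖shellProfile m G j ‖ξ‖‖ₑ ^ 2 ≤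
      ENNReal.ofReal (6 * Real.pi * 4 ^ (4 * ε)) *
        (ENNReal.ofReal (N ^ β * (2 : ℝ) ^ (-(2 * ε * j))) * hsNorm s f) ^ 2 := by
  have hN0 : 0 < N := by linarith
  rw [mul_pow, hsNorm, eLpNorm_two_sq, ← mul_assoc,
    ← lintegral_const_mul' _ _ (by finiteness)]
  refine lintegral_mono_ae ?_
  filter_upwards [hG] with ξ hξ
  rw [hξ, enorm_mul, ← ofReal_norm, ← ofReal_norm, ← ofReal_norm, Complex.norm_real,
    Real.norm_of_nonneg (by positivity), ← ENNReal.ofReal_pow (by positivity),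
    ← ENNReal.ofReal_mul (by positivity), ← ENNReal.ofReal_mul (by positivity),
    ← ENNReal.ofReal_pow (by positivity), ← ENNReal.ofReal_pow (by positivity),
    ← ENNReal.ofReal_mul (by positivity), ← ENNReal.ofReal_mul (by positivity)]
  refine ENNReal.ofReal_le_ofReal ?_
  rw [mul_pow ((1 + ‖(2 * Real.pi) • ξ‖ ^ 2) ^ (s / 2))]
  exact norm_mul_shellProfile_sq_le hβ hβσ hβ1 hε hs hN hm G j ξ

end SymbolBound

/-! ### Gaussian moments of mixed norms -/

section RandomMoments

variable {Ω : Type*} [MeasurableSpace Ω] {P : Measure Ω}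

/-- Minkowski's integral inequality with counting measure in the inner variable. -/
theorem lintegral_rpow_tsum_le [SFinite P] {ι : Type*} [Countable ι] {X : ι → Ω → ℝ≥0∞}
    (hX : ∀ b, Measurable (X b)) {n : ℝ} (hn : 1 ≤ n) :
    (∫⁻ ω, (∑' b, X b ω) ^ n ∂P) ^ (1 / n) ≤ ∑' b, (∫⁻ ω, X b ω ^ n ∂P) ^ (1 / n) := by
  let _ : MeasurableSpace ι := ⊤
  have h := lintegral_rpow_lintegral_le (μ := P) (ν := (Measure.count : Measure ι))
    (f := fun ω b => X b ω) (measurable_from_prod_countable_left fun b => hX b) hn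
  simpa only [lintegral_count] using h

theorem measurable_random_sum {g : (Fin 3 → ℤ) → Ω → ℂ} (hg : ∀ k, Measurable (g k))
    {F : (Fin 3 → ℤ) → ℝ → R3 → ℂ} (hF : ∀ k, Measurable (Function.uncurry (F k)))
    (K : Finset (Fin 3 → ℤ)) :
    Measurable fun z : (Ω × ℝ) × R3 => ∑ k ∈ K, g k z.1.1 * F k z.1.2 z.2 :=
  Finset.measurable_sum _ fun k _ => ((hg k).comp (measurable_fst.comp
    measurable_fst)).mul ((hF k).comp ((measurable_snd.comp measurable_fst).prodMk
      measurable_snd))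

theorem measurable_lintegral_random_sum {g : (Fin 3 → ℤ) → Ω → ℂ} (hg : ∀ k, Measurable (g k))
    {F : (Fin 3 → ℤ) → ℝ → R3 → ℂ} (hF : ∀ k, Measurable (Function.uncurry (F k)))
    (K : Finset (Fin 3 → ℤ)) (p : ℝ) :
    Measurable (Function.uncurry fun (ω : Ω) (t : ℝ) =>
      (∫⁻ x, ‖∑ k ∈ K, g k ω * F k t x‖ₑ ^ p) ^ (2 / p)) :=
  (((measurable_random_sum hg hF K).enorm.pow_const p).lintegral_prod_right').pow_const _

/-- Gaussian moments of the `L²_t L^p_x` norm of a random sum, by Minkowski's inequality. -/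
theorem IsGaussianFamily.lintegral_mixed_sum_le [IsProbabilityMeasure P] {κ : ℝ}
    {g : (Fin 3 → ℤ) → Ω → ℂ} (hg : IsGaussianFamily P κ g) {F : (Fin 3 → ℤ) → ℝ → R3 → ℂ}
    (hF : ∀ k, Measurable (Function.uncurry (F k))) (K : Finset (Fin 3 → ℤ)) {p : ℝ} (hp : 0 < p)
    {n : ℕ} (hn : 2 ≤ n) (hpn : p ≤ n) :
    (∫⁻ ω, ((∫⁻ t, (∫⁻ x, ‖∑ k ∈ K, g k ω * F k t x‖ₑ ^ p) ^ (2 / p)) ^ (1 / 2 : ℝ)) ^ (n : ℝ)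
      ∂P) ^ (1 / (n : ℝ)) ≤ ENNReal.ofReal (8 * √(n * κ)) *
        (∫⁻ t, (∫⁻ x, (∑ k ∈ K, ‖F k t x‖ₑ ^ 2) ^ (p / 2)) ^ (2 / p)) ^ (1 / 2 : ℝ) := by
  have hn2 : (2 : ℝ) ≤ n := by exact_mod_cast hn
  have hn0 : (0 : ℝ) < n := by linarith
  set M := ENNReal.ofReal (8 * √(n * κ)) with hM
  have hMt : M ≠ ∞ := ENNReal.ofReal_ne_top
  have hmeas := measurable_random_sum hg.measurable hF K
  have hY := measurable_lintegral_random_sum hg.measurable hF K p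
  -- The moment is moved inside the time integral at the level of squared norms, with exponent n/2;
  -- this needs n ≥ 2.
  have hstep1 := lintegral_rpow_lintegral_le (μ := P) (ν := (volume : Measure ℝ)) hY
    (p := (n : ℝ) / 2) (by linarith)
  have hexp : ∀ z : ℝ≥0∞, (z ^ (1 / 2 : ℝ)) ^ (n : ℝ) = z ^ ((n : ℝ) / 2) := fun z => by
    rw [← ENNReal.rpow_mul]
    congr 1
    ring
  have hinner : ∀ t, (∫⁻ ω, ((∫⁻ x, ‖∑ k ∈ K, g k ω * F k t x‖ₑ ^ p) ^ (2 / p)) ^ ((n : ℝ) / 2)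
      ∂P) ^ (1 / ((n : ℝ) / 2)) ≤
        M ^ (2 : ℝ) * (∫⁻ x, (∑ k ∈ K, ‖F k t x‖ₑ ^ 2) ^ (p / 2)) ^ (2 / p) := by
    intro t
    have hmt : Measurable (Function.uncurry fun (ω : Ω) (x : R3) =>
        ‖∑ k ∈ K, g k ω * F k t x‖ₑ ^ p) :=
      ((hmeas.comp ((measurable_fst.prodMk measurable_const).prodMk
        measurable_snd)).enorm.pow_const p)
    -- The same exchange with the space integral, with exponent n/p, needs n ≥ p. At a fixed point
    -- (t, x) what remains is a scalar Gaussian sum.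
    have h := lintegral_rpow_lintegral_le (μ := P) (ν := (volume : Measure R3)) hmt
      (p := (n : ℝ) / p) ((one_le_div hp).2 hpn)
    have hx : ∀ x, (∫⁻ ω, (‖∑ k ∈ K, g k ω * F k t x‖ₑ ^ p) ^ ((n : ℝ) / p) ∂P) ^
        (1 / ((n : ℝ) / p)) ≤ M ^ p * (∑ k ∈ K, ‖F k t x‖ₑ ^ 2) ^ (p / 2) := fun x => by
      have hgk := hg.lintegral_enorm_sum_le (K := K) (c := fun k => F k t x) (n := n) (by lia)
      have e1 : ∀ ω, (‖∑ k ∈ K, g k ω * F k t x‖ₑ ^ p) ^ ((n : ℝ) / p) =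
          ‖∑ k ∈ K, g k ω * F k t x‖ₑ ^ (n : ℝ) := fun ω => by
        rw [← ENNReal.rpow_mul]
        congr 1
        field_simp
      simp_rw [e1]
      have e2 : (1 / ((n : ℝ) / p)) = 1 / (n : ℝ) * p := by field_simp
      rw [e2, ENNReal.rpow_mul]
      refine (ENNReal.rpow_le_rpow hgk hp.le).trans (le_of_eq ?_)
      rw [ENNReal.mul_rpow_of_nonneg _ _ hp.le]
      congr 1
      rw [Real.sqrt_eq_rpow, ← ENNReal.ofReal_rpow_of_nonneg (by positivity) (by norm_num),
        ← ENNReal.rpow_mul, ENNReal.ofReal_sum_of_nonneg (fun k _ => by positivity)]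
      congr 1
      · refine Finset.sum_congr rfl fun k _ => ?_
        rw [ENNReal.ofReal_pow (norm_nonneg _), ofReal_norm]
      · ring
    have e3 : ∀ ω, ((∫⁻ x, ‖∑ k ∈ K, g k ω * F k t x‖ₑ ^ p) ^ (2 / p)) ^ ((n : ℝ) / 2) =
        (∫⁻ x, ‖∑ k ∈ K, g k ω * F k t x‖ₑ ^ p) ^ ((n : ℝ) / p) := fun ω => by
      rw [← ENNReal.rpow_mul]
      congr 1
      field_simp
    have e4 : (1 / ((n : ℝ) / 2)) = 1 / ((n : ℝ) / p) * (2 / p) := by field_simp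
    simp_rw [e3]
    rw [e4, ENNReal.rpow_mul]
    refine (ENNReal.rpow_le_rpow (h.trans (lintegral_mono hx)) (by positivity)).trans
      (le_of_eq ?_)
    rw [lintegral_const_mul' _ _ (ENNReal.rpow_ne_top_of_nonneg hp.le hMt),
      ENNReal.mul_rpow_of_nonneg _ _ (by positivity), ← ENNReal.rpow_mul]
    congr 2
    field_simp
  simp_rw [hexp]
  have e5 : (1 / (n : ℝ)) = 1 / ((n : ℝ) / 2) * (1 / 2) := by field_simp
  rw [e5, ENNReal.rpow_mul]
  refine (ENNReal.rpow_le_rpow (hstep1.trans (lintegral_mono hinner)) (by norm_num)).trans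
    (le_of_eq ?_)
  rw [lintegral_const_mul' _ _ (ENNReal.rpow_ne_top_of_nonneg (by norm_num) hMt),
    ENNReal.mul_rpow_of_nonneg _ _ (by norm_num), ← ENNReal.rpow_mul]
  norm_num

end RandomMoments

/-! ### Reduction to a finite spatial exponent -/

section FrequencyLocalized

/-- For frequencies of size at most `2 ^ j`, the `L^r` norm is controlled by an `L^p` norm with
finite `p > 4`, up to a loss of an arbitrarily small power of `2 ^ j`. -/
theorem exists_eLpNorm_fourierInv_le {r : ℝ≥0∞} (hr : 4 < r) {ε : ℝ} (hε : 0 < ε) :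
    ∃ p : ℝ, 4 < p ∧ ∃ C : ℝ≥0∞, C ≠ ∞ ∧ ∀ (j : ℕ) (A : R3 → ℂ), Integrable A →
      (∀ ξ, A ξ ≠ 0 → ‖ξ‖ ≤ 2 ^ j) →
        eLpNorm (𝓕⁻ A) r volume ≤
          C * ENNReal.ofReal ((2 : ℝ) ^ (ε * j)) * (∫⁻ y, ‖𝓕⁻ A y‖ₑ ^ p) ^ (1 / p) := by
  by_cases hrt : r = ∞
  -- The exponent 5 is an arbitrary choice above 4, and p ≥ 3/ε makes the Bernstein loss 2^{3j/p} at
  -- most 2^{εj}. For finite r, p = r works with no loss.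
  · obtain ⟨C, hC, h⟩ := exists_enorm_fourierInv_le_of_support (p := max 5 (3 / ε))
      (lt_of_lt_of_le (by norm_num) (le_max_left _ _))
    refine ⟨max 5 (3 / ε), lt_of_lt_of_le (by norm_num) (le_max_left _ _), C, hC,
      fun j A hA hs => ?_⟩
    have hp0 : 0 < max 5 (3 / ε) := lt_of_lt_of_le (by norm_num) (le_max_left _ _)
    have hp : 3 / max 5 (3 / ε) ≤ ε := by
      rw [div_le_iff₀ hp0, mul_comm, ← div_le_iff₀ hε]
      exact le_max_right _ _
    rw [hrt, eLpNorm_exponent_top]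
    refine eLpNormEssSup_le_of_ae_enorm_bound (Filter.Eventually.of_forall fun x => ?_)
    refine (h (2 ^ j) (by positivity) A hA hs x).trans ?_
    gcongr
    rw [← Real.rpow_natCast, ← Real.rpow_mul (by norm_num)]
    refine Real.rpow_le_rpow_of_exponent_le one_le_two ?_
    rw [mul_comm]
    gcongr
  · refine ⟨r.toReal, ?_, 1, ENNReal.one_ne_top, fun j A _ _ => ?_⟩
    · have := (ENNReal.toReal_lt_toReal (by norm_num) hrt).2 hr
      simpa using this
    · rw [eLpNorm_eq_lintegral_rpow_enorm_toReal (by intro h; simp [h] at hr) hrt, one_mul]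
      refine le_mul_of_one_le_left zero_le ?_
      rw [← ENNReal.ofReal_one]
      exact ENNReal.ofReal_le_ofReal (Real.one_le_rpow one_le_two (by positivity))

end FrequencyLocalized

/-! ### Norms of distributions given by series of functions -/

section DistributionNorm

theorem hasSum_eval {ι : Type*} {u : ι → 𝓢'(R3, ℂ)} {T : 𝓢'(R3, ℂ)} (h : HasSum u T)
    (φ : 𝓢(R3, ℂ)) : HasSum (fun b => u b φ) (T φ) :=
  h.mapL (PointwiseConvergenceCLM.evalCLM (RingHom.id ℂ) ℂ φ)

theorem Lp_hasSum_integral {r : ℝ≥0∞} [Fact (1 ≤ r)] {u : ℕ → Lp ℂ r (volume : Measure R3)}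
    (hu : Summable u) (φ : 𝓢(R3, ℂ)) :
    HasSum (fun j => ∫ x, φ x * u j x)
      (∫ x, φ x * (∑' j, u j : Lp ℂ r (volume : Measure R3)) x) := by
  have h := hasSum_eval (hu.hasSum.mapL (Lp.toTemperedDistributionCLM ℂ volume r)) φ
  simpa only [Lp.toTemperedDistributionCLM_apply, Lp.toTemperedDistribution_apply,
    smul_eq_mul] using h

theorem eLpNorm_toLp_le_sum {r : ℝ≥0∞} (hr : 1 ≤ r) {v : Fin 3 → R3 → ℂ}
    (hv : ∀ i, AEStronglyMeasurable (v i) volume) :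
    eLpNorm (fun x => (WithLp.toLp 2 fun i => v i x : EuclideanSpace ℂ (Fin 3))) r volume ≤
      ∑ i, eLpNorm (v i) r volume := by
  have h1 : eLpNorm (fun x => (WithLp.toLp 2 fun i => v i x : EuclideanSpace ℂ (Fin 3))) r volume ≤
      eLpNorm (∑ i, fun x => ‖v i x‖) r volume := by
    refine eLpNorm_mono_real fun x => ?_
    rw [EuclideanSpace.norm_eq, Finset.sum_apply]
    refine Real.sqrt_le_iff.2 ⟨by positivity, ?_⟩
    exact Finset.sum_sq_le_sq_sum_of_nonneg fun i _ => norm_nonneg _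
  refine h1.trans ((eLpNorm_sum_le (fun i _ => (hv i).norm) hr).trans (le_of_eq ?_))
  simp_rw [eLpNorm_norm]

/-- If a triple of distributions is the sum of a series of functions, then its `L^r` norm is at
most the sum of the `L^r` norms. -/
theorem distLpNorm_le_tsum {r : ℝ≥0∞} (hr : 1 ≤ r) {T : Fin 3 → 𝓢'(R3, ℂ)}
    {h : ℕ → Fin 3 → R3 → ℂ} (hm : ∀ j i, AEStronglyMeasurable (h j i) volume)
    (hT : ∀ i (φ : 𝓢(R3, ℂ)), HasSum (fun j => ∫ x, φ x * h j i x) (T i φ)) :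
    distLpNorm r T ≤ ∑' b : ℕ × Fin 3, eLpNorm (h b.1 b.2) r volume := by
  have : Fact (1 ≤ r) := ⟨hr⟩
  have hprod : ∑' b : ℕ × Fin 3, eLpNorm (h b.1 b.2) r volume =
      ∑ i, ∑' j, eLpNorm (h j i) r volume := by
    rw [ENNReal.tsum_prod (f := fun j i => eLpNorm (h j i) r volume), ENNReal.tsum_comm,
      tsum_fintype]
  rw [hprod]
  -- If the sum of norms is finite, the series converges absolutely in L^r; its limit represents the
  -- distribution, by uniqueness of limits after pairing with test functions.
  by_cases hfin : ∑ i, ∑' j, eLpNorm (h j i) r volume = ∞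
  · rw [hfin]; exact le_top
  have hfi : ∀ i, ∑' j, eLpNorm (h j i) r volume ≠ ∞ := fun i =>
    (ENNReal.sum_ne_top.1 hfin) i (Finset.mem_univ i)
  have hmem : ∀ j i, MemLp (h j i) r volume := fun j i =>
    ⟨hm j i, (ENNReal.ne_top_of_tsum_ne_top (hfi i) j).lt_top⟩
  set u : Fin 3 → ℕ → Lp ℂ r (volume : Measure R3) := fun i j => (hmem j i).toLp (h j i) with hu
  have hun : ∀ i j, ‖u i j‖ₑ = eLpNorm (h j i) r volume := fun i j => Lp.enorm_toLp _
  have hsum : ∀ i, Summable (u i) := fun i => by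
    refine Summable.of_norm ?_
    have := ENNReal.summable_toReal (hfi i)
    simpa only [← hun, toReal_enorm] using this
  set v : Fin 3 → Lp ℂ r (volume : Measure R3) := fun i => ∑' j, u i j with hv
  have hvn : ∀ i, eLpNorm (v i) r volume ≤ ∑' j, eLpNorm (h j i) r volume := fun i => by
    rw [← Lp.enorm_def, ← tsum_congr (hun i)]
    exact enorm_tsum_le_tsum_enorm
  have hle := (eLpNorm_toLp_le_sum hr fun i => Lp.aestronglyMeasurable (v i)).trans
    (Finset.sum_le_sum fun i _ => hvn i)
  refine (iInf₂_le (fun x => WithLp.toLp 2 fun i => v i x) ⟨⟨?_, ?_⟩, fun i φ => ?_⟩).trans hle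
  · have hpi : AEMeasurable (fun x => fun i => v i x) (volume : Measure R3) :=
      aemeasurable_pi_lambda _ fun i => (Lp.aestronglyMeasurable (v i)).aemeasurable
    exact ((PiLp.continuous_toLp 2 fun _ : Fin 3 => ℂ).measurable.comp_aemeasurable
      hpi).aestronglyMeasurable
  · exact hle.trans_lt (lt_top_iff_ne_top.2 hfin)
  · refine (hT i φ).unique ?_
    refine HasSum.congr_fun (Lp_hasSum_integral (hsum i) φ) fun j => integral_congr_ae ?_
    filter_upwards [(hmem j i).coeFn_toLp] with x hx
    rw [hx]

/-- Minkowski's inequality in time is applied to the measurable majorants. Measurability of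
`distLpNorm` in t is not needed, since lower integrals are monotone for arbitrary functions. -/
theorem mixedNorm_le_tsum {r : ℝ≥0∞} {T : ℝ → Fin 3 → 𝓢'(R3, ℂ)} {ι : Type*} [Countable ι]
    {Z : ι → ℝ → ℝ≥0∞} (hZ : ∀ b, Measurable (Z b)) (h : ∀ t, distLpNorm r (T t) ≤ ∑' b, Z b t) :
    mixedNorm r T ≤ ∑' b, (∫⁻ t, Z b t ^ 2) ^ (1 / 2 : ℝ) := by
  have h1 := lintegral_rpow_tsum_le (P := (volume : Measure ℝ)) hZ one_le_two
  simp only [ENNReal.rpow_two] at h1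
  exact (ENNReal.rpow_le_rpow (lintegral_mono fun t => pow_le_pow_left' (h t) 2)
    (by norm_num)).trans h1

end DistributionNorm

/-! ### Passing the operators through the randomized series -/

section RandomizedSeries

theorem freeEvolution_congr_ae {A B : R3 → ℂ} (h : A =ᵐ[volume] B) (t : ℝ) (x : R3) :
    freeEvolution A t x = freeEvolution B t x := by
  simp only [freeEvolution, Real.fourierInv_eq']
  refine integral_congr_ae ?_
  filter_upwards [h] with ξ hξ
  rw [hξ]

theorem hasSum_dyadicBlock {u : (Fin 3 → ℤ) → ℂ} {a : ℂ} (h : HasSum u a) :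
    HasSum (fun j => ∑ k ∈ dyadicBlock j, u k) a := by
  have h1 := (Equiv.sigmaFiberEquiv dyadicLevel).hasSum_iff.2 h
  refine h1.sigma fun j => ?_
  have h2 : Fintype {k // dyadicLevel k = j} := (finite_dyadicLevel_eq j).fintype
  have h3 := hasSum_fintype fun k : {k // dyadicLevel k = j} => u k
  rw [← Finset.sum_subtype (dyadicBlock j) (fun k => mem_dyadicBlock) u] at h3
  exact h3

/-- All the operators are continuous and linear on tempered distributions, and so is evaluation at a
test function; hence convergence of the series passes through them. -/
theorem hasSum_gradient3_randomization {ψ : R3 → ℝ} {c : (Fin 3 → ℤ) → ℂ}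
    {f : Lp ℂ 2 (volume : Measure R3)}
    (h : Summable fun k => c k • wienerProj ψ k (f : 𝓢'(R3, ℂ))) (m : R3 → ℝ) (t : ℝ) (i : Fin 3)
    (φ : 𝓢(R3, ℂ)) :
    HasSum (fun k => c k * gradient3 (iOperator m (schrodinger t
      (wienerProj ψ k (f : 𝓢'(R3, ℂ))))) i φ)
      (gradient3 (iOperator m (schrodinger t (wienerRandomization ψ c f))) i φ) := by
  have h1 := hasSum_eval (((h.hasSum.mapL (schrodinger t)).mapL (iOperator m)).mapL
    (LineDeriv.lineDerivOpCLM ℂ 𝓢'(R3, ℂ) (EuclideanSpace.single i (1 : ℝ) : R3))) φ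
  refine h1.congr_fun fun k => ?_
  simp only [map_smul]
  rfl

end RandomizedSeries

/-! ### Decomposition of the randomized evolution into dyadic blocks -/

section BlockSums

/-- The evolution of the `i`-th component of `∇ I Q_k f`, for `k` in the `j`-th dyadic block and
`f` with radial Fourier transform `G`. -/
noncomputable def blockTerm (ψ m : R3 → ℝ) (G : ℝ → ℂ) (j : ℕ) (i : Fin 3) (k : Fin 3 → ℤ) :
    ℝ → R3 → ℂ :=
  freeEvolution fun ξ =>
    (ψ ((2 * Real.pi) • ξ - latticePoint k) : ℂ) * ((ξ i : ℂ) * shellProfile m G j ‖ξ‖)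

theorem IsWienerProfile.integrable_mul {ψ : R3 → ℝ} (hψ : IsWienerProfile ψ) (k : Fin 3 → ℤ)
    {A : R3 → ℂ} (hA : Integrable A) :
    Integrable fun ξ => (ψ ((2 * Real.pi) • ξ - latticePoint k) : ℂ) * A ξ := by
  simp_rw [← hψ.schwartz_sub k]
  set S := SchwartzMap.compSubConstCLM ℂ ((2 * Real.pi)⁻¹ • latticePoint k) hψ.schwartz
  exact hA.bdd_mul S.continuous.aestronglyMeasurable
    (Filter.Eventually.of_forall fun ξ => SchwartzMap.norm_le_seminorm ℂ S ξ)

theorem norm_freeEvolution_le (A : R3 → ℂ) (t : ℝ) (x : R3) :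
    ‖freeEvolution A t x‖ ≤ ∫ ξ, ‖A ξ‖ := by
  rw [freeEvolution, Real.fourierInv_eq']
  refine (norm_integral_le_integral_norm _).trans (le_of_eq (integral_congr_ae
    (Filter.Eventually.of_forall fun ξ => ?_)))
  simp only [norm_smul, norm_mul, norm_schrodinger_symbol, Complex.norm_exp_ofReal_mul_I, one_mul]

theorem sum_mul_freeEvolution_eq {ι : Type*} (K : Finset ι) (c : ι → ℂ) {A : ι → R3 → ℂ}
    (hA : ∀ k, Integrable (A k)) (t : ℝ) :
    (fun x => ∑ k ∈ K, c k * freeEvolution (A k) t x) =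
      𝓕⁻ fun ξ : R3 => ∑ k ∈ K, c k * (Complex.exp (-(Complex.I * (t : ℂ) *
        ((‖(2 * Real.pi) • ξ‖ ^ 2 : ℝ) : ℂ))) * A k ξ) := by
  ext x
  simp only [freeEvolution, Real.fourierInv_eq', ← integral_const_mul, smul_eq_mul, Finset.mul_sum]
  rw [integral_finsetSum]
  · refine Finset.sum_congr rfl fun k _ => ?_
    congr 1
    ext ξ
    ring
  · intro k _
    exact integrable_modulation ((integrable_schrodinger_mul (hA k) t).const_mul (c k)) x

variable {ψ : R3 → ℝ} {σ N : ℝ} {m : R3 → ℝ} {G : ℝ → ℂ}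

theorem eLpNorm_block_sum_le (hψ : IsWienerProfile ψ) (hm : IsISymbol σ N m) (hG : Measurable G)
    (hG2 : MemLp (fun ξ : R3 => G ‖ξ‖) 2) {r C : ℝ≥0∞} {ε p : ℝ}
    (hC : ∀ (j : ℕ) (A : R3 → ℂ), Integrable A → (∀ ξ, A ξ ≠ 0 → ‖ξ‖ ≤ 2 ^ j) →
        eLpNorm (𝓕⁻ A) r volume ≤
          C * ENNReal.ofReal ((2 : ℝ) ^ (ε * j)) * (∫⁻ y, ‖𝓕⁻ A y‖ₑ ^ p) ^ (1 / p))
    (c : (Fin 3 → ℤ) → ℂ) (K : Finset (Fin 3 → ℤ)) (j : ℕ) (i : Fin 3) (t : ℝ) :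
    eLpNorm (fun x => ∑ k ∈ K, c k * blockTerm ψ m G j i k t x) r volume ≤
      C * ENNReal.ofReal ((2 : ℝ) ^ (ε * j)) *
        (∫⁻ x, ‖∑ k ∈ K, c k * blockTerm ψ m G j i k t x‖ₑ ^ p) ^ (1 / p) := by
  have hint : ∀ k, Integrable fun ξ : R3 => (ψ ((2 * Real.pi) • ξ - latticePoint k) : ℂ) *
      ((ξ i : ℂ) * shellProfile m G j ‖ξ‖) := fun k =>
    hψ.integrable_mul k (integrable_coord_mul_shellProfile hm hG hG2 j i)
  have heq := sum_mul_freeEvolution_eq K c hint t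
  have h := hC j _ (integrable_finsetSum K fun k _ =>
    (integrable_schrodinger_mul (hint k) t).const_mul (c k)) fun ξ hξ => by
      by_contra hlt
      exact hξ (Finset.sum_eq_zero fun k _ => by
        rw [shellProfile_eq_zero (not_le.1 hlt)]; ring)
  rw [← heq] at h
  exact h

theorem measurable_blockTerm (hψ : IsWienerProfile ψ) (hm : IsISymbol σ N m) (hG : Measurable G)
    (hG2 : MemLp (fun ξ : R3 => G ‖ξ‖) 2) (j : ℕ) (i : Fin 3) (k : Fin 3 → ℤ) :
    Measurable (Function.uncurry (blockTerm ψ m G j i k)) :=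
  (continuous_freeEvolution
    (hψ.integrable_mul k (integrable_coord_mul_shellProfile hm hG hG2 j i))).measurable

theorem integrable_schwartz_mul_blockTerm (hψ : IsWienerProfile ψ) (hm : IsISymbol σ N m)
    (hG : Measurable G) (hG2 : MemLp (fun ξ : R3 => G ‖ξ‖) 2) (j : ℕ) (i : Fin 3)
    (k : Fin 3 → ℤ) (t : ℝ) (c : ℂ) (φ : 𝓢(R3, ℂ)) :
    Integrable fun x => φ x * (c * blockTerm ψ m G j i k t x) := by
  have h1 : Measurable fun x => blockTerm ψ m G j i k t x :=
    (measurable_blockTerm hψ hm hG hG2 j i k).of_uncurry_left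
  obtain ⟨B, hB⟩ : ∃ B, ∀ x, ‖blockTerm ψ m G j i k t x‖ ≤ B :=
    ⟨_, fun x => norm_freeEvolution_le _ t x⟩
  generalize blockTerm ψ m G j i k t = u at h1 hB ⊢
  refine φ.integrable.mul_bdd (c := ‖c‖ * B) (h1.const_mul c).aestronglyMeasurable
    (Filter.Eventually.of_forall fun x => ?_)
  rw [norm_mul]
  exact mul_le_mul_of_nonneg_left (hB x) (norm_nonneg _)

/-- Convergence is unconditional, so the lattice sum may be grouped by dyadic level. Each group is a
finite sum of functions, to which L^r estimates apply. -/
theorem hasSum_integral_block (hψ : IsWienerProfile ψ) (hN : 0 < N) (hσ : σ < 1)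
    (hm : IsISymbol σ N m) {f : Lp ℂ 2 (volume : Measure R3)} (hG : Measurable G)
    (hG2 : MemLp (fun ξ : R3 => G ‖ξ‖) 2)
    (hf : ∀ᵐ ξ : R3, (𝓕 f : Lp ℂ 2 (volume : Measure R3)) ξ = G ‖ξ‖) {c : (Fin 3 → ℤ) → ℂ}
    (hsum : Summable fun k => c k • wienerProj ψ k (f : 𝓢'(R3, ℂ))) (t : ℝ) (i : Fin 3)
    (φ : 𝓢(R3, ℂ)) :
    HasSum (fun j => ∫ x, φ x * ∑ k ∈ dyadicBlock j, c k * blockTerm ψ m G j i k t x)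
      (gradient3 (iOperator m (schrodinger t (wienerRandomization ψ c f))) i φ) := by
  refine (hasSum_dyadicBlock (hasSum_gradient3_randomization hsum m t i φ)).congr_fun fun j => ?_
  have hint : ∀ k, Integrable fun ξ : R3 => (ψ ((2 * Real.pi) • ξ - latticePoint k) : ℂ) *
      ((ξ i : ℂ) * shellProfile m G j ‖ξ‖) := fun k =>
    hψ.integrable_mul k (integrable_coord_mul_shellProfile hm hG hG2 j i)
  have hterm : ∀ k ∈ dyadicBlock j, ∫ x, φ x * (c k * blockTerm ψ m G j i k t x) =
      c k * gradient3 (iOperator m (schrodinger t (wienerProj ψ k (f : 𝓢'(R3, ℂ))))) i φ := by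
    intro k hk
    have hae := wiener_mul_gradIData_ae_eq hψ hm hf (mem_dyadicBlock.1 hk) i
    rw [gradient3_wienerProj_apply hψ hN hσ hm f k t i ((integrable_congr hae).2 (hint k)) φ,
      ← integral_const_mul]
    refine integral_congr_ae (Filter.Eventually.of_forall fun x => ?_)
    simp only [freeEvolution_congr_ae hae, blockTerm]
    ring
  rw [← Finset.sum_congr rfl hterm]
  simp only [Finset.mul_sum]
  refine (integral_finsetSum _ fun k _ => ?_)
  exact integrable_schwartz_mul_blockTerm hψ hm hG hG2 j i k t (c k) φ

/-- The norm of the randomized evolution is at most the sum of the norms of its blocks. -/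
theorem mixedNorm_randomization_le (hψ : IsWienerProfile ψ) (hN : 0 < N) (hσ : σ < 1)
    (hm : IsISymbol σ N m) {f : Lp ℂ 2 (volume : Measure R3)} (hG : Measurable G)
    (hG2 : MemLp (fun ξ : R3 => G ‖ξ‖) 2)
    (hf : ∀ᵐ ξ : R3, (𝓕 f : Lp ℂ 2 (volume : Measure R3)) ξ = G ‖ξ‖)
    {r C : ℝ≥0∞} (hr : 1 ≤ r) (hCt : C ≠ ∞) {ε p : ℝ}
    (hC : ∀ (j : ℕ) (A : R3 → ℂ), Integrable A → (∀ ξ, A ξ ≠ 0 → ‖ξ‖ ≤ 2 ^ j) →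
        eLpNorm (𝓕⁻ A) r volume ≤
          C * ENNReal.ofReal ((2 : ℝ) ^ (ε * j)) * (∫⁻ y, ‖𝓕⁻ A y‖ₑ ^ p) ^ (1 / p))
    (c : (Fin 3 → ℤ) → ℂ) :
    mixedNorm r (fun t => gradient3 (iOperator m (schrodinger t (wienerRandomization ψ c f)))) ≤
      ∑' b : ℕ × Fin 3, C * ENNReal.ofReal ((2 : ℝ) ^ (ε * b.1)) *
        (∫⁻ t, (∫⁻ x, ‖∑ k ∈ dyadicBlock b.1, c k * blockTerm ψ m G b.1 b.2 k t x‖ₑ ^ p) ^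
          (2 / p)) ^ (1 / 2 : ℝ) := by
  have hmeas : ∀ b : ℕ × Fin 3, Measurable fun z : ℝ × R3 =>
      ∑ k ∈ dyadicBlock b.1, c k * blockTerm ψ m G b.1 b.2 k z.1 z.2 := fun b =>
    Finset.measurable_sum _ fun k _ =>
      (measurable_blockTerm hψ hm hG hG2 b.1 b.2 k).const_mul (c k)
  have hdist : ∀ t, distLpNorm r (gradient3 (iOperator m (schrodinger t
      (wienerRandomization ψ c f)))) ≤ ∑' b : ℕ × Fin 3, C * ENNReal.ofReal ((2 : ℝ) ^ (ε * b.1)) *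
        (∫⁻ x, ‖∑ k ∈ dyadicBlock b.1, c k * blockTerm ψ m G b.1 b.2 k t x‖ₑ ^ p) ^ (1 / p) := by
    intro t
    by_cases hsum : Summable fun k => c k • wienerProj ψ k (f : 𝓢'(R3, ℂ))
    · refine (distLpNorm_le_tsum hr (h := fun j i x =>
        ∑ k ∈ dyadicBlock j, c k * blockTerm ψ m G j i k t x) (fun j i => ?_) fun i φ =>
          hasSum_integral_block hψ hN hσ hm hG hG2 hf hsum t i φ).trans
        (ENNReal.tsum_le_tsum fun b => eLpNorm_block_sum_le hψ hm hG hG2 hC c _ b.1 b.2 t)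
      exact ((hmeas (j, i)).comp measurable_prodMk_left).aestronglyMeasurable
    -- A series that does not converge has the default sum 0, and the bound is then trivial; no
    -- almost sure convergence has to be proved.
    · have h0 : wienerRandomization ψ c f = 0 := tsum_eq_zero_of_not_summable hsum
      have hz : ∀ i, gradient3 (iOperator m (schrodinger t (wienerRandomization ψ c f))) i = 0 :=
        fun i => by
          rw [h0, map_zero, map_zero]
          exact map_zero (LineDeriv.lineDerivOpCLM ℂ 𝓢'(R3, ℂ)
            (EuclideanSpace.single i (1 : ℝ) : R3))
      refine (iInf₂_le (fun _ => 0) ⟨MemLp.zero', fun i φ => ?_⟩).trans ?_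
      · simp
      · rw [hz i]
        simp
  refine (mixedNorm_le_tsum (fun b => ?_) hdist).trans (ENNReal.tsum_le_tsum fun b => le_of_eq ?_)
  · exact ((((hmeas b).enorm.pow_const p).lintegral_prod_right').pow_const _).const_mul _
  · have hct : C * ENNReal.ofReal ((2 : ℝ) ^ (ε * b.1)) ≠ ∞ :=
      ENNReal.mul_ne_top hCt ENNReal.ofReal_ne_top
    simp_rw [mul_pow]
    rw [lintegral_const_mul' _ _ (by finiteness), ENNReal.mul_rpow_of_nonneg _ _ (by norm_num)]
    congr 1
    · rw [← mul_pow, ← ENNReal.rpow_natCast, ← ENNReal.rpow_mul]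
      norm_num
    · congr 2
      ext t
      rw [← ENNReal.rpow_natCast, ← ENNReal.rpow_mul]
      congr 1
      push_cast
      ring

end BlockSums

/-! ### Summation over dyadic levels -/

section TailBound

theorem tsum_ofReal_two_rpow_ne_top {ε : ℝ} (hε : 0 < ε) :
    ∑' b : ℕ × Fin 3, ENNReal.ofReal ((2 : ℝ) ^ (-(ε * b.1))) ≠ ∞ := by
  have hq1 : (2 : ℝ) ^ (-ε) < 1 := Real.rpow_lt_one_of_one_lt_of_neg one_lt_two (by linarith)
  have h : ∀ j : ℕ, ENNReal.ofReal ((2 : ℝ) ^ (-(ε * j))) = ENNReal.ofReal ((2 : ℝ) ^ (-ε)) ^ j :=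
    fun j => by
      rw [← ENNReal.ofReal_pow (by positivity), ← Real.rpow_natCast, ← Real.rpow_mul (by norm_num),
        neg_mul]
  rw [ENNReal.tsum_prod (f := fun (j : ℕ) (_ : Fin 3) => ENNReal.ofReal ((2 : ℝ) ^ (-(ε * j))))]
  simp_rw [tsum_fintype, h, Finset.sum_const]
  simp only [Finset.card_univ, Fintype.card_fin, nsmul_eq_mul]
  rw [ENNReal.tsum_mul_left, ENNReal.tsum_geometric]
  refine ENNReal.mul_ne_top (by norm_num) (ENNReal.inv_ne_top.2 ?_)
  rw [Ne, tsub_eq_zero_iff_le, not_le, ← ENNReal.ofReal_one]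
  exact (ENNReal.ofReal_lt_ofReal_iff one_pos).2 hq1

/-- Gaussian moments of the majorant of the randomized evolution. -/
theorem exists_lintegral_majorant_le {ψ : R3 → ℝ} (hψ : IsWienerProfile ψ) (κ : ℝ)
    {σ β ε s : ℝ} (hβ : 0 ≤ β) (hβσ : β ≤ 1 - σ) (hβ1 : 2 * β ≤ 1) (hε : 0 < ε)
    (hs : 1 - 2 * s + 4 * ε = 2 * β) {p : ℝ} (hp : 4 < p) {C : ℝ≥0∞} (hC : C ≠ ∞) :
    ∃ D : ℝ, 0 < D ∧ ∀ (Ω : Type*) [MeasurableSpace Ω] (P : Measure Ω) [IsProbabilityMeasure P]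
        (g : (Fin 3 → ℤ) → Ω → ℂ), IsGaussianFamily P κ g →
      ∀ (f : Lp ℂ 2 (volume : Measure R3)) (G : ℝ → ℂ), Measurable G →
        (∀ᵐ ξ : R3, (𝓕 f : Lp ℂ 2 (volume : Measure R3)) ξ = G ‖ξ‖) → hsNorm s f ≠ ∞ →
      ∀ N : ℝ, 1 ≤ N → ∀ m : R3 → ℝ, IsISymbol σ N m → ∀ n : ℕ, 2 ≤ n → p ≤ n →
      (∫⁻ ω, (∑' b : ℕ × Fin 3, C * ENNReal.ofReal ((2 : ℝ) ^ (ε * b.1)) *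
        (∫⁻ t, (∫⁻ x, ‖∑ k ∈ dyadicBlock b.1, g k ω * blockTerm ψ m G b.1 b.2 k t x‖ₑ ^ p) ^
          (2 / p)) ^ (1 / 2 : ℝ)) ^ (n : ℝ) ∂P) ^ (1 / (n : ℝ)) ≤
        ENNReal.ofReal (D * N ^ β * (hsNorm s f).toReal * √n) := by
  obtain ⟨C₂, hC₂, hsq⟩ := exists_lintegral_square_function_le hψ hp
  set C₃ : ℝ≥0∞ := (C₂ * ENNReal.ofReal (6 * Real.pi * 4 ^ (4 * ε))) ^ (1 / 2 : ℝ) with hC₃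
  have hC₃t : C₃ ≠ ∞ := ENNReal.rpow_ne_top_of_nonneg (by norm_num)
    (ENNReal.mul_ne_top hC₂ ENNReal.ofReal_ne_top)
  set S := ∑' b : ℕ × Fin 3, ENNReal.ofReal ((2 : ℝ) ^ (-(ε * b.1))) with hS
  have hSt : S ≠ ∞ := tsum_ofReal_two_rpow_ne_top hε
  have hCS : C * C₃ * S ≠ ∞ := ENNReal.mul_ne_top (ENNReal.mul_ne_top hC hC₃t) hSt
  -- Adding 1 only ensures positivity, for instance when κ = 0.
  refine ⟨8 * √κ * (C * C₃ * S).toReal + 1, by positivity, ?_⟩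
  intro Ω _ P _ g hg f G hGm hG hfs N hN m hm n hn hpn
  have hN0 : 0 < N := by linarith
  have hG2 : MemLp (fun ξ : R3 => G ‖ξ‖) 2 := (memLp_congr_ae hG).1 (Lp.memLp _)
  have hF : ∀ (b : ℕ × Fin 3) k, Measurable (Function.uncurry (blockTerm ψ m G b.1 b.2 k)) :=
    fun b k => measurable_blockTerm hψ hm hGm hG2 b.1 b.2 k
  have hn1 : (1 : ℝ) ≤ n := by exact_mod_cast (by lia : 1 ≤ n)
  have hblock : ∀ b : ℕ × Fin 3, (∫⁻ t, (∫⁻ x, (∑ k ∈ dyadicBlock b.1,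
      ‖blockTerm ψ m G b.1 b.2 k t x‖ₑ ^ 2) ^ (p / 2)) ^ (2 / p)) ^ (1 / 2 : ℝ) ≤
        C₃ * (ENNReal.ofReal (N ^ β * (2 : ℝ) ^ (-(2 * ε * b.1))) * hsNorm s f) := by
    intro b
    have h1 := hsq (shellProfile m G b.1) (measurable_shellProfile hm hGm b.1)
      (fun l => integrable_coord_mul_shellProfile hm hGm hG2 b.1 l)
      (fun l => memLp_coord_mul_shellProfile hm hGm hG2 b.1 l) (dyadicBlock b.1) b.2
    have h2 := h1.trans (mul_le_mul_right
      (lintegral_shellProfile_le hβ hβσ hβ1 hε.le hs hN hm hG b.1) C₂)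
    refine (ENNReal.rpow_le_rpow h2 (by norm_num : (0 : ℝ) ≤ 1 / 2)).trans (le_of_eq ?_)
    rw [← mul_assoc, ENNReal.mul_rpow_of_nonneg _ _ (by norm_num), hC₃]
    congr 1
    rw [← ENNReal.rpow_natCast, ← ENNReal.rpow_mul]
    norm_num
  have hXm : ∀ b : ℕ × Fin 3, Measurable fun ω => (∫⁻ t, (∫⁻ x, ‖∑ k ∈ dyadicBlock b.1,
      g k ω * blockTerm ψ m G b.1 b.2 k t x‖ₑ ^ p) ^ (2 / p)) ^ (1 / 2 : ℝ) := fun b =>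
    ((measurable_lintegral_random_sum hg.measurable (hF b) (dyadicBlock b.1)
      p).lintegral_prod_right').pow_const _
  refine (lintegral_rpow_tsum_le (fun b => (hXm b).const_mul _) hn1).trans ?_
  have hterm : ∀ b : ℕ × Fin 3, (∫⁻ ω, (C * ENNReal.ofReal ((2 : ℝ) ^ (ε * b.1)) *
      (∫⁻ t, (∫⁻ x, ‖∑ k ∈ dyadicBlock b.1, g k ω * blockTerm ψ m G b.1 b.2 k t x‖ₑ ^ p) ^
        (2 / p)) ^ (1 / 2 : ℝ)) ^ (n : ℝ) ∂P) ^ (1 / (n : ℝ)) ≤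
      C * C₃ * (ENNReal.ofReal (8 * √(n * κ) * N ^ β) * hsNorm s f) *
        ENNReal.ofReal ((2 : ℝ) ^ (-(ε * b.1))) := by
    intro b
    have hct : C * ENNReal.ofReal ((2 : ℝ) ^ (ε * b.1)) ≠ ∞ :=
      ENNReal.mul_ne_top hC ENNReal.ofReal_ne_top
    have hmoment := (hg.lintegral_mixed_sum_le (hF b) (dyadicBlock b.1) (by linarith : 0 < p)
      hn hpn).trans (mul_le_mul_right (hblock b) _)
    -- The Bernstein loss 2^{εj} uses up half of the gain 2^{-2εj} from the shell; the other half
    -- makes the sum over j converge.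
    have hpow : (2 : ℝ) ^ (ε * b.1) * (2 : ℝ) ^ (-(2 * ε * b.1)) = (2 : ℝ) ^ (-(ε * b.1)) := by
      rw [← Real.rpow_add (by norm_num)]
      congr 1
      ring
    set a := C * ENNReal.ofReal ((2 : ℝ) ^ (ε * b.1)) with ha
    simp_rw [ENNReal.mul_rpow_of_nonneg a _ (by linarith : (0 : ℝ) ≤ n)]
    rw [lintegral_const_mul' _ _ (ENNReal.rpow_ne_top_of_nonneg (by linarith) hct),
      ENNReal.mul_rpow_of_nonneg _ _ (by positivity), ← ENNReal.rpow_mul,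
      mul_one_div_cancel (by linarith : (n : ℝ) ≠ 0), ENNReal.rpow_one]
    refine (mul_le_mul_right hmoment a).trans (le_of_eq ?_)
    rw [ha, ← hpow, ENNReal.ofReal_mul (p := N ^ β) (by positivity),
      ENNReal.ofReal_mul (p := 8 * √(n * κ)) (by positivity),
      ENNReal.ofReal_mul (p := (2 : ℝ) ^ (ε * b.1)) (by positivity)]
    ring
  refine (ENNReal.tsum_le_tsum hterm).trans ?_
  rw [ENNReal.tsum_mul_left, ← hS, Real.sqrt_mul (Nat.cast_nonneg n)]
  have heq : C * C₃ * (ENNReal.ofReal (8 * (√n * √κ) * N ^ β) * hsNorm s f) * S =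
      ENNReal.ofReal (8 * √κ * (C * C₃ * S).toReal * N ^ β * (hsNorm s f).toReal * √n) := by
    rw [← ENNReal.ofReal_toReal hfs, ENNReal.toReal_ofReal ENNReal.toReal_nonneg,
      show C * C₃ * (ENNReal.ofReal (8 * (√n * √κ) * N ^ β) *
        ENNReal.ofReal (hsNorm s f).toReal) * S = (C * C₃ * S) *
        (ENNReal.ofReal (8 * (√n * √κ) * N ^ β) * ENNReal.ofReal (hsNorm s f).toReal) by ring]
    nth_rewrite 1 [← ENNReal.ofReal_toReal hCS]
    rw [← ENNReal.ofReal_mul (by positivity), ← ENNReal.ofReal_mul (by positivity)]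
    congr 1
    ring
  rw [heq]
  refine ENNReal.ofReal_le_ofReal ?_
  gcongr
  linarith

end TailBound

/-! ### Choice of the exponents and conclusion -/

theorem mainTheorem7 (ψ : R3 → ℝ) (hψ : IsWienerProfile ψ) (κ : ℝ)
    (s σ : ℝ) (hs : 1 / 4 < s) (hσ : 1 / 2 < σ) (hσ_lt_one : σ < 1) (hσs : σ < 2 * s)
    (r : ℝ≥0∞) (hr : 4 < r)
    (δ : ℝ) (hδ : 0 < δ) (hδ_small : δ < min s (1 / 2) - σ / 2) :
    ∃ N₀ C c : ℝ, 0 < N₀ ∧ 0 < C ∧ 0 < c ∧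
      ∀ (Ω : Type*) [MeasurableSpace Ω] (P : Measure Ω) [IsProbabilityMeasure P]
        (g : (Fin 3 → ℤ) → Ω → ℂ), IsGaussianFamily P κ g →
      ∀ f₀ : Lp ℂ 2 (volume : Measure R3), IsRadial f₀ → hsNorm s f₀ < ∞ →
      ∀ lam : ℝ, 0 < lam → ∀ N : ℝ, N₀ ≤ N → ∀ m : R3 → ℝ, IsISymbol σ N m →
        P.real {ω | ENNReal.ofReal lam <
            mixedNorm r (fun t => gradient3 (iOperator m (schrodinger t
              (wienerRandomization ψ (fun k => g k ω) f₀))))} ≤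
          C * Real.exp (-c * lam ^ 2 *
            (N ^ (-δ) * N ^ ((1 - σ) / 2) * (hsNorm s f₀).toReal) ^ (-2 : ℤ)) := by
  have hδs : δ < s - σ / 2 := hδ_small.trans_le (by linarith [min_le_left s (1 / 2)])
  have hδh : δ < 1 / 2 - σ / 2 := hδ_small.trans_le (by linarith [min_le_right s (1 / 2)])
  -- β is the power of N in the final bound, and ε is then forced by 1 - 2s + 4ε = 2β. The bound δ <
  -- 1/2 - σ/2 gives β ≥ 0, and δ < s - σ/2 gives ε > 0.
  set β := (1 - σ) / 2 - δ with hβdef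
  set ε := (2 * s - σ - 2 * δ) / 4 with hεdef
  have hβ : 0 ≤ β := by rw [hβdef]; linarith
  have hε : 0 < ε := by rw [hεdef]; linarith
  obtain ⟨p, hp, C₁, hC₁, hbern⟩ := exists_eLpNorm_fourierInv_le hr hε
  obtain ⟨D, hD, hmom⟩ := exists_lintegral_majorant_le hψ κ (σ := σ) hβ (by linarith)
    (by linarith) hε (by rw [hβdef, hεdef]; ring) hp hC₁
  -- The smallest moment for which both exchanges by Minkowski's inequality are allowed.
  set n₀ : ℕ := max 2 ⌈p⌉₊ with hn₀
  refine ⟨1, Real.exp (n₀ + 1), 1 / (Real.exp 1 * D) ^ 2, one_pos, Real.exp_pos _,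
    by positivity, ?_⟩
  intro Ω _ P _ g hg f₀ hrad hfin lam hlam N hN m hm
  have hN0 : 0 < N := by linarith
  have hNβ : N ^ (-δ) * N ^ ((1 - σ) / 2) = N ^ β := by
    rw [← Real.rpow_add hN0, hβdef]
    congr 1
    ring
  rw [hNβ]
  -- For a vanishing norm the inverse square takes the default value 0, so the bound reads C ≥ 1.
  rcases eq_or_lt_of_le (ENNReal.toReal_nonneg (a := hsNorm s f₀)) with h0 | hpos
  · rw [← h0, mul_zero, zero_zpow _ (by norm_num), mul_zero, Real.exp_zero, mul_one]
    exact measureReal_le_one.trans (Real.one_le_exp (by positivity))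
  obtain ⟨G, hGm, hG⟩ := hrad.exists_fourier_ae_eq
  have hG2 : MemLp (fun ξ : R3 => G ‖ξ‖) 2 := (memLp_congr_ae hG).1 (Lp.memLp _)
  -- The moments are taken of this measurable majorant; the tail event itself need not be
  -- measurable, as monotonicity of the measure suffices.
  set X : Ω → ℝ≥0∞ := fun ω => ∑' b : ℕ × Fin 3, C₁ * ENNReal.ofReal ((2 : ℝ) ^ (ε * b.1)) *
    (∫⁻ t, (∫⁻ x, ‖∑ k ∈ dyadicBlock b.1, g k ω * blockTerm ψ m G b.1 b.2 k t x‖ₑ ^ p) ^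
      (2 / p)) ^ (1 / 2 : ℝ) with hX
  have hXm : Measurable X := Measurable.tsum fun b =>
    (((measurable_lintegral_random_sum hg.measurable (fun k =>
      measurable_blockTerm hψ hm hGm hG2 b.1 b.2 k) (dyadicBlock b.1)
      p).lintegral_prod_right').pow_const _).const_mul _
  have htail := measureReal_lt_le_of_moments hXm (n₀ := n₀) (by lia)
    (A := D * N ^ β * (hsNorm s f₀).toReal) (by positivity) (fun n hn => by
      refine hmom Ω P g hg f₀ G hGm hG hfin.ne N hN m hm n (by lia) ?_
      exact (Nat.le_ceil p).trans (by exact_mod_cast (le_max_right _ _).trans hn)) hlam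
  refine (measureReal_mono fun ω (hω : ENNReal.ofReal lam < _) => lt_of_lt_of_le hω
    (mixedNorm_randomization_le hψ hN0 hσ_lt_one hm hGm hG2 hG
      ((by norm_num : (1 : ℝ≥0∞) ≤ 4).trans hr.le) hC₁ hbern fun k => g k ω)).trans
        (htail.trans (le_of_eq ?_))
  congr 2
  rw [zpow_neg, zpow_ofNat]
  field_simp
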